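/- Let $n\ge 3$ and place $2n$ points on a circle, labelled clockwise $1,2,\dots,2n$ (labels are taken modulo $2n$). Odd points are called hollow and even points solid; their convex hulls are the hollow and the solid polygon. A hollow (resp. solid) diagonal is a segment joining two distinct hollow (resp. solid) points; it is internal if it is not a boundary edge of the hollow (resp. solid) polygon. Two diagonals cross if their four endpoints are distinct and alternate on the circle. Let $D_\circ$ be a hollow dissection, i.e. a set of pairwise non-crossing internal hollow diagonals, and let $\overline{D}_\circ$ be $D_\circ$ together with all boundary edges of the hollow polygon. A solid diagonal is a $D_\circ$-accordion diagonal if the diagonals of $\overline{D}_\circ$ that it crosses form a connected set, and a $D_\circ$-accordion dissection is a set of pairwise non-crossing internal $D_\circ$-accordion diagonals. For a solid diagonal $\delta$ define its $d$-vector $d(D_\circ\,|\,\delta)\in\mathbb{R}^{D_\circ}$ as follows: its coordinate at $ij\in D_\circ$ is $-1$ if $\delta=(i-1)(j-1)$, is $1$ if $\delta$ crosses $(i-1)(j-1)$, and is $0$ otherwise. For a $D_\circ$-accordion dissection $A$ let $C(A)=\mathbb{R}_{\ge 0}\,\{d(D_\circ\,|\,\delta):\delta\in A\}$ be the cone spanned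 by the $d$-vectors of its diagonals. **Theorem.** The collection of cones $\{C(A) : A \text{ a } D_\circ\text{-accordion dissection}\}$ is a complete simplicial fan in $\mathbb{R}^{D_\circ}$ (a finite collection of simplicial cones, closed under taking faces, in which any two cones intersect along a common face of both, and whose union is $\mathbb{R}^{D_\circ}$) if and only if $D_\circ$ has no even interior cell, that is, no cell with an even number of edges all of which are internal diagonals in $D_\circ$. Moreover, in this case the fan realizes the complex of $D_\circ$-accordion dissections: for all $D_\circ$-accordion dissections $A$ and $B$, $C(A)\subseteq C(B)$ if and only if $A\subseteq B$. -/

import Mathlib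

namespace Accordion

/-! ### Diagonals

The `2n` points on the circle are labelled clockwise by the residues modulo `2n`;
odd labels are hollow, even labels are solid (the label `2n` is the residue `0`). -/

/-- A segment joining two of the `2n` points, as the unordered pair of its endpoints. -/
abbrev Diag (n : ℕ) : Type := Sym2 (ZMod (2 * n))

/-- A hollow diagonal: it joins two distinct hollow points. -/
def IsHollow {n : ℕ} (δ : Diag n) : Prop := ¬ δ.IsDiag ∧ ∀ v ∈ δ, Odd v.val

/-- A solid diagonal: it joins two distinct solid points. -/
def IsSolid {n : ℕ} (δ : Diag n) : Prop := ¬ δ.IsDiag ∧ ∀ v ∈ δ, Even v.val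

/-- Boundary edges of the hollow and of the solid polygon join points whose labels differ by 2. -/
def IsBoundary {n : ℕ} (δ : Diag n) : Prop := ∃ v : ZMod (2 * n), δ = s(v, v + 2)

/-- Two diagonals cross when their four endpoints are distinct and alternate on the circle.
Here `sbtw a c b` means that `c` lies strictly between `a` and `b`, clockwise from `a` to `b`. -/
def Cross {n : ℕ} (δ ε : Diag n) : Prop :=
  ∃ a b c d : ZMod (2 * n), δ = s(a, b) ∧ ε = s(c, d) ∧ sbtw a c b ∧ sbtw b d a

/-- The diagonal `(i-1)(j-1)` obtained from `ij` by rotating one step counterclockwise. -/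
def rotate {n : ℕ} (δ : Diag n) : Diag n := δ.map (fun v => v - 1)

/-! ### Dissections and accordions -/

/-- A hollow dissection: a set of pairwise non-crossing internal hollow diagonals. -/
def IsHollowDissection {n : ℕ} (D : Finset (Diag n)) : Prop :=
  (∀ δ ∈ D, IsHollow δ ∧ ¬ IsBoundary δ) ∧ ∀ δ ∈ D, ∀ ε ∈ D, ¬ Cross δ ε

/-- The dissection `D` together with all boundary edges of the hollow polygon. -/
def withBoundary {n : ℕ} (D : Finset (Diag n)) : Set (Diag n) :=
  {δ | δ ∈ D ∨ (IsHollow δ ∧ IsBoundary δ)}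

/-- A set of pairwise non-crossing diagonals is connected when any two of them are linked by a
chain of diagonals of the set in which consecutive diagonals share an endpoint. -/
def IsConnected {n : ℕ} (S : Set (Diag n)) : Prop :=
  ∀ δ ∈ S, ∀ ε ∈ S, Relation.ReflTransGen (fun α β => β ∈ S ∧ ∃ v, v ∈ α ∧ v ∈ β) δ ε

/-- A solid diagonal is a `D`-accordion diagonal when the diagonals of `D` and hollow boundary
edges that it crosses form a connected set. -/
def IsAccordionDiagonal {n : ℕ} (D : Finset (Diag n)) (δ : Diag n) : Prop :=
  IsSolid δ ∧ IsConnected {ε | ε ∈ withBoundary D ∧ Cross δ ε}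

/-- A `D`-accordion dissection: a set of pairwise non-crossing internal `D`-accordion diagonals. -/
def IsAccordionDissection {n : ℕ} (D A : Finset (Diag n)) : Prop :=
  (∀ δ ∈ A, IsAccordionDiagonal D δ ∧ ¬ IsBoundary δ) ∧ ∀ δ ∈ A, ∀ ε ∈ A, ¬ Cross δ ε

/-! ### Cells -/

/-- The edges of the convex polygon with vertex set `C`: they join consecutive points of `C`. -/
def sides {n : ℕ} (C : Finset (ZMod (2 * n))) : Set (Diag n) :=
  {δ | ∃ v ∈ C, ∃ w ∈ C, v ≠ w ∧ (∀ u ∈ C, ¬ sbtw v u w) ∧ δ = s(v, w)}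

/-- `C` is the vertex set of a cell of the hollow dissection `D`: every edge of the convex hull of
`C` is a diagonal of `D` or a boundary edge, and no diagonal of `D` subdivides this hull. -/
def IsCell {n : ℕ} (D : Finset (Diag n)) (C : Finset (ZMod (2 * n))) : Prop :=
  3 ≤ C.card ∧ (∀ v ∈ C, Odd v.val) ∧ sides C ⊆ withBoundary D ∧
    ∀ δ ∈ D, (∀ v ∈ δ, v ∈ C) → δ ∈ sides C

/-- `D` has a cell with an even number of edges (equivalently, of vertices), all of which are
internal diagonals of `D`. -/
def HasEvenInteriorCell {n : ℕ} (D : Finset (Diag n)) : Prop :=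
  ∃ C : Finset (ZMod (2 * n)), IsCell D C ∧ Even C.card ∧ ∀ δ ∈ sides C, δ ∈ D

/-! ### Compatibility vectors and their cones -/

open Classical in
/-- The compatibility degree of a hollow diagonal `δ` with a solid diagonal `ε`. -/
noncomputable def compat {n : ℕ} (δ ε : Diag n) : ℝ :=
  if ε = rotate δ then -1 else if Cross ε (rotate δ) then 1 else 0

/-- The `d`-vector of the solid diagonal `ε` with respect to `D`, a vector of `ℝ^D`. -/
noncomputable def dVector {n : ℕ} (D : Finset (Diag n)) (ε : Diag n) : D → ℝ :=
  fun δ => compat δ.1 ε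

/-- The cone of nonnegative combinations of the `d`-vectors of the diagonals of `A`. -/
noncomputable def dCone {n : ℕ} (D A : Finset (Diag n)) : PointedCone ℝ (D → ℝ) :=
  PointedCone.hull ℝ (dVector D '' (A : Set (Diag n)))

/-- The collection of the cones spanned by the `d`-vectors of all `D`-accordion dissections. -/
def dVectorFan {n : ℕ} (D : Finset (Diag n)) : Set (PointedCone ℝ (D → ℝ)) :=
  {K | ∃ A : Finset (Diag n), IsAccordionDissection D A ∧ K = dCone D A}

/-! ### Fans -/

/-- A complete simplicial fan: a finite collection of simplicial cones, closed under taking faces,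
in which any two cones intersect along a common face, and which covers the whole space. -/
structure IsCompleteSimplicialFan {E : Type*} [AddCommGroup E] [Module ℝ E]
    (F : Set (PointedCone ℝ E)) : Prop where
  finite : F.Finite
  simplicial : ∀ K ∈ F, K.IsSimplicial
  face_mem : ∀ K ∈ F, ∀ G : PointedCone ℝ E, G.IsFaceOf K → G ∈ F
  inter_face : ∀ K ∈ F, ∀ L ∈ F, (K ⊓ L).IsFaceOf K ∧ (K ⊓ L).IsFaceOf L
  complete : ∀ x : E, ∃ K ∈ F, x ∈ K

end Accordion

namespace Accordion

/-! Name points by indices: the hollow point `2 i + 1` and the solid point `2 i` both have index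
`i`, so the rotation of a hollow diagonal is the solid diagonal with the same pair of indices. A
nonnegative combination of pairwise non-crossing solid chords is encoded by its height function: `h
c` is the total weight of the chords passing over `c`. Since the chords do not cross, the weight of
the chords over a whole interval is the minimum of `h` on it (`IsFamily.cover_eq_min`).
Inclusion-exclusion then recovers the weights from `h`, and every `h` vanishing at both ends with
inner minimum zero occurs (`IsHeight.height_heightWeight`). The coordinate at `(p, q)` becomes
`edgeCoord` of `h p`, `h q` and the minimum `m` strictly between; it is strictly decreasing in `m`
and takes all real values. The accordion condition becomes an equation between block minima in each
cell (`IsGoodCell`).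

Given a vector of `ℝ^D`, heights are rebuilt cell by cell, downwards from the root edge `(0, n -
1)`. Once the heights at the ends of the top edge of a cell and the minimum over this edge are
known, the cell is governed by a cyclic system `u (i + 1) = max (X i - u i) 0`, where the `X i` are
the positive parts of the coordinates of its edges. One turn around the cell composes as many
antitone maps as there are edges. A solution always exists by continuity, so the cones always cover
the space. If the number of edges is odd, the turn is antitone and the solution is unique; if an
edge lies on the boundary, its `X` is zero, which resets the system and again forces uniqueness.
Hence without even interior cells every vector has exactly one nonnegative representation supported
on an accordion dissection (`exists_accordionFamily`, `IsAccordionFamily.unique`), and this alone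
yields the fan and the comparison of cones (`isCompleteSimplicialFan_of_unique`).

In an even interior cell, the system with all `X i = 1` has the two alternating solutions `0, 1, 0,
…` and `1, 0, 1, …`. They give two representations of the all-ones vector, concentrated at adjacent
corners of the cell (`exists_family_even_cell`). If the two cones met along a face, a generator of
one would lie in the other, and its chord would cross the rotations of three consecutive edges of
the cell, which is impossible for a chord with two ends. -/

/-! ### Minima of a function over integer intervals -/

/-- The minimum of `h` over the interval `[i, j]`. -/
noncomputable def intervalMin (h : ℕ → ℝ) (i j : ℕ) : ℝ := sInf (h '' Set.Icc i j)

section intervalMin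

variable {h h' : ℕ → ℝ} {i j k c : ℕ} {a : ℝ}

lemma le_intervalMin_iff (hij : i ≤ j) :
    a ≤ intervalMin h i j ↔ ∀ c, i ≤ c → c ≤ j → a ≤ h c := by
  unfold intervalMin
  rw [le_csInf_iff ((Set.finite_Icc i j).image h).bddBelow
    ((Set.nonempty_Icc.2 hij).image h)]
  constructor
  · intro H c h1 h2
    exact H _ ⟨c, ⟨h1, h2⟩, rfl⟩
  · rintro H _ ⟨c, ⟨h1, h2⟩, rfl⟩
    exact H c h1 h2

lemma intervalMin_le (hi : i ≤ c) (hj : c ≤ j) : intervalMin h i j ≤ h c :=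
  (le_intervalMin_iff (hi.trans hj)).1 le_rfl c hi hj

lemma intervalMin_self : intervalMin h i i = h i := by simp [intervalMin]

lemma intervalMin_split (hij : i ≤ j) (hjk : j < k) :
    intervalMin h i k = min (intervalMin h i j) (intervalMin h (j + 1) k) := by
  refine eq_of_forall_le_iff fun a => ?_
  rw [le_min_iff, le_intervalMin_iff hij, le_intervalMin_iff (by omega),
    le_intervalMin_iff (by omega)]
  constructor
  · intro H
    exact ⟨fun c h1 h2 => H c h1 (by omega), fun c h1 h2 => H c (by omega) h2⟩
  · rintro ⟨H1, H2⟩ c h1 h2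
    rcases le_or_gt c j with h3 | h3
    · exact H1 c h1 h3
    · exact H2 c h3 h2

lemma intervalMin_succ_right (hij : i ≤ j) :
    intervalMin h i (j + 1) = min (intervalMin h i j) (h (j + 1)) := by
  rw [intervalMin_split hij (Nat.lt_succ_self j), intervalMin_self]

lemma intervalMin_pred_right (hij : i < j) :
    intervalMin h i j = min (intervalMin h i (j - 1)) (h j) := by
  obtain ⟨j, rfl⟩ : ∃ j', j = j' + 1 := ⟨j - 1, by omega⟩
  exact intervalMin_succ_right (by omega)

lemma intervalMin_succ_left (hij : i < j) :
    intervalMin h i j = min (h i) (intervalMin h (i + 1) j) := by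
  rw [intervalMin_split le_rfl hij, intervalMin_self]

lemma intervalMin_congr (hij : i ≤ j) (H : ∀ c, i ≤ c → c ≤ j → h c = h' c) :
    intervalMin h i j = intervalMin h' i j := by
  refine eq_of_forall_le_iff fun a => ?_
  rw [le_intervalMin_iff hij, le_intervalMin_iff hij]
  exact forall_congr' fun c => forall_congr' fun h1 => forall_congr' fun h2 => by rw [H c h1 h2]

lemma intervalMin_anti {i' j' : ℕ} (hij : i' ≤ j') (hi : i ≤ i') (hj : j' ≤ j) :
    intervalMin h i j ≤ intervalMin h i' j' :=
  (le_intervalMin_iff hij).2 fun _ h1 h2 => intervalMin_le (hi.trans h1) (h2.trans hj)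

end intervalMin

/-! ### Weighted non-crossing families of chords and height functions -/

/-- Weights on the internal chords `(a, b)` of the polygon with vertices `0, …, n - 1`, the chords
of nonzero weight being pairwise non-crossing. -/
structure IsFamily (n : ℕ) (w : ℕ → ℕ → ℝ) : Prop where
  nonneg : ∀ a b, 0 ≤ w a b
  supp : ∀ a b, w a b ≠ 0 → a + 2 ≤ b ∧ b < n ∧ ¬ (a = 0 ∧ b + 1 = n)
  noncross : ∀ a b c d, w a b ≠ 0 → w c d ≠ 0 → a < c → c < b → b < d → False

/-- The total weight of the chords `(a, b)` with `a < i` and `j < b`. -/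
noncomputable def coverWeight (n : ℕ) (w : ℕ → ℕ → ℝ) (i j : ℕ) : ℝ :=
  ∑ a ∈ Finset.range i, ∑ b ∈ Finset.Ico (j + 1) n, w a b

/-- The total weight of the chords passing over `c`. -/
noncomputable def height (n : ℕ) (w : ℕ → ℕ → ℝ) (c : ℕ) : ℝ := coverWeight n w c c

section Family

variable {n : ℕ} {w : ℕ → ℕ → ℝ}

/-- Inclusion-exclusion: the weight in a rectangle of pairs of endpoints is a mixed second
difference of `coverWeight`. A rectangle without chords of the family thus gives an equation between
covers. -/
lemma rect_sum {i i' j j' : ℕ} (hi : i ≤ i') (hj : j ≤ j') (hn : j' < n) :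
    ∑ a ∈ Finset.Ico i i', ∑ b ∈ Finset.Ico (j + 1) (j' + 1), w a b =
      coverWeight n w i' j - coverWeight n w i j - coverWeight n w i' j' +
        coverWeight n w i j' := by
  have h1 : ∀ J, coverWeight n w i' J - coverWeight n w i J =
      ∑ a ∈ Finset.Ico i i', ∑ b ∈ Finset.Ico (J + 1) n, w a b := fun J => by
    unfold coverWeight
    rw [Finset.sum_Ico_eq_sub _ hi]
  have h2 : ∑ a ∈ Finset.Ico i i', ∑ b ∈ Finset.Ico (j + 1) (j' + 1), w a b =
      ∑ a ∈ Finset.Ico i i', ∑ b ∈ Finset.Ico (j + 1) n, w a b -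
      ∑ a ∈ Finset.Ico i i', ∑ b ∈ Finset.Ico (j' + 1) n, w a b := by
    rw [← Finset.sum_sub_distrib]
    refine Finset.sum_congr rfl fun a _ => ?_
    rw [eq_sub_iff_add_eq,
      Finset.sum_Ico_consecutive _ (Nat.succ_le_succ hj) (show j' + 1 ≤ n by omega)]
  rw [h2, ← h1, ← h1]
  ring

lemma coverWeight_zero_left (j : ℕ) : coverWeight n w 0 j = 0 := by simp [coverWeight]

lemma coverWeight_last {i j : ℕ} (hj : n ≤ j + 1) : coverWeight n w i j = 0 := by
  simp [coverWeight, Finset.Ico_eq_empty_of_le hj]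

lemma weight_eq_cover {a b : ℕ} (hab : a + 2 ≤ b) (hb : b < n) :
    w a b = coverWeight n w (a + 1) (b - 1) - coverWeight n w a (b - 1) -
      coverWeight n w (a + 1) b + coverWeight n w a b := by
  rw [← rect_sum (Nat.le_succ a) (Nat.sub_le b 1) hb]
  have : b - 1 + 1 = b := by omega
  simp [this]

/-- Chords over `[i, j]` that end at `j + 1` cross the chords over `j + 1` starting in `[i, j]`. -/
lemma IsFamily.cover_succ (hw : IsFamily n w) {i j : ℕ} (hij : i ≤ j) (hj : j + 1 < n) :
    coverWeight n w i (j + 1) = min (coverWeight n w i j) (coverWeight n w (j + 1) (j + 1)) := by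
  have e1 := rect_sum (w := w) (i := 0) (i' := i) (j := j) (j' := j + 1) (by omega) (by omega) hj
  have e2 := rect_sum (w := w) (i := i) (i' := j + 1) (j := j + 1) (j' := n - 1) (by omega)
    (show j + 1 ≤ n - 1 by omega) (show n - 1 < n by omega)
  rw [coverWeight_zero_left, coverWeight_zero_left] at e1
  rw [coverWeight_last (by omega : n ≤ n - 1 + 1), coverWeight_last (by omega : n ≤ n - 1 + 1)]
    at e2
  set S1 := ∑ a ∈ Finset.Ico 0 i, ∑ b ∈ Finset.Ico (j + 1) (j + 1 + 1), w a b with hS1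
  set S2 := ∑ a ∈ Finset.Ico i (j + 1), ∑ b ∈ Finset.Ico (j + 1 + 1) (n - 1 + 1), w a b with hS2
  have p1 : 0 ≤ S1 := Finset.sum_nonneg fun a _ => Finset.sum_nonneg fun b _ => hw.nonneg a b
  have p2 : 0 ≤ S2 := Finset.sum_nonneg fun a _ => Finset.sum_nonneg fun b _ => hw.nonneg a b
  -- `S1` and `S2` are the amounts by which the two entries of the minimum exceed the left side; a
  -- chord from each would give a crossing.
  have : S1 = 0 ∨ S2 = 0 := by
    by_contra! hne
    obtain ⟨a, ha, hne1⟩ := Finset.exists_ne_zero_of_sum_ne_zero hne.1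
    obtain ⟨b, hb, hne1⟩ := Finset.exists_ne_zero_of_sum_ne_zero hne1
    obtain ⟨c, hc, hne2⟩ := Finset.exists_ne_zero_of_sum_ne_zero hne.2
    obtain ⟨d, hd, hne2⟩ := Finset.exists_ne_zero_of_sum_ne_zero hne2
    simp only [Finset.mem_Ico] at ha hb hc hd
    exact hw.noncross a b c d hne1 hne2 (by omega) (by omega) (by omega)
  rcases this with h | h
  · rw [min_eq_left (by linarith)]; linarith
  · rw [min_eq_right (by linarith)]; linarith

/-- The bridge between weights and heights: iterating `cover_succ` adds one point of the interval to
the minimum at a time. -/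
lemma IsFamily.cover_eq_min (hw : IsFamily n w) {i j : ℕ} (hij : i ≤ j) (hj : j < n) :
    coverWeight n w i j = intervalMin (height n w) i j := by
  induction j, hij using Nat.le_induction with
  | base => rw [intervalMin_self]; rfl
  | succ j hij ih =>
    rw [hw.cover_succ hij hj, intervalMin_succ_right hij, ih (by omega)]; rfl

lemma height_zero : height n w 0 = 0 := coverWeight_zero_left 0

lemma height_last {j : ℕ} (hj : n ≤ j + 1) : height n w j = 0 := coverWeight_last hj

/-- A chord over all of `1, …, n - 2` could only be the boundary edge `(0, n - 1)`, which `supp`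
excludes. -/
lemma IsFamily.intervalMin_eq_zero (hw : IsFamily n w) (hn : 3 ≤ n) :
    intervalMin (height n w) 1 (n - 2) = 0 := by
  rw [← hw.cover_eq_min (by omega) (by omega)]
  unfold coverWeight
  refine Finset.sum_eq_zero fun a ha => Finset.sum_eq_zero fun b hb => ?_
  simp only [Finset.mem_range, Finset.mem_Ico] at ha hb
  by_contra h
  exact (hw.supp a b h).2.2 ⟨by omega, by omega⟩

/-- The weight of the chord `(a, b)` read off from a height function. -/
lemma min_alternating (m x y : ℝ) :
    m - min x m - min m y + min (min x m) y = max (m - max x y) 0 := by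
  rcases le_total m x with h1 | h1 <;> rcases le_total m y with h2 | h2 <;>
    rcases le_total x y with h3 | h3 <;>
    simp only [h1, h2, h3, min_eq_left, min_eq_right, max_eq_left, max_eq_right] <;>
    first
      | (rw [max_eq_right (by linarith)]; linarith)
      | (rw [max_eq_left (by linarith)]; linarith)

/-- The mixed difference expressing a single weight is one of interval minima, so the height
function determines the family. -/
lemma IsFamily.weight_eq (hw : IsFamily n w) {a b : ℕ} (hab : a + 2 ≤ b) (hb : b < n) :
    w a b = max (intervalMin (height n w) (a + 1) (b - 1) -
      max (height n w a) (height n w b)) 0 := by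
  rw [weight_eq_cover (w := w) hab hb, hw.cover_eq_min (by omega) (by omega),
    hw.cover_eq_min (by omega) (by omega), hw.cover_eq_min (by omega) (by omega),
    hw.cover_eq_min (by omega) (by omega), ← min_alternating,
    intervalMin_pred_right (show a < b by omega), intervalMin_pred_right (show a + 1 < b by omega),
    intervalMin_succ_left (show a < b - 1 by omega)]

/-- The weights of chords given by a height function. -/
noncomputable def heightWeight (n : ℕ) (h : ℕ → ℝ) (a b : ℕ) : ℝ :=
  if a + 2 ≤ b ∧ b < n then max (intervalMin h (a + 1) (b - 1) - max (h a) (h b)) 0 else 0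

/-- Height functions: nonnegative, zero at both ends and at some inner point. -/
structure IsHeight (n : ℕ) (h : ℕ → ℝ) : Prop where
  left : h 0 = 0
  right : h (n - 1) = 0
  inner : intervalMin h 1 (n - 2) = 0

variable {h : ℕ → ℝ}

lemma IsHeight.nonneg (hh : IsHeight n h) {c : ℕ} (hc : c < n) : 0 ≤ h c := by
  rcases Nat.eq_zero_or_pos c with rfl | h0
  · exact hh.left.ge
  rcases eq_or_ne c (n - 1) with rfl | h1
  · exact hh.right.ge
  · rw [← hh.inner]
    exact intervalMin_le h0 (by omega)

lemma heightWeight_pos {a b : ℕ} (hab : heightWeight n h a b ≠ 0) :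
    a + 2 ≤ b ∧ b < n ∧ max (h a) (h b) < intervalMin h (a + 1) (b - 1) := by
  unfold heightWeight at hab
  split_ifs at hab with h1
  · refine ⟨h1.1, h1.2, ?_⟩
    by_contra h2
    exact hab (max_eq_right (by linarith))
  · exact absurd rfl hab

/-- A chord of positive weight has both ends strictly lower than everything between them. If `a < c
< b < d`, this would give both `h b < h c` and `h c < h b`. -/
lemma IsHeight.isFamily (hh : IsHeight n h) : IsFamily n (heightWeight n h) where
  nonneg a b := by
    unfold heightWeight
    split_ifs
    · exact le_max_right _ _
    · exact le_rfl
  supp a b hab := by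
    obtain ⟨h1, h2, h3⟩ := heightWeight_pos hab
    refine ⟨h1, h2, ?_⟩
    rintro ⟨rfl, h4⟩
    have : b - 1 = n - 2 := by omega
    rw [this, zero_add, hh.inner, hh.left] at h3
    exact absurd h3 (not_lt.2 (le_max_left _ _))
  noncross a b c d hab hcd h1 h2 h3 := by
    obtain ⟨-, -, h4⟩ := heightWeight_pos hab
    obtain ⟨-, -, h5⟩ := heightWeight_pos hcd
    have h6 : intervalMin h (a + 1) (b - 1) ≤ h c := intervalMin_le (by omega) (by omega)
    have h7 : intervalMin h (c + 1) (d - 1) ≤ h b := intervalMin_le (by omega) (by omega)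
    have h8 := le_max_right (h a) (h b)
    have h9 := le_max_left (h c) (h d)
    linarith

lemma heightWeight_eq {a b : ℕ} (hab : a + 2 ≤ b) (hb : b < n) :
    heightWeight n h a b = intervalMin h (a + 1) (b - 1) - intervalMin h a (b - 1) -
      intervalMin h (a + 1) b + intervalMin h a b := by
  rw [heightWeight, if_pos ⟨hab, hb⟩, ← min_alternating,
    intervalMin_pred_right (show a < b by omega), intervalMin_pred_right (show a + 1 < b by omega),
    intervalMin_succ_left (show a < b - 1 by omega)]

/-- By `heightWeight_eq` the double sum telescopes in `b` and then in `a`. The boundary terms are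
minima over intervals containing `0` or `n - 1`, where the nonnegative function `h` vanishes. -/
lemma IsHeight.height_heightWeight (hh : IsHeight n h) {c : ℕ} (hc : c < n) :
    height n (heightWeight n h) c = h c := by
  unfold height coverWeight
  have key : ∀ a < c, ∑ b ∈ Finset.Ico (c + 1) n, heightWeight n h a b =
      intervalMin h (a + 1) c - intervalMin h a c -
        (intervalMin h (a + 1) (n - 1) - intervalMin h a (n - 1)) := by
    intro a ha
    have : ∀ m, c ≤ m → m < n → ∑ b ∈ Finset.Ico (c + 1) (m + 1), heightWeight n h a b =
      intervalMin h (a + 1) c - intervalMin h a c -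
        (intervalMin h (a + 1) m - intervalMin h a m) := by
      intro m hm
      induction m, hm using Nat.le_induction with
      | base => simp
      | succ m hm ih =>
        intro hmn
        rw [Finset.sum_Ico_succ_top (by omega), ih (by omega), heightWeight_eq (by omega) hmn]
        simp only [Nat.add_sub_cancel]
        ring
    have h1 := this (n - 1) (by omega) (by omega)
    rwa [Nat.sub_add_cancel (by omega)] at h1
  have zero : ∀ i < n, intervalMin h i (n - 1) = 0 := fun i hi =>
    le_antisymm ((intervalMin_le (by omega) le_rfl).trans hh.right.le)
      ((le_intervalMin_iff (by omega)).2 fun c _ h2 => hh.nonneg (by omega))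
  have zero' : intervalMin h 0 c = 0 :=
    le_antisymm ((intervalMin_le le_rfl (by omega)).trans hh.left.le)
      ((le_intervalMin_iff (by omega)).2 fun c _ h2 => hh.nonneg (by omega))
  rw [Finset.sum_congr rfl fun a ha => key a (Finset.mem_range.1 ha),
    Finset.sum_congr rfl fun a ha => by
      rw [zero a (by simp at ha; omega), zero (a + 1) (by simp at ha; omega), sub_zero, sub_zero],
    Finset.sum_range_sub (fun a => intervalMin h a c), zero', sub_zero, intervalMin_self]

/-! ### Coordinates of compatibility vectors -/

open Classical in
/-- The compatibility degree of the chords `(p, q)` and `(a, b)`. -/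
noncomputable def chordCompat (p q a b : ℕ) : ℝ :=
  if a = p ∧ b = q then -1
  else if (a < p ∧ p < b ∧ b < q) ∨ (p < a ∧ a < q ∧ q < b) then 1 else 0

/-- The `(p, q)` coordinate of a weighted sum of compatibility vectors. -/
noncomputable def coord (n : ℕ) (w : ℕ → ℕ → ℝ) (p q : ℕ) : ℝ :=
  ∑ a ∈ Finset.range n, ∑ b ∈ Finset.range n, w a b * chordCompat p q a b

/-- The coordinate at a chord whose ends have heights `y`, `z` and over which the minimal height
is `m`. -/
noncomputable def edgeCoord (y z m : ℝ) : ℝ :=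
  max (y - m) 0 + max (z - m) 0 - max (m - max y z) 0

lemma coord_eq_sums {p q : ℕ} (hpq : p + 2 ≤ q) (hq : q < n) :
    coord n w p q = ∑ a ∈ Finset.Ico 0 p, ∑ b ∈ Finset.Ico (p + 1) (q - 1 + 1), w a b +
      ∑ a ∈ Finset.Ico (p + 1) q, ∑ b ∈ Finset.Ico (q + 1) (n - 1 + 1), w a b - w p q := by
  classical
  have e' : coord n w p q = ∑ a ∈ Finset.range n, ∑ b ∈ Finset.range n,
      ((if a ∈ Finset.Ico 0 p then if b ∈ Finset.Ico (p + 1) (q - 1 + 1) then w a b else 0 else 0) +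
      (if a ∈ Finset.Ico (p + 1) q then
        if b ∈ Finset.Ico (q + 1) (n - 1 + 1) then w a b else 0 else 0) -
      (if p = a then if q = b then w a b else 0 else 0)) := by
    unfold coord
    refine Finset.sum_congr rfl fun a _ => Finset.sum_congr rfl fun b hb => ?_
    rw [Finset.mem_range] at hb
    unfold chordCompat
    simp only [Finset.mem_Ico]
    split_ifs <;> first | omega | ring
  have f : ∀ (I J : Finset ℕ), I ⊆ Finset.range n → J ⊆ Finset.range n →
      ∑ a ∈ Finset.range n, ∑ b ∈ Finset.range n,
        (if a ∈ I then if b ∈ J then w a b else 0 else 0) = ∑ a ∈ I, ∑ b ∈ J, w a b := by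
    intro I J hI hJ
    have : ∀ a, ∑ b ∈ Finset.range n, (if a ∈ I then if b ∈ J then w a b else 0 else 0) =
        if a ∈ I then ∑ b ∈ J, w a b else 0 := by
      intro a
      split_ifs
      · rw [Finset.sum_ite_mem, Finset.inter_eq_right.2 hJ]
      · simp
    simp only [this]
    rw [Finset.sum_ite_mem, Finset.inter_eq_right.2 hI]
  have g : ∑ a ∈ Finset.range n, ∑ b ∈ Finset.range n,
        (if p = a then if q = b then w a b else 0 else 0) = w p q := by
    have := f {p} {q} (by simp; omega) (by simpa using hq)
    simpa [eq_comm] using this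
  rw [e']
  simp only [Finset.sum_add_distrib, Finset.sum_sub_distrib]
  rw [f, f, g]
  · intro a; simp; omega
  · intro a; simp; omega
  · intro a; simp; omega
  · intro a; simp; omega

lemma sub_min_eq (x y : ℝ) : x - min x y = max (x - y) 0 := by
  rcases le_total x y with h | h
  · rw [min_eq_left h, max_eq_right (by linarith)]; ring
  · rw [min_eq_right h, max_eq_left (by linarith)]

/-- With `m` the minimum over the chord, the crossing chords that start left of `p` weigh `h p - min
(h p) m`, those that end right of `q` weigh `h q - min (h q) m`, and the last term of `edgeCoord` is
the weight of `(p, q)` itself. -/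
lemma IsFamily.coord_eq (hw : IsFamily n w) {p q : ℕ} (hpq : p + 2 ≤ q) (hq : q < n) :
    coord n w p q = edgeCoord (height n w p) (height n w q)
      (intervalMin (height n w) (p + 1) (q - 1)) := by
  rw [coord_eq_sums hpq hq,
    rect_sum (Nat.zero_le p) (show p ≤ q - 1 by omega) (show q - 1 < n by omega),
    rect_sum (show p + 1 ≤ q by omega) (show q ≤ n - 1 by omega) (show n - 1 < n by omega),
    coverWeight_zero_left, coverWeight_zero_left,
    coverWeight_last (by omega : n ≤ n - 1 + 1), coverWeight_last (by omega : n ≤ n - 1 + 1),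
    hw.cover_eq_min (by omega) (by omega), hw.cover_eq_min (by omega) (by omega),
    hw.cover_eq_min (by omega) (by omega), hw.cover_eq_min (by omega) (by omega),
    intervalMin_self, intervalMin_self, hw.weight_eq hpq hq,
    intervalMin_succ_left (show p < q - 1 by omega),
    intervalMin_pred_right (show p + 1 < q by omega), edgeCoord, ← sub_min_eq (height n w p),
    ← sub_min_eq (height n w q), min_comm (height n w q)]
  ring

/-- The weight of the chords that cross two consecutive chords `(p, q)` and `(q, r)`. -/
lemma IsFamily.corner_sum (hw : IsFamily n w) {p q r : ℕ} (hpq : p + 2 ≤ q) (hqr : q + 2 ≤ r)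
    (hr : r < n) {t : ℝ} (h1 : intervalMin (height n w) (p + 1) (q - 1) = t)
    (h2 : intervalMin (height n w) (q + 1) (r - 1) = t) (h3 : t ≤ height n w q) :
    ∑ a ∈ Finset.Ico (p + 1) q, ∑ b ∈ Finset.Ico (q + 1) (r - 1 + 1), w a b =
      height n w q - t := by
  rw [rect_sum (show p + 1 ≤ q by omega) (show q ≤ r - 1 by omega) (show r - 1 < n by omega),
    hw.cover_eq_min (by omega) (by omega),
    hw.cover_eq_min (by omega) (by omega), hw.cover_eq_min (by omega) (by omega),
    hw.cover_eq_min (by omega) (by omega), intervalMin_split (show p + 1 ≤ q by omega)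
    (show q < r - 1 by omega), intervalMin_succ_left (show q < r - 1 by omega), h2,
    intervalMin_pred_right (show p + 1 < q by omega), h1, intervalMin_self, min_eq_left h3,
    min_eq_right h3, min_self]
  ring

end Family

/-! ### The coordinate of a chord as a function of the minimal height over it -/

/-- Each term is antitone in `m`, and one moves strictly: the last one if `m'` exceeds both ends,
otherwise that of an end at least as high as `m'`. -/
lemma edgeCoord_strictAnti (y z : ℝ) {m m' : ℝ} (h : m < m') :
    edgeCoord y z m' < edgeCoord y z m := by
  unfold edgeCoord
  have h1 : max (y - m') 0 ≤ max (y - m) 0 := max_le_max (by linarith) le_rfl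
  have h2 : max (z - m') 0 ≤ max (z - m) 0 := max_le_max (by linarith) le_rfl
  have h3 : max (m - max y z) 0 ≤ max (m' - max y z) 0 := max_le_max (by linarith) le_rfl
  rcases lt_or_ge (max y z) m' with h4 | h4
  · have : max (m - max y z) 0 < max (m' - max y z) 0 := by
      rw [max_eq_left (by linarith : 0 ≤ m' - max y z)]
      exact max_lt (by linarith) (by linarith)
    linarith
  · rcases le_max_iff.1 h4 with h5 | h5
    · have : max (y - m') 0 < max (y - m) 0 := by
        rw [max_eq_left (by linarith : 0 ≤ y - m'), max_eq_left (by linarith : 0 ≤ y - m)]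
        linarith
      linarith
    · have : max (z - m') 0 < max (z - m) 0 := by
        rw [max_eq_left (by linarith : 0 ≤ z - m'), max_eq_left (by linarith : 0 ≤ z - m)]
        linarith
      linarith

lemma edgeCoord_inj {y z m m' : ℝ} (h : edgeCoord y z m = edgeCoord y z m') : m = m' := by
  rcases lt_trichotomy m m' with h1 | h1 | h1
  · exact absurd h (edgeCoord_strictAnti y z h1).ne'
  · exact h1
  · exact absurd h (edgeCoord_strictAnti y z h1).ne

lemma le_of_edgeCoord_le {y z m m' : ℝ} (h : edgeCoord y z m ≤ edgeCoord y z m') : m' ≤ m :=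
  not_lt.1 fun h1 => absurd h (not_le.2 (edgeCoord_strictAnti y z h1))

lemma edgeCoord_surjective (y z x : ℝ) : ∃ m, edgeCoord y z m = x := by
  have hc : Continuous (edgeCoord y z) := by unfold edgeCoord; fun_prop
  -- The value here is `-|x|`, and at `y - |x|` it is at least `|x|`; the intermediate value theorem
  -- does the rest.
  have h1 : edgeCoord y z (max y z + |x|) ≤ x := by
    unfold edgeCoord
    have := le_max_left y z
    have := le_max_right y z
    have := abs_nonneg x
    rw [max_eq_right (by linarith), max_eq_right (by linarith), max_eq_left (by linarith)]
    linarith [neg_abs_le x]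
  have h2 : x ≤ edgeCoord y z (y - |x|) := by
    unfold edgeCoord
    have := le_max_left y z
    have := abs_nonneg x
    have h3 := le_max_right (z - (y - |x|)) 0
    rw [max_eq_left (by linarith), max_eq_right (by linarith : y - |x| - max y z ≤ 0)]
    linarith [le_abs_self x]
  obtain ⟨m, hm⟩ := mem_range_of_exists_le_of_exists_ge hc ⟨_, h1⟩ ⟨_, h2⟩
  exact ⟨m, hm⟩

/-- The positive part of the coordinate. -/
lemma max_edgeCoord (y z m : ℝ) :
    max (edgeCoord y z m) 0 = max (y - m) 0 + max (z - m) 0 := by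
  unfold edgeCoord
  rcases le_total m (max y z) with h | h
  · rw [max_eq_right (by linarith : m - max y z ≤ 0), sub_zero]
    exact max_eq_left (add_nonneg (le_max_right _ _) (le_max_right _ _))
  · have := le_max_left y z
    have := le_max_right y z
    rw [max_eq_right (by linarith : y - m ≤ 0), max_eq_right (by linarith : z - m ≤ 0),
      max_eq_left (by linarith : 0 ≤ m - max y z)]
    rw [max_eq_right (by linarith)]
    ring

lemma edgeCoord_max (y z : ℝ) : edgeCoord y z (max y z) = 0 := by
  unfold edgeCoord
  have := le_max_left y z
  have := le_max_right y z
  rw [max_eq_right (by linarith), max_eq_right (by linarith), max_eq_right (by linarith)]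
  ring

/-- The height of the right end of a chord with minimal height `a`, left end of height `y` and
positive part of the coordinate `X`. -/
noncomputable def rightHeight (X y a : ℝ) : ℝ := a + max (X - max (y - a) 0) 0

/-- Strictness allows the minimum `a` to be recovered from the right height, once `X` and `y` are
known. -/
lemma rightHeight_strictMono (X y : ℝ) {a b : ℝ} (h : a < b) :
    rightHeight X y a < rightHeight X y b := by
  unfold rightHeight
  have : max (y - b) 0 ≤ max (y - a) 0 := max_le_max (by linarith) le_rfl
  have : max (X - max (y - a) 0) 0 ≤ max (X - max (y - b) 0) 0 := max_le_max (by linarith) le_rfl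
  linarith

lemma rightHeight_inj {X y a b : ℝ} (h : rightHeight X y a = rightHeight X y b) : a = b := by
  rcases lt_trichotomy a b with h1 | h1 | h1
  · exact absurd h (rightHeight_strictMono X y h1).ne
  · exact h1
  · exact absurd h (rightHeight_strictMono X y h1).ne'

/-- The variable is `min m z`, the minimum over the half-open block that includes the right end,
since the accordion condition speaks of such blocks. If `m ≤ z`, solve `X = max (y - m) 0 + (z - m)`
for `z`; if `z ≤ m`, nothing of `X` is left beyond `max (y - z) 0`. -/
lemma eq_rightHeight (y z m : ℝ) :
    z = rightHeight (max (edgeCoord y z m) 0) y (min m z) := by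
  rw [max_edgeCoord]
  unfold rightHeight
  rcases le_total m z with h | h
  · rw [min_eq_left h, max_eq_left (by linarith : 0 ≤ z - m), add_sub_cancel_left,
      max_eq_left (by linarith : 0 ≤ z - m)]
    ring
  · have : max (y - m) 0 ≤ max (y - z) 0 := max_le_max (by linarith) le_rfl
    rw [min_eq_right h, max_eq_right (by linarith : z - m ≤ 0), add_zero,
      max_eq_right (by linarith)]
    ring

/-! ### A single cell

A cell has vertices `0, …, K` at heights `y`, the chord from `i` to `i + 1` has coordinate `x i`
and minimal height `μ i`, the minimal height over the closing chord is `m`. The numbers `u`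
solve a cyclic system of equations which determines everything else. -/

/-- The minimal heights of a cell obey the accordion condition, with overall minimum `m`. -/
structure IsCellMin (K : ℕ) (y μ : ℕ → ℝ) (m : ℝ) : Prop where
  le_iff : ∀ a, a ≤ m ↔ (∀ i, i + 1 < K → a ≤ min (μ i) (y (i + 1))) ∧ a ≤ μ (K - 1)
  mid : ∀ i, 0 < i → i + 1 < K → min (μ i) (y (i + 1)) =
    max (min (μ 0) (y 1)) (min (μ (K - 1)) (y K))

/-- The parameters `s`, `u` of a cell. -/
structure IsCellSolution (K : ℕ) (y x μ : ℕ → ℝ) (m s : ℝ) (u : ℕ → ℝ) : Prop where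
  first : min (μ 0) (y 1) = m + max s 0
  mid : ∀ i, 0 < i → i + 1 < K → min (μ i) (y (i + 1)) = m + |s|
  u_zero : u 0 = max (max (y 0 - m) 0 - s) 0
  u_mid : ∀ i, 0 < i → i < K → u i = max (y i - m - |s|) 0
  u_last : u K = s + max (y K - m) 0
  step : ∀ i < K, u (i + 1) = max (max (x i) 0 - u i) 0

lemma max_max_sub (X a s : ℝ) (hs : s ≤ 0) :
    max (max (X - a) 0 + s) 0 = max (X - (a - s)) 0 := by
  rcases le_total (X - a) 0 with h | h
  · rw [max_eq_right h, max_eq_right (by linarith), max_eq_right (by linarith)]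
  · rw [max_eq_left h]
    congr 1
    ring

/-- The first step around a cell. -/
lemma first_step {X y0 y1 m s : ℝ} (h : y1 = rightHeight X y0 (m + max s 0)) :
    max (y1 - m - |s|) 0 = max (X - max (max (y0 - m) 0 - s) 0) 0 := by
  rw [h]
  unfold rightHeight
  rcases le_total 0 s with hs | hs
  · have e : max (max (y0 - m) 0 - s) 0 = max (y0 - (m + s)) 0 := by
      rcases le_total (y0 - m) 0 with h | h
      · rw [max_eq_right h, max_eq_right (by linarith), max_eq_right (by linarith)]
      · rw [max_eq_left h]
        congr 1
        ring
    rw [e, abs_of_nonneg hs, max_eq_left hs]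
    have := le_max_right (X - max (y0 - (m + s)) 0) 0
    rw [max_eq_left (by linarith)]
    ring
  · rw [abs_of_nonpos hs, max_eq_right hs, add_zero,
      max_eq_left (by have := le_max_right (y0 - m) 0; linarith : 0 ≤ max (y0 - m) 0 - s),
      ← max_max_sub _ _ _ hs]
    congr 1
    ring

/-- The excess of the first block over `m` and the positive excess of the last block cannot both be
nonzero, so one signed number `s` records both. Every middle block then has excess `|s|`, and `u i`
is the positive excess of an inner vertex over this common level. At the two end vertices `u` is
adjusted by `s` so that the same recursion holds all around the cell. -/
lemma IsCellMin.exists_solution {K : ℕ} {y x μ : ℕ → ℝ} {m : ℝ} (hK : 2 ≤ K)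
    (hx : ∀ i < K, edgeCoord (y i) (y (i + 1)) (μ i) = x i) (h : IsCellMin K y μ m) :
    ∃ s u, IsCellSolution K y x μ m s u := by
  have hrel : ∀ i < K, y (i + 1) = rightHeight (max (x i) 0) (y i) (min (μ i) (y (i + 1))) :=
    fun i hi => by
      have := eq_rightHeight (y i) (y (i + 1)) (μ i)
      rwa [hx i hi] at this
  set m0 := min (μ 0) (y 1) with hm0
  set ml := min (μ (K - 1)) (y K) with hml
  have hle := (h.le_iff m).1 le_rfl
  have hm0' : m ≤ m0 := hle.1 0 (by omega)
  -- Middle blocks are at least as high as the first one, so the overall minimum is attained in the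
  -- first block or strictly inside the last edge.
  have dich : m0 = m ∨ μ (K - 1) = m := by
    by_contra! hne
    have h1 : m < m0 := lt_of_le_of_ne hm0' hne.1.symm
    have h2 : m < μ (K - 1) := lt_of_le_of_ne hle.2 hne.2.symm
    refine absurd ((h.le_iff (min m0 (μ (K - 1)))).2 ⟨fun i hi => ?_, min_le_right _ _⟩)
      (not_le.2 (lt_min h1 h2))
    rcases Nat.eq_zero_or_pos i with rfl | hi0
    · exact min_le_left _ _
    · rw [h.mid i hi0 hi]
      exact (min_le_left _ _).trans (le_max_left _ _)
  set s := (m0 - m) - max (ml - m) 0 with hs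
  have hfirst : m0 = m + max s 0 := by
    rcases dich with h1 | h1
    · have := le_max_right (ml - m) 0
      rw [hs, max_eq_right (by linarith)]
      linarith
    · have : ml ≤ m := h1 ▸ min_le_left _ _
      rw [hs, max_eq_right (by linarith : ml - m ≤ 0), max_eq_left (by linarith)]
      ring
  have habs : max m0 ml = m + |s| := by
    rcases dich with h1 | h1
    · have h2 := le_max_right (ml - m) 0
      rw [hs, abs_of_nonpos (by linarith), h1]
      rcases le_total ml m with h3 | h3
      · rw [max_eq_left h3, max_eq_right (by linarith)]; ring
      · rw [max_eq_right h3, max_eq_left (by linarith)]; ring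
    · have : ml ≤ m := h1 ▸ min_le_left _ _
      rw [hs, max_eq_right (by linarith : ml - m ≤ 0), max_eq_left (by linarith),
        abs_of_nonneg (by linarith)]
      ring
  have hmid : ∀ i, 0 < i → i + 1 < K → min (μ i) (y (i + 1)) = m + |s| := fun i h1 h2 => by
    rw [h.mid i h1 h2, habs]
  refine ⟨s, fun i => if i = 0 then max (max (y 0 - m) 0 - s) 0 else if i < K then
    max (y i - m - |s|) 0 else s + max (y K - m) 0, hfirst, hmid, by simp, ?_, ?_, ?_⟩
  · intro i h1 h2
    simp [h1.ne', h2]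
  · simp [show K ≠ 0 by omega]
  intro i hi
  rcases Nat.eq_zero_or_pos i with rfl | hi0
  · simp only [zero_add, if_true, one_ne_zero, if_false, if_pos (show 1 < K by omega)]
    apply first_step
    rw [← hfirst]
    exact hrel 0 hi
  rcases eq_or_ne (i + 1) K with hiK | hiK
  · simp only [if_false, hi0.ne', hi, if_true, hiK, lt_irrefl, show K ≠ 0 by omega]
    obtain rfl : i = K - 1 := by omega
    have hr := hrel (K - 1) hi
    have hxl := hx (K - 1) hi
    rw [hiK, ← hml] at hr
    rw [hiK] at hxl
    have hX := max_edgeCoord (y (K - 1)) (y K) (μ (K - 1))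
    rw [hxl] at hX
    have hprev : m0 ≤ y (K - 1) := by
      rcases eq_or_ne K 2 with rfl | h2
      · exact min_le_right _ _
      · have h1 := h.mid (K - 2) (by omega) (by omega)
        rw [show K - 2 + 1 = K - 1 by omega] at h1
        exact (le_max_left _ _).trans (h1 ▸ min_le_right _ _)
    set v := y (K - 1) - m - |s| with hv
    -- If `s < 0`, the last block sits at the middle level and `rightHeight` gives `y K`. If `s >
    -- 0`, then `μ (K - 1) = m` and the positive part of the last coordinate is explicit. If `s =
    -- 0`, either `μ (K - 1) = m` or `y K ≤ m`.
    rcases lt_trichotomy s 0 with hs0 | hs0 | hs0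
    · have h1 : m0 = m := by rw [hfirst, max_eq_right hs0.le, add_zero]
      have h2 : ml = m + |s| := by
        rw [← habs, max_eq_right]
        by_contra h3
        rw [max_eq_left (by linarith)] at habs
        have := abs_pos_of_neg hs0
        linarith
      have h3 : ml ≤ y K := min_le_right _ _
      have h4 := abs_nonneg s
      unfold rightHeight at hr
      rw [max_eq_left (by linarith : 0 ≤ y K - m), hv, abs_of_neg hs0] at *
      rw [h2] at hr
      have : y (K - 1) - m - -s = y (K - 1) - (m + -s) := by ring
      rw [this]
      linarith
    · have h1 : m0 = m := by rw [hfirst, hs0, max_self, add_zero]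
      have h2 : ml ≤ m := by
        rw [h1, hs0, abs_zero, add_zero] at habs
        exact habs ▸ le_max_right _ _
      rw [hv, hs0, abs_zero, sub_zero, zero_add]
      rcases eq_or_ne (μ (K - 1)) m with h3 | h3
      · rw [hX, h3, add_sub_cancel_left, max_eq_left (le_max_right (y K - m) 0)]
      · have h4 : y K ≤ m := by
          rcases min_le_iff.1 h2 with h5 | h5
          · exact absurd (le_antisymm h5 hle.2) h3
          · exact h5
        rw [hX, max_eq_right (by linarith : y K - m ≤ 0),
          max_eq_right (by linarith [hle.2] : y K - μ (K - 1) ≤ 0), add_zero]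
        symm
        apply max_eq_right
        have := hle.2
        have : max (y (K - 1) - μ (K - 1)) 0 ≤ max (y (K - 1) - m) 0 :=
          max_le_max (by linarith) le_rfl
        linarith
    · have h1 : m0 = m + s := by rw [hfirst, max_eq_left hs0.le]
      have h2 : μ (K - 1) = m := by
        rcases dich with h3 | h3
        · linarith
        · exact h3
      rw [h2, max_eq_left (by linarith : 0 ≤ y (K - 1) - m)] at hX
      rw [hX, hv, abs_of_pos hs0, max_eq_left (by linarith : 0 ≤ y (K - 1) - m - s)]
      have := le_max_right (y K - m) 0
      have e : y (K - 1) - m + max (y K - m) 0 - (y (K - 1) - m - s) =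
        s + max (y K - m) 0 := by ring
      rw [e, max_eq_left (by linarith : 0 ≤ s + max (y K - m) 0)]
  · have hi1 : i + 1 < K := by omega
    simp only [Nat.succ_ne_zero, if_false, hi0.ne', hi, if_true, hi1]
    have hr := hrel i hi
    rw [hmid i hi0 hi1, rightHeight] at hr
    have h1 := le_max_right (max (x i) 0 - max (y i - (m + |s|)) 0) 0
    rw [max_eq_left (by linarith), sub_sub, hr, sub_sub]
    ring

/-- Converse of `IsCellMin.exists_solution`: the heights are written down from `u`, and any minima
`μ` with the right coordinates then satisfy the accordion condition automatically, because
`rightHeight` and `edgeCoord` are injective in the minimum. -/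
lemma exists_cell {K : ℕ} {x u : ℕ → ℝ} {m y0 yK : ℝ} (hK : 2 ≤ K)
    (hu : ∀ i < K, u (i + 1) = max (max (x i) 0 - u i) 0)
    (hu0 : u 0 = max (max (y0 - m) 0 + max (yK - m) 0 - u K) 0) :
    ∃ y : ℕ → ℝ, y 0 = y0 ∧ y K = yK ∧ ∀ μ : ℕ → ℝ,
      (∀ i < K, edgeCoord (y i) (y (i + 1)) (μ i) = x i) →
        IsCellMin K y μ m ∧ ∃ s, IsCellSolution K y x μ m s u := by
  set B := max (yK - m) 0 with hB
  -- Forced by the equation `u_last`.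
  set s := u K - B with hs
  -- Vertex `1` closes the first block, whose minimum is `m + max s 0`. Later inner vertices close
  -- middle blocks at level `m + |s|`, where `rightHeight` simplifies to the level plus `u i`.
  set y : ℕ → ℝ := fun i => if i = 0 then y0 else if i = K then yK else if i = 1 then
    rightHeight (max (x 0) 0) y0 (m + max s 0) else m + |s| + u i with hy
  have y_zero : y 0 = y0 := by simp [hy]
  have y_last : y K = yK := by simp [hy, show K ≠ 0 by omega]
  have y_one : y 1 = rightHeight (max (x 0) 0) (y 0) (m + max s 0) := by
    rw [y_zero]
    simp [hy, show 1 ≠ K by omega]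
  have y_mid : ∀ i, 1 < i → i < K → y i = m + |s| + u i := fun i h1 h2 => by
    simp [hy, show i ≠ 0 by omega, show i ≠ K by omega, show i ≠ 1 by omega]
  refine ⟨y, y_zero, y_last, fun μ hμ => ?_⟩
  have hrel : ∀ i < K, y (i + 1) = rightHeight (max (x i) 0) (y i) (min (μ i) (y (i + 1))) :=
    fun i hi => by
      have := eq_rightHeight (y i) (y (i + 1)) (μ i)
      rwa [hμ i hi] at this
  have unn : ∀ i < K, 0 ≤ u (i + 1) := fun i hi => by rw [hu i hi]; exact le_max_right _ _
  have u_zero : u 0 = max (max (y 0 - m) 0 - s) 0 := by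
    rw [hu0, y_zero]
    congr 1
    rw [hs]
    ring
  have u_mid : ∀ i, 0 < i → i < K → u i = max (y i - m - |s|) 0 := by
    intro i h1 h2
    rcases eq_or_ne i 1 with rfl | h3
    · rw [first_step y_one, ← u_zero]
      exact hu 0 (by omega)
    · obtain ⟨j, rfl⟩ : ∃ j, i = j + 1 := ⟨i - 1, by omega⟩
      rw [y_mid _ (by omega) h2, max_eq_left (by have := unn j (by omega); linarith)]
      ring
  have hfirst : min (μ 0) (y 1) = m + max s 0 :=
    rightHeight_inj ((hrel 0 (by omega)).symm.trans y_one)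
  have hmid : ∀ i, 0 < i → i + 1 < K → min (μ i) (y (i + 1)) = m + |s| := by
    intro i h1 h2
    refine rightHeight_inj ((hrel i (by omega)).symm.trans ?_)
    rw [y_mid _ (by omega) h2, hu i (by omega), u_mid i h1 (by omega), rightHeight, sub_sub]
  have hlast : u K = s + max (y K - m) 0 := by rw [y_last, hs]; ring
  have hprev : m + max s 0 ≤ y (K - 1) := by
    rcases eq_or_ne K 2 with rfl | h2
    · exact hfirst ▸ min_le_right _ _
    · have h1 := hmid (K - 2) (by omega) (by omega)
      rw [show K - 2 + 1 = K - 1 by omega] at h1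
      have h3 : min (μ (K - 2)) (y (K - 1)) ≤ y (K - 1) := min_le_right _ _
      rw [h1] at h3
      exact le_trans (by linarith [max_le (le_abs_self s) (abs_nonneg s)]) h3
  have hclose : s + B = max (max (x (K - 1)) 0 - max (y (K - 1) - m - |s|) 0) 0 := by
    have := hu (K - 1) (by omega)
    rw [Nat.sub_add_cancel (by omega : 1 ≤ K), u_mid (K - 1) (by omega) (by omega)] at this
    linarith
  have hxl := hμ (K - 1) (by omega)
  have hrl := hrel (K - 1) (by omega)
  rw [Nat.sub_add_cancel (by omega : 1 ≤ K), y_last] at hxl hrl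
  -- behaviour at the last chord
  have key : m ≤ μ (K - 1) ∧ (0 < s → μ (K - 1) = m) ∧
      max (m + max s 0) (min (μ (K - 1)) yK) = m + |s| := by
    have hBs : 0 ≤ B := le_max_right _ _
    -- Here `yK` is the right height produced by the level `m + |s|`, so injectivity puts the last
    -- block at that level.
    have case1 : 0 < B → s ≤ 0 → min (μ (K - 1)) yK = m + |s| := by
      intro h1 h2
      have hB1 : B = yK - m := by
        rcases max_choice (yK - m) 0 with h3 | h3
        · exact h3
        · rw [← hB] at h3; linarith
      refine rightHeight_inj (hrl.symm.trans ?_)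
      rw [rightHeight, ← sub_sub, ← hclose, abs_of_nonpos h2]
      linarith
    rcases lt_trichotomy s 0 with h1 | h1 | h1
    · have h2 : 0 < B := by
        have := le_max_right (max (x (K - 1)) 0 - max (y (K - 1) - m - |s|) 0) 0
        linarith
      have h3 := case1 h2 h1.le
      have h4 : m + |s| ≤ μ (K - 1) := h3 ▸ min_le_left _ _
      have h5 := abs_nonneg s
      refine ⟨by linarith, fun h => absurd h (not_lt.2 h1.le), ?_⟩
      rw [h3, max_eq_right h1.le, add_zero]
      exact max_eq_right (by linarith)
    · rw [h1] at case1 hclose hprev ⊢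
      simp only [abs_zero, add_zero, max_self, sub_zero, zero_add, lt_irrefl, false_imp_iff,
        true_and, le_refl, forall_const] at case1 hclose hprev ⊢
      rcases hBs.lt_or_eq with h2 | h2
      · have h3 := case1 h2
        exact ⟨h3 ▸ min_le_left _ _, by rw [h3, max_self]⟩
      · have h4 : yK ≤ m := by
          have := le_max_left (yK - m) 0
          rw [← hB, ← h2] at this
          linarith
        -- With `s = 0` and `yK ≤ m` the block minimum gives no lower bound on `μ (K - 1)`;
        -- comparing the coordinate with its value at `m` does.
        refine ⟨le_of_edgeCoord_le (y := y (K - 1)) (z := yK) ?_,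
          max_eq_left ((min_le_right _ _).trans h4)⟩
        rw [hxl]
        unfold edgeCoord
        have h5 : m ≤ max (y (K - 1)) yK := hprev.trans (le_max_left _ _)
        rw [max_eq_right (by linarith : m - max (y (K - 1)) yK ≤ 0), ← hB, ← h2]
        rw [← h2] at hclose
        have h6 := le_max_left (max (x (K - 1)) 0 - max (y (K - 1) - m) 0) 0
        have h7 := le_max_left (x (K - 1)) 0
        linarith
    · have h2 : y (K - 1) - m - |s| = y (K - 1) - m - s := by rw [abs_of_pos h1]
      rw [max_eq_left h1.le] at hprev
      rw [h2, max_eq_left (by linarith : 0 ≤ y (K - 1) - m - s)] at hclose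
      have h3 : s + B = max (x (K - 1)) 0 - (y (K - 1) - m - s) := by
        rcases max_choice (max (x (K - 1)) 0 - (y (K - 1) - m - s)) 0 with h | h
        · rw [← h]; exact hclose
        · linarith
      have h4 : max (x (K - 1)) 0 = x (K - 1) := by
        rcases max_choice (x (K - 1)) 0 with h | h
        · exact h
        · linarith
      have h5 : μ (K - 1) = m := by
        refine edgeCoord_inj (y := y (K - 1)) (z := yK) ?_
        rw [hxl]
        unfold edgeCoord
        have h5 : m ≤ max (y (K - 1)) yK := le_trans (by linarith) (le_max_left _ _)
        rw [max_eq_right (by linarith : m - max (y (K - 1)) yK ≤ 0), ← hB,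
          max_eq_left (by linarith : 0 ≤ y (K - 1) - m)]
        linarith
      refine ⟨h5.ge, fun _ => h5, ?_⟩
      rw [h5, max_eq_left h1.le, abs_of_pos h1]
      exact max_eq_left ((min_le_left _ _).trans (by linarith))
  refine ⟨⟨fun a => ⟨fun ha => ⟨fun i hi => ?_, ha.trans key.1⟩, fun ⟨h1, h2⟩ => ?_⟩,
    fun i h1 h2 => ?_⟩, s, hfirst, hmid, u_zero, u_mid, hlast, hu⟩
  · rcases Nat.eq_zero_or_pos i with rfl | hi0
    · rw [hfirst]
      linarith [le_max_right s 0]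
    · rw [hmid i hi0 hi]
      linarith [abs_nonneg s]
  · rcases le_or_gt s 0 with h3 | h3
    · have := h1 0 (by omega)
      rwa [hfirst, max_eq_right h3, add_zero] at this
    · rwa [key.2.1 h3] at h2
  · rw [hmid i h1 h2, hfirst, y_last, key.2.2]

/-! ### The cyclic system of a cell -/

/-- Iterating `v ↦ max (X i - v) 0`. -/
noncomputable def cyclicIter (X : ℕ → ℝ) (v : ℝ) : ℕ → ℝ
  | 0 => v
  | i + 1 => max (X i - cyclicIter X v i) 0

lemma eq_cyclicIter {X u : ℕ → ℝ} {K : ℕ} (hu : ∀ i < K, u (i + 1) = max (X i - u i) 0) :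
    ∀ i ≤ K, u i = cyclicIter X (u 0) i := by
  intro i
  induction i with
  | zero => intro _; rfl
  | succ i ih =>
    intro hi
    rw [hu i (by omega), cyclicIter, ih (by omega)]

lemma continuous_cyclicIter (X : ℕ → ℝ) (i : ℕ) : Continuous fun v => cyclicIter X v i := by
  induction i with
  | zero => exact continuous_id
  | succ i ih => unfold cyclicIter; fun_prop

/-- Each step is antitone, so the composite of `i` steps is monotone or antitone according to the
parity of `i`. -/
lemma cyclicIter_monotone (X : ℕ → ℝ) (i : ℕ) {v v' : ℝ} (h : v ≤ v') :
    (Even i → cyclicIter X v i ≤ cyclicIter X v' i) ∧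
      (¬ Even i → cyclicIter X v' i ≤ cyclicIter X v i) := by
  induction i with
  | zero => exact ⟨fun _ => h, fun h => absurd Even.zero h⟩
  | succ i ih =>
    rw [Nat.even_add_one, not_not]
    exact ⟨fun hi => max_le_max (by linarith [ih.2 hi]) le_rfl,
      fun hi => max_le_max (by linarith [ih.1 hi]) le_rfl⟩

/-- A solution is a fixed point of one full turn `f`, a continuous map with values in `[0, M]` on
the nonnegative reals. No parity is needed. -/
lemma exists_cyclic_solution (K : ℕ) (X : ℕ → ℝ) (Y : ℝ) :
    ∃ u : ℕ → ℝ, (∀ i < K, u (i + 1) = max (X i - u i) 0) ∧ u 0 = max (Y - u K) 0 := by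
  set f : ℝ → ℝ := fun v => max (Y - cyclicIter X v K) 0 with hf
  have hc : Continuous f := by have := continuous_cyclicIter X K; fun_prop
  have hK : ∃ M, ∀ v, 0 ≤ v → f v ≤ M := by
    rcases K with _ | K
    · exact ⟨max Y 0, fun v hv => max_le_max (by simp [cyclicIter]; linarith) le_rfl⟩
    · refine ⟨max Y 0, fun v _ => max_le_max ?_ le_rfl⟩
      have : 0 ≤ cyclicIter X v (K + 1) := le_max_right _ _
      linarith
  obtain ⟨M, hM⟩ := hK
  have h0 : 0 ≤ f 0 := le_max_right _ _
  have hM0 : 0 ≤ M := h0.trans (hM 0 le_rfl)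
  obtain ⟨v, -, hv⟩ := intermediate_value_Icc' hM0
    (f := fun v => f v - v) (by fun_prop) (show (0 : ℝ) ∈ Set.Icc _ _ from
      ⟨by linarith [hM M hM0], by linarith⟩)
  refine ⟨cyclicIter X v, fun i _ => rfl, ?_⟩
  exact (sub_eq_zero.1 hv).symm

/-- A full turn has `K + 1` steps. For `K` even it is antitone and has at most one fixed point. If
some right-hand side is at most zero, the unknown that it defines is zero and the others follow from
it. -/
lemma cyclic_solution_unique {K : ℕ} {X u u' : ℕ → ℝ} {Y : ℝ}
    (hu : ∀ i < K, u (i + 1) = max (X i - u i) 0) (hu0 : u 0 = max (Y - u K) 0)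
    (hu' : ∀ i < K, u' (i + 1) = max (X i - u' i) 0) (hu0' : u' 0 = max (Y - u' K) 0)
    (h : Even K ∨ Y ≤ 0 ∨ ∃ i < K, X i ≤ 0) : ∀ i ≤ K, u i = u' i := by
  suffices h0 : u 0 = u' 0 by
    intro i hi
    rw [eq_cyclicIter hu i hi, eq_cyclicIter hu' i hi, h0]
  have key : ∀ {u u' : ℕ → ℝ}, (∀ i < K, u (i + 1) = max (X i - u i) 0) →
      u 0 = max (Y - u K) 0 → (∀ i < K, u' (i + 1) = max (X i - u' i) 0) →
      u' 0 = max (Y - u' K) 0 → Even K → u 0 ≤ u' 0 → u' 0 ≤ u 0 := by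
    intro u u' hu hu0 hu' hu0' hK hle
    have := (cyclicIter_monotone X K hle).1 hK
    rw [← eq_cyclicIter hu K le_rfl, ← eq_cyclicIter hu' K le_rfl] at this
    rw [hu0, hu0']
    exact max_le_max (by linarith) le_rfl
  have nonneg : ∀ {u : ℕ → ℝ}, (∀ i < K, u (i + 1) = max (X i - u i) 0) →
      u 0 = max (Y - u K) 0 → ∀ i ≤ K, 0 ≤ u i := by
    intro u hu hu0 i hi
    rcases i with _ | i
    · rw [hu0]; exact le_max_right _ _
    · rw [hu i (by omega)]; exact le_max_right _ _
  rcases h with h | h | ⟨i, hi, h⟩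
  · rcases le_total (u 0) (u' 0) with h1 | h1
    · exact le_antisymm h1 (key hu hu0 hu' hu0' h h1)
    · exact le_antisymm (key hu' hu0' hu hu0 h h1) h1
  · rw [hu0, hu0', max_eq_right (by linarith [nonneg hu hu0 K le_rfl]),
      max_eq_right (by linarith [nonneg hu' hu0' K le_rfl])]
  · have h1 : ∀ j, i + 1 ≤ j → j ≤ K → u j = u' j := by
      intro j hj
      induction j, hj using Nat.le_induction with
      | base =>
        intro _
        rw [hu i hi, hu' i hi, max_eq_right (by linarith [nonneg hu hu0 i hi.le]),
          max_eq_right (by linarith [nonneg hu' hu0' i hi.le])]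
      | succ j _ ih =>
        intro hjK
        rw [hu j (by omega), hu' j (by omega), ih (by omega)]
    rw [hu0, hu0', h1 K hi le_rfl]

/-! ### Laminar families of intervals and their cells -/

/-- A non-crossing set of chords `(p, q)`, `p < q < n`, with all sides of the polygon. -/
structure IsLaminar (n : ℕ) (E : ℕ → ℕ → Prop) : Prop where
  lt : ∀ {p q}, E p q → p < q
  bound : ∀ {p q}, E p q → q < n
  leaf : ∀ p, p + 1 < n → E p (p + 1)
  root : E 0 (n - 1)
  noncross : ∀ {p q r s}, E p q → E r s → p < r → r < q → q < s → False

/-- `c 0 < ⋯ < c K` are the vertices of the cell below the chord `(p, q)`. -/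
structure IsCellChain (E : ℕ → ℕ → Prop) (p q K : ℕ) (c : ℕ → ℕ) : Prop where
  two_le : 2 ≤ K
  first : c 0 = p
  last : c K = q
  edge : ∀ i < K, E (c i) (c (i + 1))
  maximal : ∀ r s, E r s → p ≤ r → s ≤ q → ¬ (r = p ∧ s = q) → ∃ i < K, c i ≤ r ∧ s ≤ c (i + 1)

/-- A choice of the cell below each chord. -/
structure IsCellSystem (n : ℕ) (E : ℕ → ℕ → Prop) (K : ℕ → ℕ → ℕ) (c : ℕ → ℕ → ℕ → ℕ) : Prop
    extends IsLaminar n E where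
  chain : ∀ {p q}, E p q → p + 2 ≤ q → IsCellChain E p q (K p q) (c p q)

section Chains

variable {n : ℕ} {E : ℕ → ℕ → Prop}

lemma IsCellChain.lt_of_lt (hE : IsLaminar n E) {p q K : ℕ} {c : ℕ → ℕ}
    (hc : IsCellChain E p q K c) {i j : ℕ} (hij : i < j) (hj : j ≤ K) : c i < c j := by
  induction j, hij using Nat.le_induction with
  | base => exact hE.lt (hc.edge i (by omega))
  | succ j _ ih => exact (ih (by omega)).trans (hE.lt (hc.edge j (by omega)))

lemma IsCellChain.le_of_le (hE : IsLaminar n E) {p q K : ℕ} {c : ℕ → ℕ}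
    (hc : IsCellChain E p q K c) {i j : ℕ} (hij : i ≤ j) (hj : j ≤ K) : c i ≤ c j := by
  rcases hij.eq_or_lt with rfl | h
  · exact le_rfl
  · exact (hc.lt_of_lt hE h hj).le

lemma IsCellChain.lt_iff (hE : IsLaminar n E) {p q K : ℕ} {c : ℕ → ℕ}
    (hc : IsCellChain E p q K c) {i j : ℕ} (hi : i ≤ K) (hj : j ≤ K) : c i < c j ↔ i < j := by
  refine ⟨fun h => ?_, fun h => hc.lt_of_lt hE h hj⟩
  by_contra h1
  exact absurd (hc.le_of_le hE (not_lt.1 h1) hi) (not_le.2 h)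

lemma IsCellChain.le_iff (hE : IsLaminar n E) {p q K : ℕ} {c : ℕ → ℕ}
    (hc : IsCellChain E p q K c) {i j : ℕ} (hi : i ≤ K) (hj : j ≤ K) : c i ≤ c j ↔ i ≤ j := by
  rw [← not_lt, hc.lt_iff hE hj hi, not_lt]

lemma IsCellChain.ge_first (hE : IsLaminar n E) {p q K : ℕ} {c : ℕ → ℕ}
    (hc : IsCellChain E p q K c) {i : ℕ} (hi : i ≤ K) : p ≤ c i := by
  have := hc.le_of_le hE (Nat.zero_le i) hi
  rwa [hc.first] at this

lemma IsCellChain.le_last (hE : IsLaminar n E) {p q K : ℕ} {c : ℕ → ℕ}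
    (hc : IsCellChain E p q K c) {i : ℕ} (hi : i ≤ K) : c i ≤ q := by
  have := hc.le_of_le hE hi le_rfl
  rwa [hc.last] at this

lemma IsCellChain.child_ne (hE : IsLaminar n E) {p q K : ℕ} {c : ℕ → ℕ}
    (hc : IsCellChain E p q K c) {i : ℕ} (hi : i < K) :
    c (i + 1) - c i < q - p := by
  have h1 := hc.two_le
  have h2 := hc.ge_first hE hi.le
  have h3 := hc.le_last hE (i := i + 1) hi
  have h4 := hE.lt (hc.edge i hi)
  rcases Nat.eq_zero_or_pos i with rfl | h0
  · have := hc.lt_of_lt hE (show 0 + 1 < K by omega) le_rfl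
    rw [hc.last] at this
    omega
  · have := hc.lt_of_lt hE h0 hi.le
    rw [hc.first] at this
    omega

lemma IsCellChain.exists_block {p q K : ℕ} {c : ℕ → ℕ}
    (hc : IsCellChain E p q K c) {a : ℕ} (h1 : p < a) (h2 : a ≤ q) :
    ∃ i < K, c i < a ∧ a ≤ c (i + 1) := by
  have : ∀ j ≤ K, a ≤ c j → ∃ i < j, c i < a ∧ a ≤ c (i + 1) := by
    intro j
    induction j with
    | zero => intro _ h; rw [hc.first] at h; omega
    | succ j ih =>
      intro hj h
      rcases le_or_gt a (c j) with h3 | h3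
      · obtain ⟨i, hi, h⟩ := ih (by omega) h3
        exact ⟨i, by omega, h⟩
      · exact ⟨j, by omega, h3, h⟩
  exact this K le_rfl (by rwa [hc.last])

/-- Every chord that is not a side has a cell below it. -/
lemma IsLaminar.exists_chain (hE : IsLaminar n E) {p q : ℕ} (hpq : E p q) (h2 : p + 2 ≤ q) :
    ∃ K c, IsCellChain E p q K c := by
  classical
  -- the right end of the largest chord starting at `a` and properly contained in `(p, q)`
  have hq := hE.bound hpq
  have ex : ∀ a, p ≤ a → a < q → ∃ b, E a b ∧ b ≤ q ∧ ¬ (a = p ∧ b = q) ∧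
      ∀ b', E a b' → b' ≤ q → ¬ (a = p ∧ b' = q) → b' ≤ b := by
    intro a h1 h3
    have hne : ∃ b, E a b ∧ b ≤ q ∧ ¬ (a = p ∧ b = q) :=
      ⟨a + 1, hE.leaf a (by omega), by omega, by omega⟩
    set P : ℕ → Prop := fun b => E a b ∧ b ≤ q ∧ ¬ (a = p ∧ b = q) with hP
    obtain ⟨b0, hb0⟩ := hne
    have h4 := Nat.findGreatest_spec (P := P) (n := q) hb0.2.1 hb0
    exact ⟨_, h4.1, h4.2.1, h4.2.2, fun b' h5 h6 h7 => Nat.le_findGreatest h6 ⟨h5, h6, h7⟩⟩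
  have ex' : ∀ a, ∃ b, p ≤ a → a < q → (E a b ∧ b ≤ q ∧ ¬ (a = p ∧ b = q) ∧
      ∀ b', E a b' → b' ≤ q → ¬ (a = p ∧ b' = q) → b' ≤ b) := by
    intro a
    by_cases h : p ≤ a ∧ a < q
    · obtain ⟨b, hb⟩ := ex a h.1 h.2
      exact ⟨b, fun _ _ => hb⟩
    · exact ⟨0, fun h1 h2 => absurd ⟨h1, h2⟩ h⟩
  choose nx hnx using ex'
  -- Walk greedily from `p`, each time along the longest chord inside `(p, q)` other than `(p, q)`
  -- itself; the positions increase and never pass `q`.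
  set c : ℕ → ℕ := fun i => nx^[i] p with hc
  have c0 : c 0 = p := rfl
  have cs : ∀ i, c (i + 1) = nx (c i) := fun i => Function.iterate_succ_apply' nx i p
  have hreach : ∃ K, c K = q ∧ ∀ i < K, c i < q := by
    have : ∀ d a, p ≤ a → a ≤ q → q - a ≤ d → ∃ K, nx^[K] a = q ∧ ∀ i < K, nx^[i] a < q := by
      intro d
      induction d with
      | zero => intro a h1 h2 h3; exact ⟨0, by simp; omega, by omega⟩
      | succ d ih =>
        intro a h1 h2 h3
        rcases h2.eq_or_lt with rfl | h4
        · exact ⟨0, by simp, by omega⟩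
        · have h5 := hnx a h1 h4
          have h6 := hE.lt h5.1
          obtain ⟨K, h7, h8⟩ := ih (nx a) (by omega) h5.2.1 (by omega)
          refine ⟨K + 1, by rwa [Function.iterate_succ_apply], fun i hi => ?_⟩
          rcases i with _ | i
          · simpa using h4
          · rw [Function.iterate_succ_apply]
            exact h8 i (by omega)
    exact this (q - p) p le_rfl (by omega) le_rfl
  obtain ⟨K, hK, hlt⟩ := hreach
  have hge : ∀ i ≤ K, p ≤ c i := by
    intro i
    induction i with
    | zero => intro _; exact le_rfl
    | succ i ih =>
      intro hi
      have h3 := ih (by omega)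
      rw [cs]
      exact h3.trans (hE.lt (hnx _ h3 (hlt i (by omega))).1).le
  have hsp : ∀ i < K, _ := fun i hi => hnx (c i) (hge i hi.le) (hlt i hi)
  have hK0 : K ≠ 0 := by rintro rfl; omega
  have hK1 : K ≠ 1 := by
    rintro rfl
    have := (hsp 0 (by omega)).2.2.1
    rw [← cs, hK] at this
    exact this ⟨c0, rfl⟩
  refine ⟨K, c, by omega, c0, hK, fun i hi => by rw [cs]; exact (hsp i hi).1, ?_⟩
  intro r s hrs hpr hsq hne
  have hrs' := hE.lt hrs
  -- locate the block containing `r`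
  have : ∀ j ≤ K, r < c j → ∃ i < j, c i ≤ r ∧ r < c (i + 1) := by
    intro j
    induction j with
    | zero => intro _ h; omega
    | succ j ih =>
      intro hj h
      rcases lt_or_ge r (c j) with h3 | h3
      · obtain ⟨i, hi, h⟩ := ih (by omega) h3
        exact ⟨i, by omega, h⟩
      · exact ⟨j, by omega, h3, h⟩
  obtain ⟨i, hi, h3, h4⟩ := this K le_rfl (by omega)
  refine ⟨i, hi, h3, ?_⟩
  have h5 := hsp i hi
  rcases h3.eq_or_lt with rfl | h3
  · rw [cs]
    exact h5.2.2.2 s hrs hsq hne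
  -- A chord that starts strictly inside a greedy step and ends beyond it would cross that step.
  · by_contra h6
    rw [cs] at h4 h6
    exact hE.noncross h5.1 hrs h3 h4 (by omega)

lemma IsLaminar.exists_cellSystem (hE : IsLaminar n E) : ∃ K c, IsCellSystem n E K c := by
  have : ∀ p q, ∃ K c, E p q → p + 2 ≤ q → IsCellChain E p q K c := by
    intro p q
    by_cases h : E p q ∧ p + 2 ≤ q
    · obtain ⟨K, c, hc⟩ := hE.exists_chain h.1 h.2
      exact ⟨K, c, fun _ _ => hc⟩
    · exact ⟨0, id, fun h1 h2 => absurd ⟨h1, h2⟩ h⟩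
  choose K c hc using this
  exact ⟨K, c, ⟨hE, fun {p q} => hc p q⟩⟩

/-- A cell system with a prescribed cell. -/
lemma IsLaminar.exists_cellSystem_extending (hE : IsLaminar n E) {p q K₀ : ℕ} {c₀ : ℕ → ℕ}
    (h : IsCellChain E p q K₀ c₀) : ∃ K c, IsCellSystem n E K c ∧ K p q = K₀ ∧ c p q = c₀ := by
  classical
  obtain ⟨K, c, hc⟩ := hE.exists_cellSystem
  refine ⟨fun r s => if r = p ∧ s = q then K₀ else K r s,
    fun r s => if r = p ∧ s = q then c₀ else c r s, ⟨hE, fun {r s} h1 h2 => ?_⟩, by simp, by simp⟩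
  by_cases h3 : r = p ∧ s = q
  · simp only [h3, and_self, if_true]
    exact h
  · simp only [h3, if_false]
    exact hc.chain h1 h2

end Chains

/-! ### Height functions on a laminar family -/

/-- The minimal height strictly between the ends of a chord; for a side, the larger of the heights
of its ends. -/
noncomputable def overMin (h : ℕ → ℝ) (p q : ℕ) : ℝ :=
  if q = p + 1 then max (h p) (h q) else intervalMin h (p + 1) (q - 1)

section OverMin

variable {h h' : ℕ → ℝ} {n : ℕ} {E : ℕ → ℕ → Prop}

lemma overMin_of_le {p q : ℕ} (hpq : p + 2 ≤ q) :
    overMin h p q = intervalMin h (p + 1) (q - 1) := by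
  rw [overMin, if_neg (by omega)]

/-- The value of `overMin` on sides is chosen so that this also holds there, and so that sides have
coordinate zero (`edgeCoord_max`). -/
lemma min_overMin {p q : ℕ} (hpq : p < q) :
    min (overMin h p q) (h q) = intervalMin h (p + 1) q := by
  unfold overMin
  split_ifs with h1
  · rw [min_eq_right (le_max_right _ _), h1, intervalMin_self]
  · rw [← intervalMin_pred_right (show p + 1 < q by omega)]

lemma overMin_congr {p q : ℕ} (hpq : p < q) (H : ∀ a, p ≤ a → a ≤ q → h a = h' a) :
    overMin h p q = overMin h' p q := by
  unfold overMin
  split_ifs with h1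
  · rw [H p le_rfl hpq.le, H q hpq.le le_rfl]
  · exact intervalMin_congr (by omega) fun a h1 h2 => H a (by omega) (by omega)

/-- The open interval from `p` to `q` is cut into half-open blocks. The last one stays open because
`q` is excluded, so `h (c K)` does not enter. -/
lemma IsCellChain.le_overMin_iff (hE : IsLaminar n E) {p q K : ℕ} {c : ℕ → ℕ}
    (hc : IsCellChain E p q K c) (a : ℝ) :
    a ≤ overMin h p q ↔ (∀ i, i + 1 < K → a ≤ min (overMin h (c i) (c (i + 1))) (h (c (i + 1)))) ∧
      a ≤ overMin h (c (K - 1)) (c (K - 1 + 1)) := by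
  have hK := hc.two_le
  have hlen := hc.child_ne hE (i := 0) (by omega)
  have hlt := hE.lt (hc.edge 0 (by omega))
  have hpq : p + 2 ≤ q := by omega
  have hKK : c (K - 1 + 1) = q := by rw [Nat.sub_add_cancel (by omega), hc.last]
  have hl1 := hE.lt (hc.edge (K - 1) (by omega))
  have hl2 : p < c (K - 1) := by
    have := hc.lt_of_lt hE (show 0 < K - 1 by omega) (by omega)
    rwa [hc.first] at this
  rw [hKK] at hl1 ⊢
  rw [overMin_of_le hpq, le_intervalMin_iff (by omega)]
  constructor
  · intro H
    refine ⟨fun i hi => ?_, ?_⟩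
    · rw [min_overMin (hE.lt (hc.edge i (by omega))),
        le_intervalMin_iff (hE.lt (hc.edge i (by omega)))]
      intro b h1 h2
      have := hc.ge_first hE (i := i) (by omega)
      have h3 := hc.lt_of_lt hE hi le_rfl
      rw [hc.last] at h3
      exact H b (by omega) (by omega)
    · unfold overMin
      -- If the last edge is a side, its conventional value dominates the height at `c (K - 1)`,
      -- which already lies over `(p, q)`.
      split_ifs with h1
      · exact (H _ (by omega) (by omega)).trans (le_max_left _ _)
      · rw [le_intervalMin_iff (by omega)]
        exact fun b h1 h2 => H b (by omega) (by omega)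
  · rintro ⟨H1, H2⟩ b hb1 hb2
    obtain ⟨i, hi, h1, h2⟩ := hc.exists_block (a := b) (by omega) (by omega)
    by_cases h3 : i + 1 < K
    · have := H1 i h3
      rw [min_overMin (hE.lt (hc.edge i hi)), le_intervalMin_iff (by omega)] at this
      exact this b h1 h2
    · obtain rfl : i = K - 1 := by omega
      rw [overMin_of_le (by omega), le_intervalMin_iff (by omega)] at H2
      exact H2 b (by omega) (by omega)

end OverMin

/-- The accordion condition on heights in the cell with vertices `c 0, …, c K`. -/
def IsGoodCell (h : ℕ → ℝ) (K : ℕ) (c : ℕ → ℕ) : Prop :=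
  ∀ i, 0 < i → i + 1 < K → intervalMin h (c i + 1) (c (i + 1)) =
    max (intervalMin h (c 0 + 1) (c 1)) (intervalMin h (c (K - 1) + 1) (c K))

section Cells

variable {n : ℕ} {E : ℕ → ℕ → Prop} {h : ℕ → ℝ} {p q K : ℕ} {c : ℕ → ℕ}

lemma IsCellChain.isCellMin_iff (hE : IsLaminar n E) (hc : IsCellChain E p q K c) :
    IsCellMin K (fun i => h (c i)) (fun i => overMin h (c i) (c (i + 1))) (overMin h p q) ↔
      IsGoodCell h K c := by
  have hK := hc.two_le
  have e : ∀ i < K, min (overMin h (c i) (c (i + 1))) (h (c (i + 1))) =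
      intervalMin h (c i + 1) (c (i + 1)) := fun i hi => min_overMin (hE.lt (hc.edge i hi))
  have e0 := e 0 (by omega)
  have eK := e (K - 1) (by omega)
  rw [Nat.sub_add_cancel (by omega)] at eK
  have key : (∀ i, 0 < i → i + 1 < K → min (overMin h (c i) (c (i + 1))) (h (c (i + 1))) =
      max (min (overMin h (c 0) (c (0 + 1))) (h (c 1)))
        (min (overMin h (c (K - 1)) (c (K - 1 + 1))) (h (c K)))) ↔ IsGoodCell h K c := by
    rw [Nat.sub_add_cancel (by omega : 1 ≤ K), eK, e0]
    exact forall_congr' fun i => forall_congr' fun h1 => forall_congr' fun h2 => by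
      rw [e i (by omega)]
  constructor
  · intro H
    exact key.1 H.mid
  · intro H
    exact ⟨hc.le_overMin_iff hE, key.2 H⟩

end Cells

/-! ### Reconstruction of heights from coordinates -/

section Reconstruction

variable {n : ℕ} {E : ℕ → ℕ → Prop} {K : ℕ → ℕ → ℕ} {c : ℕ → ℕ → ℕ → ℕ}

/-- Below the chord `(p, q)`, the heights `h` have coordinates `x` and obey the accordion
condition. -/
structure IsSolutionBelow (E : ℕ → ℕ → Prop) (K : ℕ → ℕ → ℕ) (c : ℕ → ℕ → ℕ → ℕ)
    (x : ℕ → ℕ → ℝ) (p q : ℕ) (h : ℕ → ℝ) : Prop where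
  coord : ∀ r s, E r s → p ≤ r → s ≤ q → ¬ (r = p ∧ s = q) →
    edgeCoord (h r) (h s) (overMin h r s) = x r s
  good : ∀ r s, E r s → p ≤ r → s ≤ q → r + 2 ≤ s → IsGoodCell h (K r s) (c r s)

/-- In each cell, the cyclic system has at most one solution. -/
def HasUniqueCells (E : ℕ → ℕ → Prop) (K : ℕ → ℕ → ℕ) (c : ℕ → ℕ → ℕ → ℕ)
    (x : ℕ → ℕ → ℝ) : Prop :=
  ∀ p q, E p q → p + 2 ≤ q → Even (K p q) ∨ x p q ≤ 0 ∨
    ∃ i < K p q, x (c p q i) (c p q (i + 1)) ≤ 0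

lemma IsSolutionBelow.exists_cellSolution (hS : IsCellSystem n E K c) {x : ℕ → ℕ → ℝ}
    {p q : ℕ} (hpq : E p q) (h2 : p + 2 ≤ q) {h : ℕ → ℝ} (hh : IsSolutionBelow E K c x p q h) :
    ∃ s u, IsCellSolution (K p q) (fun i => h (c p q i)) (fun i => x (c p q i) (c p q (i + 1)))
      (fun i => overMin h (c p q i) (c p q (i + 1))) (overMin h p q) s u := by
  have hc := hS.chain hpq h2
  refine IsCellMin.exists_solution hc.two_le (fun i hi => ?_)
    ((hc.isCellMin_iff hS.toIsLaminar).2 (hh.good p q hpq le_rfl le_rfl h2))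
  refine hh.coord _ _ (hc.edge i hi) (hc.ge_first hS.toIsLaminar hi.le)
    (hc.le_last hS.toIsLaminar hi) ?_
  have := hc.child_ne hS.toIsLaminar hi
  omega

/-- Closes the cycle: `u 0` and `u K` contain `s` with opposite signs, so it cancels against the
coordinate of the top edge. -/
lemma IsCellSolution.cyclic {K : ℕ} {y x μ : ℕ → ℝ} {m s : ℝ} {u : ℕ → ℝ}
    (h : IsCellSolution K y x μ m s u) {X : ℝ}
    (hX : max X 0 = max (y 0 - m) 0 + max (y K - m) 0) : u 0 = max (max X 0 - u K) 0 := by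
  rw [h.u_zero, h.u_last, hX]
  congr 1
  ring

/-- Heights are determined by their coordinates. -/
lemma IsSolutionBelow.unique (hS : IsCellSystem n E K c) {x : ℕ → ℕ → ℝ}
    (hx : HasUniqueCells E K c x) {h h' : ℕ → ℝ} :
    ∀ d p q, q - p ≤ d → E p q → IsSolutionBelow E K c x p q h →
      IsSolutionBelow E K c x p q h' → h p = h' p → h q = h' q →
      overMin h p q = overMin h' p q → edgeCoord (h p) (h q) (overMin h p q) = x p q →
      ∀ a, p ≤ a → a ≤ q → h a = h' a := by
  have hE := hS.toIsLaminar
  intro d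
  induction d with
  | zero => intro p q hd hpq; have := hE.lt hpq; omega
  | succ d ih =>
    intro p q hd hpq hh hh' ep eq em ex a ha1 ha2
    have hlt := hE.lt hpq
    rcases (show q = p + 1 ∨ p + 2 ≤ q by omega) with rfl | h2
    · rcases (show a = p ∨ a = p + 1 by omega) with rfl | rfl
      · exact ep
      · exact eq
    have hc := hS.chain hpq h2
    have hK := hc.two_le
    obtain ⟨s, u, hs⟩ := hh.exists_cellSolution hS hpq h2
    obtain ⟨s', u', hs'⟩ := hh'.exists_cellSolution hS hpq h2
    have hX : max (x p q) 0 = max (h p - overMin h p q) 0 + max (h q - overMin h p q) 0 := by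
      rw [← ex, max_edgeCoord]
    have hu0 := hs.cyclic (X := x p q) (by simpa only [hc.first, hc.last] using hX)
    have hu0' := hs'.cyclic (X := x p q)
      (by simpa only [hc.first, hc.last, ← ep, ← eq, ← em] using hX)
    -- The only place where parity or a nonpositive coordinate enters: both height functions yield
    -- the same `u`, hence the same `s`.
    have huu := cyclic_solution_unique hs.step hu0 hs'.step hu0' (by
      rcases hx p q hpq h2 with h | h | ⟨i, hi, h⟩
      · exact Or.inl h
      · exact Or.inr (Or.inl (max_le h le_rfl))
      · exact Or.inr (Or.inr ⟨i, hi, max_le h le_rfl⟩))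
    have ss : s = s' := by
      have h1 := hs.u_last
      have h3 := hs'.u_last
      simp only [hc.last] at h1 h3
      rw [huu _ le_rfl, eq, em] at h1
      linarith
    subst ss
    have hcoord : ∀ {g : ℕ → ℝ}, IsSolutionBelow E K c x p q g → ∀ i < K p q,
        edgeCoord (g (c p q i)) (g (c p q (i + 1))) (overMin g (c p q i) (c p q (i + 1))) =
          x (c p q i) (c p q (i + 1)) := fun hg i hi => by
      refine hg.coord _ _ (hc.edge i hi) (hc.ge_first hE hi.le) (hc.le_last hE hi) ?_
      have := hc.child_ne hE hi
      omega
    have hrel : ∀ {g : ℕ → ℝ}, IsSolutionBelow E K c x p q g → ∀ i < K p q,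
        g (c p q (i + 1)) = rightHeight (max (x (c p q i) (c p q (i + 1))) 0) (g (c p q i))
          (min (overMin g (c p q i) (c p q (i + 1))) (g (c p q (i + 1)))) := fun hg i hi => by
      rw [← hcoord hg i hi]
      exact eq_rightHeight _ _ _
    -- The block minima depend only on `m` and `s`, so `rightHeight` carries the equality from
    -- vertex to vertex.
    have hv : ∀ i ≤ K p q, h (c p q i) = h' (c p q i) := by
      intro i hi
      rcases hi.eq_or_lt with rfl | hi
      · rw [hc.last, eq]
      induction i with
      | zero => rw [hc.first, ep]
      | succ i ihi =>
        rw [hrel hh i (by omega), hrel hh' i (by omega), ihi (by omega) (by omega)]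
        congr 1
        rcases Nat.eq_zero_or_pos i with rfl | hi0
        · exact (hs.first.trans (by rw [em])).trans hs'.first.symm
        · exact ((hs.mid i hi0 hi).trans (by rw [em])).trans (hs'.mid i hi0 hi).symm
    rcases ha1.eq_or_lt with rfl | ha1
    · exact ep
    obtain ⟨i, hi, h3, h4⟩ := hc.exists_block ha1 ha2
    have hed := hc.edge i hi
    have hg1 := hc.ge_first hE hi.le
    have hg2 := hc.le_last hE (i := i + 1) hi
    have hch := hc.child_ne hE hi
    have hsub : ∀ {g : ℕ → ℝ}, IsSolutionBelow E K c x p q g →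
        IsSolutionBelow E K c x (c p q i) (c p q (i + 1)) g := fun hg =>
      ⟨fun r s h1 h2 h3 _ => hg.coord r s h1 (by omega) (by omega)
        (by have := hE.lt h1; omega),
        fun r s h1 h2 h3 => hg.good r s h1 (by omega) (by omega)⟩
    refine ih _ _ (by omega) hed (hsub hh) (hsub hh') (hv i hi.le) (hv (i + 1) hi) ?_
      (hcoord hh i hi) a h3.le h4
    -- Equal end heights and equal coordinates force equal minima over the child, which is what the
    -- recursion needs.
    refine edgeCoord_inj (y := h (c p q i)) (z := h (c p q (i + 1))) ?_
    rw [hcoord hh i hi, hv i hi.le, hv (i + 1) hi, hcoord hh' i hi]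

lemma IsGoodCell.congr {h h' : ℕ → ℝ} {p q k : ℕ} {v : ℕ → ℕ} (hE : IsLaminar n E)
    (hc : IsCellChain E p q k v) (H : ∀ a, p ≤ a → a ≤ q → h a = h' a) (hh : IsGoodCell h k v) :
    IsGoodCell h' k v := by
  have hK := hc.two_le
  have e : ∀ i < k, intervalMin h (v i + 1) (v (i + 1)) = intervalMin h' (v i + 1) (v (i + 1)) :=
    fun i hi => intervalMin_congr (hE.lt (hc.edge i hi)) fun a h1 h2 =>
      H a (by have := hc.ge_first hE hi.le; omega)
        (by have := hc.le_last hE (i := i + 1) hi; omega)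
  have eK := e (k - 1) (by omega)
  rw [Nat.sub_add_cancel (by omega)] at eK
  intro i h1 h2
  rw [← e i (by omega), ← e 0 (by omega), ← eK]
  exact hh i h1 h2

/-- Heights with given coordinates exist, for every choice of solutions `u` of the cyclic systems
of the cells. -/
lemma exists_solutionBelow (hS : IsCellSystem n E K c) {x : ℕ → ℕ → ℝ}
    (hleaf : ∀ p, x p (p + 1) = 0) {u : ℕ → ℕ → ℕ → ℝ}
    (hu : ∀ p q, E p q → p + 2 ≤ q → ∀ i < K p q,
      u p q (i + 1) = max (max (x (c p q i) (c p q (i + 1))) 0 - u p q i) 0)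
    (hu0 : ∀ p q, E p q → p + 2 ≤ q → u p q 0 = max (max (x p q) 0 - u p q (K p q)) 0) :
    ∀ d p q, q - p ≤ d → E p q → ∀ yp yq m : ℝ, edgeCoord yp yq m = x p q →
      ∃ h : ℕ → ℝ, h p = yp ∧ h q = yq ∧ overMin h p q = m ∧ IsSolutionBelow E K c x p q h ∧
        ∀ r s, E r s → p ≤ r → s ≤ q → r + 2 ≤ s → ∃ t, IsCellSolution (K r s)
          (fun i => h (c r s i)) (fun i => x (c r s i) (c r s (i + 1)))
          (fun i => overMin h (c r s i) (c r s (i + 1))) (overMin h r s) t (u r s) := by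
  have hE := hS.toIsLaminar
  intro d
  induction d with
  | zero => intro p q hd hpq; have := hE.lt hpq; omega
  | succ d ih =>
    intro p q hd hpq yp yq m hm
    have hlt := hE.lt hpq
    rcases (show q = p + 1 ∨ p + 2 ≤ q by omega) with rfl | h2
    -- A side has no interior point, so `m` cannot be chosen; its coordinate zero makes `m` the
    -- larger end height, as `overMin` requires.
    · refine ⟨fun a => if a = p then yp else yq, by simp, by simp, ?_, ⟨?_, ?_⟩, ?_⟩
      · rw [overMin, if_pos rfl]
        simp only [if_true, Nat.succ_ne_self, if_false]
        refine edgeCoord_inj (y := yp) (z := yq) ?_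
        rw [edgeCoord_max, hm, hleaf]
      · intro r s h1 h2 h3
        have := hE.lt h1
        omega
      · intro r s h1 h2 h3
        omega
      · intro r s h1 h2 h3
        omega
    have hc := hS.chain hpq h2
    have hK := hc.two_le
    obtain ⟨y, y0, yK, hy⟩ := exists_cell (y0 := yp) (yK := yq) (m := m) hK (hu p q hpq h2) (by
      rw [← max_edgeCoord, hm]
      exact hu0 p q hpq h2)
    -- The vertices of the cell are fixed first; surjectivity of `edgeCoord` then gives the minimum
    -- to be realised over each child.
    choose! μ hμ using fun i (_ : i < K p q) =>
      edgeCoord_surjective (y i) (y (i + 1)) (x (c p q i) (c p q (i + 1)))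
    obtain ⟨hmin, t, ht⟩ := hy μ hμ
    have hex : ∀ i, ∃ g : ℕ → ℝ, i < K p q → (g (c p q i) = y i ∧ g (c p q (i + 1)) = y (i + 1) ∧
        overMin g (c p q i) (c p q (i + 1)) = μ i ∧
        IsSolutionBelow E K c x (c p q i) (c p q (i + 1)) g ∧
        ∀ r s, E r s → c p q i ≤ r → s ≤ c p q (i + 1) → r + 2 ≤ s → ∃ t, IsCellSolution (K r s)
          (fun i => g (c r s i)) (fun i => x (c r s i) (c r s (i + 1)))
          (fun i => overMin g (c r s i) (c r s (i + 1))) (overMin g r s) t (u r s)) := by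
      intro i
      by_cases hi : i < K p q
      · have hch := hc.child_ne hE hi
        obtain ⟨g, hg⟩ := ih _ _ (by omega) (hc.edge i hi) _ _ _ (hμ i hi)
        exact ⟨g, fun _ => hg⟩
      · exact ⟨0, fun h => absurd h hi⟩
    choose g hg using hex
    classical
    -- glue the heights of the blocks
    have hbl : ∀ a, ∃ i, p < a → a ≤ q → i < K p q ∧ c p q i < a ∧ a ≤ c p q (i + 1) := by
      intro a
      by_cases ha : p < a ∧ a ≤ q
      · obtain ⟨i, hi⟩ := hc.exists_block ha.1 ha.2
        exact ⟨i, fun _ _ => hi⟩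
      · exact ⟨0, fun h1 h2 => absurd ⟨h1, h2⟩ ha⟩
    choose b hb using hbl
    set h : ℕ → ℝ := fun a => if a = p then yp else g (b a) a with hh
    -- Neighbouring children share only a vertex, where both local height functions take the value
    -- `y`.
    have hgl : ∀ i < K p q, ∀ a, c p q i ≤ a → a ≤ c p q (i + 1) → h a = g i a := by
      intro i hi a h1 h3
      have hp := hc.ge_first hE hi.le
      have hq := hc.le_last hE (i := i + 1) hi
      rcases eq_or_ne a p with rfl | hap
      · have hi0 : i = 0 := by
          by_contra hi0
          have := hc.lt_of_lt hE (Nat.pos_of_ne_zero hi0) hi.le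
          rw [hc.first] at this
          omega
        subst hi0
        have := (hg 0 hi).1
        rw [hc.first] at this
        simp only [hh, if_true]
        rw [this, y0]
      · simp only [hh, if_neg hap]
        obtain ⟨h4, h5, h6⟩ := hb a (by omega) (by omega)
        have h7 : b a ≤ i := by
          have := (hc.lt_iff hE h4.le (show i + 1 ≤ K p q from hi)).1 (by omega)
          omega
        rcases h7.eq_or_lt with h7 | h7
        · rw [h7]
        · have h8 : c p q (b a + 1) ≤ c p q i := hc.le_of_le hE h7 hi.le
          have h9 : a = c p q i := by omega
          have h10 : b a + 1 = i := by
            by_contra hne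
            have := hc.lt_of_lt hE (show b a + 1 < i by omega) hi.le
            omega
          subst h9
          rw [(hg i hi).1]
          have := (hg (b (c p q i)) h4).2.1
          rw [h10] at this
          exact this
    have hv : ∀ i ≤ K p q, h (c p q i) = y i := by
      intro i hi
      rcases hi.eq_or_lt with rfl | hi
      · obtain ⟨k, hk⟩ : ∃ k, K p q = k + 1 := ⟨K p q - 1, by omega⟩
        have := hgl k (by omega) (c p q (k + 1)) (hE.lt (hc.edge k (by omega))).le le_rfl
        rw [hk, this, (hg k (by omega)).2.1]
      · rw [hgl i hi _ le_rfl (hE.lt (hc.edge i hi)).le, (hg i hi).1]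
    have hov : ∀ i < K p q, overMin h (c p q i) (c p q (i + 1)) = μ i := fun i hi => by
      rw [overMin_congr (hE.lt (hc.edge i hi)) (hgl i hi), (hg i hi).2.2.1]
    have hm' : overMin h p q = m := by
      refine eq_of_forall_le_iff fun a => ?_
      rw [hmin.le_iff, hc.le_overMin_iff hE, hov _ (by omega)]
      refine and_congr_left fun _ => forall_congr' fun i => forall_congr' fun hi => ?_
      rw [hov i (by omega), hv (i + 1) (by omega)]
    have hsys : IsCellSolution (K p q) (fun i => h (c p q i))
        (fun i => x (c p q i) (c p q (i + 1)))
        (fun i => overMin h (c p q i) (c p q (i + 1))) (overMin h p q) t (u p q) := by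
      refine ⟨?_, fun i h1 h2 => ?_, ?_, fun i h1 h2 => ?_, ?_, ht.step⟩
      · simp only [hov 0 (by omega), hv 1 (by omega), hm']
        exact ht.first
      · simp only [hov i (by omega), hv (i + 1) (by omega), hm']
        exact ht.mid i h1 h2
      · simp only [hv 0 (by omega), hm']
        exact ht.u_zero
      · simp only [hv i (by omega), hm']
        exact ht.u_mid i h1 h2
      · simp only [hv _ le_rfl, hm']
        exact ht.u_last
    have hgood : IsGoodCell h (K p q) (c p q) := by
      refine (hc.isCellMin_iff hE).1 ⟨hc.le_overMin_iff hE, fun i h1 h2 => ?_⟩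
      have h3 := hmin.mid i h1 h2
      simp only [hov i (by omega), hv (i + 1) (by omega), hov 0 (by omega), hv 1 (by omega),
        hov (K p q - 1) (by omega), hv _ le_rfl]
      exact h3
    refine ⟨h, ?_, ?_, hm', ⟨fun r s h1 h3 h4 h5 => ?_, fun r s h1 h3 h4 h5 => ?_⟩,
      fun r s h1 h3 h4 h5 => ?_⟩
    · rw [← hc.first, hv 0 (by omega), y0]
    · rw [← hc.last, hv _ le_rfl, yK]
    · obtain ⟨i, hi, h6, h7⟩ := hc.maximal r s h1 h3 h4 h5
      have h8 := hE.lt h1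
      rw [overMin_congr h8 fun a h9 h10 => hgl i hi a (by omega) (by omega),
        hgl i hi r h6 (by omega), hgl i hi s (by omega) h7]
      by_cases h9 : r = c p q i ∧ s = c p q (i + 1)
      · rw [h9.1, h9.2, (hg i hi).1, (hg i hi).2.1, (hg i hi).2.2.1]
        exact hμ i hi
      · exact (hg i hi).2.2.2.1.coord r s h1 h6 h7 h9
    · by_cases h9 : r = p ∧ s = q
      · rw [h9.1, h9.2]
        exact hgood
      · obtain ⟨i, hi, h6, h7⟩ := hc.maximal r s h1 h3 h4 h9
        exact ((hg i hi).2.2.2.1.good r s h1 h6 h7 h5).congr hE (hS.chain h1 h5)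
          fun a h10 h11 => (hgl i hi a (by omega) (by omega)).symm
    · by_cases h9 : r = p ∧ s = q
      · rw [h9.1, h9.2]
        exact ⟨t, hsys⟩
      · obtain ⟨i, hi, h6, h7⟩ := hc.maximal r s h1 h3 h4 h9
        have hrs := hS.chain h1 h5
        obtain ⟨t', ht'⟩ := (hg i hi).2.2.2.2 r s h1 h6 h7 h5
        have ev : ∀ j ≤ K r s, h (c r s j) = g i (c r s j) := fun j hj =>
          hgl i hi _ (h6.trans (hrs.ge_first hE hj)) ((hrs.le_last hE hj).trans h7)
        have eo : ∀ j < K r s, overMin h (c r s j) (c r s (j + 1)) =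
            overMin (g i) (c r s j) (c r s (j + 1)) := fun j hj =>
          overMin_congr (hE.lt (hrs.edge j hj)) fun a h10 h11 =>
            hgl i hi a ((h6.trans (hrs.ge_first hE hj.le)).trans h10)
              ((h11.trans (hrs.le_last hE hj)).trans h7)
        have em : overMin h r s = overMin (g i) r s :=
          overMin_congr (hE.lt h1) fun a h10 h11 => hgl i hi a (by omega) (by omega)
        have hk := hrs.two_le
        refine ⟨t', ?_, fun j h1 h2 => ?_, ?_, fun j h1 h2 => ?_, ?_, ht'.step⟩
        · simp only [eo 0 (by omega), ev 1 (by omega), em]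
          exact ht'.first
        · simp only [eo j (by omega), ev (j + 1) (by omega), em]
          exact ht'.mid j h1 h2
        · simp only [ev 0 (by omega), em]
          exact ht'.u_zero
        · simp only [ev j (by omega), em]
          exact ht'.u_mid j h1 h2
        · simp only [ev _ le_rfl, em]
          exact ht'.u_last

end Reconstruction

/-! ### Accordion chords -/

/-- The chord `(a, b)` passes from one edge of a cell to an adjacent edge, in every cell. -/
structure IsAccordionChord (E : ℕ → ℕ → Prop) (K : ℕ → ℕ → ℕ) (c : ℕ → ℕ → ℕ → ℕ)
    (a b : ℕ) : Prop where
  adj : ∀ p q, E p q → p + 2 ≤ q → ∀ i j, i < K p q → j < K p q → c p q i < a →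
    a ≤ c p q (i + 1) → c p q j < b → b ≤ c p q (j + 1) → j ≤ i + 1
  left : ∀ p q, E p q → p + 2 ≤ q → a ≤ p → ∀ j < K p q, c p q j < b → b ≤ c p q (j + 1) →
    j = 0 ∨ j + 1 = K p q
  right : ∀ p q, E p q → p + 2 ≤ q → q < b → ∀ i < K p q, c p q i < a → a ≤ c p q (i + 1) →
    i = 0 ∨ i + 1 = K p q

section AccordionHeights

variable {n : ℕ} {E : ℕ → ℕ → Prop} {K : ℕ → ℕ → ℕ} {c : ℕ → ℕ → ℕ → ℕ}

/-- Block minima are cover weights by `cover_eq_min`. The accordion condition empties certain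
rectangles of chords, so a cover weight is unchanged when its interval is enlarged to include the
first or the last block. -/
lemma IsFamily.isGoodCell (hS : IsCellSystem n E K c) {w : ℕ → ℕ → ℝ} (hw : IsFamily n w)
    (hacc : ∀ a b, w a b ≠ 0 → IsAccordionChord E K c a b) {p q : ℕ} (hpq : E p q)
    (h2 : p + 2 ≤ q) : IsGoodCell (height n w) (K p q) (c p q) := by
  have hE := hS.toIsLaminar
  have hc := hS.chain hpq h2
  have hK := hc.two_le
  have hqn := hE.bound hpq
  have rect0 : ∀ {i i' j j' : ℕ}, i ≤ i' → j ≤ j' → j' < n →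
      (∀ a b, i ≤ a → a < i' → j < b → b ≤ j' → w a b = 0) →
      coverWeight n w i' j - coverWeight n w i j - coverWeight n w i' j' +
        coverWeight n w i j' = 0 := by
    intro i i' j j' h3 h4 h5 H
    rw [← rect_sum h3 h4 h5]
    refine Finset.sum_eq_zero fun a ha => Finset.sum_eq_zero fun b hb => ?_
    simp only [Finset.mem_Ico] at ha hb
    exact H a b ha.1 ha.2 (by omega) (by omega)
  intro i h0 hi
  have o1 := hc.lt_of_lt hE h0 (by omega)
  have o2 := hc.lt_of_lt hE (Nat.lt_succ_self i) (by omega)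
  have o3 := hc.lt_of_lt hE hi le_rfl
  have o4 := hc.le_of_le hE (show 1 ≤ i by omega) (by omega)
  have o5 := hc.le_of_le hE (show i + 1 ≤ K p q - 1 by omega) (by omega)
  have o6 := hE.lt (hc.edge 0 (by omega))
  have o7 := hE.lt (hc.edge (K p q - 1) (by omega))
  rw [Nat.sub_add_cancel (by omega)] at o7
  have e0 := hc.first
  have eK := hc.last
  simp only [Nat.succ_eq_add_one, zero_add] at o2 o6
  apply le_antisymm
  -- If a chord over block `i` starts inside the cell, it must end beyond `q`, and no chord over the
  -- block ends in between; the minimum then extends to the last block. Otherwise every chord over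
  -- the block starts at or before `p`, and it extends to the first block.
  · by_cases hex : ∃ a b, p < a ∧ a ≤ c p q i ∧ c p q (i + 1) < b ∧ w a b ≠ 0
    · obtain ⟨a', b', h3, h4, h5, h6⟩ := hex
      have far : ∀ a b, p < a → a ≤ c p q i → c p q (i + 1) < b → w a b ≠ 0 → q < b := by
        intro a b h3 h4 h5 h6
        by_contra h7
        obtain ⟨r, hr, h8, h9⟩ := hc.exists_block h3 (by omega)
        obtain ⟨t, ht, h10, h11⟩ := hc.exists_block (a := b) (by omega) (by omega)
        have h12 := (hacc a b h6).adj p q hpq h2 r t hr ht h8 h9 h10 h11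
        have h13 : r < i := (hc.lt_iff hE hr.le (by omega)).1 (by omega)
        have h14 : i + 1 < t + 1 := (hc.lt_iff hE (by omega) (by omega)).1 (by omega)
        omega
      have h7 := far a' b' h3 h4 h5 h6
      have := rect0 (i := 0) (i' := c p q i + 1) (j := c p q (i + 1)) (j' := q) (by omega)
        (by omega) hqn (by
          intro a b _ h8 h9 h10
          by_contra h11
          rcases le_or_gt a p with h12 | h12
          · exact hw.noncross a b a' b' h11 h6 (by omega) (by omega) (by omega)
          · have := far a b h12 (by omega) h9 h11
            omega)
      rw [coverWeight_zero_left, coverWeight_zero_left, hw.cover_eq_min (by omega) (by omega),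
        hw.cover_eq_min (by omega) hqn] at this
      refine le_trans (le_trans (by linarith : _ ≤ intervalMin (height n w) (c p q i + 1) q) ?_)
        (le_max_right _ _)
      rw [eK]
      exact intervalMin_anti (by omega) (by omega) le_rfl
    · push Not at hex
      have := rect0 (i := p + 1) (i' := c p q i + 1) (j := c p q (i + 1)) (j' := n - 1) (by omega)
        (by omega) (by omega) (fun a b h8 h9 h10 _ => hex a b (by omega) (by omega) h10)
      rw [coverWeight_last (by omega : n ≤ n - 1 + 1), coverWeight_last (by omega : n ≤ n - 1 + 1),
        hw.cover_eq_min (by omega) (by omega), hw.cover_eq_min (by omega) (by omega)] at this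
      refine le_trans (le_trans (by linarith :
        _ ≤ intervalMin (height n w) (p + 1) (c p q (i + 1))) ?_) (le_max_left _ _)
      rw [e0]
      exact intervalMin_anti (by omega) le_rfl (by omega)
  · apply max_le
    · have := rect0 (i := 0) (i' := p + 1) (j := c p q 1) (j' := c p q (i + 1)) (by omega)
        (by omega) (by omega) (by
          intro a b _ h3 h4 h5
          by_contra h6
          obtain ⟨t, ht, h10, h11⟩ := hc.exists_block (a := b) (by omega) (by omega)
          have h12 : 1 < t + 1 := (hc.lt_iff hE (by omega) (by omega)).1 (by omega)
          have h13 : t < i + 1 := (hc.lt_iff hE (by omega) (by omega)).1 (by omega)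
          have := (hacc a b h6).left p q hpq h2 (by omega) t ht h10 h11
          omega)
      rw [coverWeight_zero_left, coverWeight_zero_left, hw.cover_eq_min (by omega) (by omega),
        hw.cover_eq_min (by omega) (by omega)] at this
      rw [e0]
      refine le_trans (by linarith :
        _ ≤ intervalMin (height n w) (p + 1) (c p q (i + 1))) ?_
      exact intervalMin_anti (by omega) (by omega) le_rfl
    · have := rect0 (i := c p q i + 1) (i' := c p q (K p q - 1) + 1) (j := q) (j' := n - 1)
        (by omega) (by omega) (by omega) (by
          intro a b h3 h4 h5 _
          by_contra h6
          obtain ⟨t, ht, h10, h11⟩ := hc.exists_block (a := a) (by omega) (by omega)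
          have h12 : i < t + 1 := (hc.lt_iff hE (by omega) (by omega)).1 (by omega)
          have h13 : t < K p q - 1 := (hc.lt_iff hE (by omega) (by omega)).1 (by omega)
          have := (hacc a b h6).right p q hpq h2 h5 t ht h10 h11
          omega)
      rw [coverWeight_last (by omega : n ≤ n - 1 + 1), coverWeight_last (by omega : n ≤ n - 1 + 1),
        hw.cover_eq_min (by omega) (by omega), hw.cover_eq_min (by omega) (by omega)] at this
      rw [eK]
      refine le_trans (by linarith : _ ≤ intervalMin (height n w) (c p q i + 1) q) ?_
      exact intervalMin_anti (by omega) le_rfl (by omega)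

/-- The ends of a chord of positive weight are strictly lower than all points between them. A
forbidden pair of edges leaves a whole block strictly between the ends, hence strictly higher than a
block containing an end, against the equations of `IsGoodCell`. -/
lemma isAccordionChord_of_isGoodCell (hS : IsCellSystem n E K c) {h : ℕ → ℝ}
    (hg : ∀ p q, E p q → p + 2 ≤ q → IsGoodCell h (K p q) (c p q)) {a b : ℕ}
    (hab : heightWeight n h a b ≠ 0) : IsAccordionChord E K c a b := by
  have hE := hS.toIsLaminar
  obtain ⟨hab2, hbn, hpos⟩ := heightWeight_pos hab
  have ha := (le_max_left (h a) (h b)).trans_lt hpos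
  have hb := (le_max_right (h a) (h b)).trans_lt hpos
  refine ⟨fun p q hpq h2 i j hi hj h3 h4 h5 h6 => ?_, fun p q hpq h2 h3 j hj h5 h6 => ?_,
    fun p q hpq h2 h3 i hi h5 h6 => ?_⟩
  · by_contra hij
    have hc := hS.chain hpq h2
    have o1 := hE.lt (hc.edge (i + 1) (by omega))
    have o2 := hc.le_of_le hE (show i + 1 + 1 ≤ j by omega) hj.le
    have m1 : intervalMin h (a + 1) (b - 1) ≤
        intervalMin h (c p q (i + 1) + 1) (c p q (i + 1 + 1)) :=
      intervalMin_anti (by omega) (by omega) (by omega)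
    have m2 : intervalMin h (c p q i + 1) (c p q (i + 1)) ≤ h a := intervalMin_le h3 h4
    have m3 : intervalMin h (c p q j + 1) (c p q (j + 1)) ≤ h b := intervalMin_le h5 h6
    have g := hg p q hpq h2
    have gr := g (i + 1) (by omega) (by omega)
    rcases Nat.eq_zero_or_pos i with rfl | hi0
    · rcases eq_or_ne (j + 1) (K p q) with hj1 | hj1
      · obtain rfl : j = K p q - 1 := by omega
        rw [hj1] at m3
        have := max_lt (m2.trans_lt (ha.trans_le m1)) (m3.trans_lt (hb.trans_le m1))
        rw [gr] at this
        exact lt_irrefl _ this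
      · have := g j (by omega) (by omega)
        linarith
    · have := g i hi0 (by omega)
      linarith
  · by_contra hj'
    push Not at hj'
    have hc := hS.chain hpq h2
    have e0 := hc.first
    have o1 := hE.lt (hc.edge 0 (by omega))
    have o2 := hc.le_of_le hE (show 0 + 1 ≤ j by omega) hj.le
    have m1 : intervalMin h (a + 1) (b - 1) ≤ intervalMin h (c p q 0 + 1) (c p q (0 + 1)) :=
      intervalMin_anti (by omega) (by omega) (by omega)
    have m3 : intervalMin h (c p q j + 1) (c p q (j + 1)) ≤ h b := intervalMin_le h5 h6
    have g := hg p q hpq h2 j (by omega) (by omega)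
    have := le_max_left (intervalMin h (c p q 0 + 1) (c p q 1))
      (intervalMin h (c p q (K p q - 1) + 1) (c p q (K p q)))
    rw [← g] at this
    linarith
  · by_contra hi'
    push Not at hi'
    have hc := hS.chain hpq h2
    have eK := hc.last
    have o1 := hE.lt (hc.edge (K p q - 1) (by omega))
    have o2 := hc.le_of_le hE (show i + 1 ≤ K p q - 1 by omega) (by omega)
    rw [Nat.sub_add_cancel (by omega)] at o1
    have m1 : intervalMin h (a + 1) (b - 1) ≤
        intervalMin h (c p q (K p q - 1) + 1) (c p q (K p q)) :=
      intervalMin_anti (by omega) (by omega) (by omega)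
    have m2 : intervalMin h (c p q i + 1) (c p q (i + 1)) ≤ h a := intervalMin_le h5 h6
    have g := hg p q hpq h2 i (by omega) (by omega)
    have := le_max_right (intervalMin h (c p q 0 + 1) (c p q 1))
      (intervalMin h (c p q (K p q - 1) + 1) (c p q (K p q)))
    rw [← g] at this
    linarith

end AccordionHeights

/-! ### Accordion chords and connectivity -/

/-- The chord `(a, b)`, `a < b`, crosses the edge `(p, q)` of the laminar family. -/
def CrossesEdge (E : ℕ → ℕ → Prop) (a b : ℕ) (e : ℕ × ℕ) : Prop :=
  E e.1 e.2 ∧ ((e.1 < a ∧ a ≤ e.2 ∧ e.2 < b) ∨ (a ≤ e.1 ∧ e.1 < b ∧ b ≤ e.2))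

/-- Two chords share an end. -/
def ShareEnd (e f : ℕ × ℕ) : Prop :=
  e.1 = f.1 ∨ e.1 = f.2 ∨ e.2 = f.1 ∨ e.2 = f.2

/-- The edges crossed by `(a, b)` form a connected set. -/
def CrossesConnected (E : ℕ → ℕ → Prop) (a b : ℕ) : Prop :=
  ∀ e f, CrossesEdge E a b e → CrossesEdge E a b f →
    Relation.ReflTransGen (fun e f => CrossesEdge E a b f ∧ ShareEnd e f) e f

section Connectivity

variable {n : ℕ} {E : ℕ → ℕ → Prop} {K : ℕ → ℕ → ℕ} {c : ℕ → ℕ → ℕ → ℕ} {a b : ℕ}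

lemma exists_step_out {α : Type*} {R : α → α → Prop} {P : α → Prop} {x y : α}
    (h : Relation.ReflTransGen R x y) (hx : P x) (hy : ¬ P y) : ∃ z z', P z ∧ ¬ P z' ∧ R z z' := by
  induction h with
  | refl => exact absurd hx hy
  | @tail z z' _ hz ih =>
    by_cases h : P z
    · exact ⟨z, z', h, hy, hz⟩
    · exact ih h

/-- A connected set of crossed edges that contains `(v, w)` and an edge not below it has an edge
not below `(v, w)` that ends at `v` or `w`. -/
lemma CrossesConnected.exists_exit (hE : IsLaminar n E) (hcon : CrossesConnected E a b) {v w : ℕ}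
    (hvw : CrossesEdge E a b (v, w)) {f : ℕ × ℕ} (hf : CrossesEdge E a b f)
    (hf' : ¬ (v ≤ f.1 ∧ f.2 ≤ w)) : ∃ r s, CrossesEdge E a b (r, s) ∧ ¬ (v ≤ r ∧ s ≤ w) ∧
      (r = v ∨ r = w ∨ s = v ∨ s = w) := by
  obtain ⟨⟨p, q⟩, ⟨r, s⟩, ⟨h1, h2, h3⟩, h4, h5, h6⟩ := exists_step_out (P := fun e =>
    E e.1 e.2 ∧ v ≤ e.1 ∧ e.2 ≤ w) (hcon _ _ hvw hf) ⟨hvw.1, le_rfl, le_rfl⟩ (fun h => hf' h.2)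
  simp only [ShareEnd] at h1 h2 h3 h4 h6
  have h7 : ¬ (v ≤ r ∧ s ≤ w) := fun h => h4 ⟨h5.1, h⟩
  refine ⟨r, s, h5, h7, ?_⟩
  have h8 := hE.lt h1
  have h9 := hE.lt h5.1
  have n1 := fun h h' h'' => hE.noncross h5.1 hvw.1 h h' h''
  have n2 := fun h h' h'' => hE.noncross hvw.1 h5.1 h h' h''
  simp only at n1 n2 h9
  by_contra h10
  have n1' : ¬ (r < v ∧ v < s ∧ s < w) := fun h => n1 h.1 h.2.1 h.2.2
  have n2' : ¬ (v < r ∧ r < w ∧ w < s) := fun h => n2 h.1 h.2.1 h.2.2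
  omega

/-- If the chord used two non-adjacent edges of a cell, a path of crossed edges leaving the part
below one of them would pass through an edge ending at one of its two vertices (`exists_exit`). Such
an edge lies below another edge of the cell, and is not crossed since neither end of the chord lies
in that block. -/
lemma CrossesConnected.isAccordionChord (hS : IsCellSystem n E K c)
    (hcon : CrossesConnected E a b) : IsAccordionChord E K c a b := by
  have hE := hS.toIsLaminar
  refine ⟨fun p q hpq h2 i j hi hj h3 h4 h5 h6 => ?_, fun p q hpq h2 h3 j hj h5 h6 => ?_,
    fun p q hpq h2 h3 i hi h5 h6 => ?_⟩
  · by_contra hij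
    have hc := hS.chain hpq h2
    have o1 := hc.lt_of_lt hE (show i + 1 < j by omega) hj.le
    obtain ⟨r, s, ⟨h7, h8⟩, h9, h10⟩ := hcon.exists_exit hE
      (v := c p q i) (w := c p q (i + 1)) ⟨hc.edge i hi, Or.inl ⟨h3, h4, by simp only; omega⟩⟩
      (f := (c p q j, c p q (j + 1)))
      ⟨hc.edge j hj, Or.inr ⟨by simp only; omega, by simp only; omega, h6⟩⟩
      (by have := hE.lt (hc.edge j hj); simp only; omega)
    simp only at h7 h8
    have hb1 := hc.ge_first hE (i := i) (by omega)
    have hb2 := hc.le_last hE (i := j + 1) (by omega)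
    have hb3 := hc.ge_first hE (i := i + 1) (by omega)
    have hb4 := hc.le_last hE (i := i) (by omega)
    have hrs := hE.lt h7
    have n1 : ¬ (r < p ∧ p < s ∧ s < q) := fun h => hE.noncross h7 hpq h.1 h.2.1 h.2.2
    have n2 : ¬ (p < r ∧ r < q ∧ q < s) := fun h => hE.noncross hpq h7 h.1 h.2.1 h.2.2
    obtain ⟨k, hk, h11, h12⟩ := hc.maximal r s h7 (by omega) (by omega) (by omega)
    have hki : k ≠ i := by rintro rfl; exact h9 ⟨h11, h12⟩
    have hk1 : k < i + 1 + 1 := by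
      by_contra h
      have := hc.lt_of_lt hE (show i + 1 < k by omega) hk.le
      have := hE.lt (hc.edge i hi)
      omega
    rcases h8 with h8 | h8
    · have h13 : k < i + 1 := (hc.lt_iff hE (by omega) (by omega)).1 (by omega)
      have h14 : i < k + 1 := (hc.lt_iff hE (by omega) (by omega)).1 (by omega)
      omega
    · have h13 : j < k + 1 := (hc.lt_iff hE (by omega) (by omega)).1 (by omega)
      omega
  · by_contra hj'
    push Not at hj'
    have hc := hS.chain hpq h2
    have e0 := hc.first
    have eK := hc.last
    have o1 := hc.lt_of_lt hE (show 0 < j by omega) hj.le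
    have o2 := hc.lt_of_lt hE (show j + 1 < K p q by omega) le_rfl
    have o3 := hE.lt (hc.edge j hj)
    obtain ⟨r, s, ⟨h7, h8⟩, h9, h10⟩ := hcon.exists_exit hE
      (v := c p q j) (w := c p q (j + 1))
      ⟨hc.edge j hj, Or.inr ⟨by simp only; omega, h5, h6⟩⟩
      (f := (p, q)) ⟨hpq, Or.inr ⟨h3, by simp only; omega, by simp only; omega⟩⟩
      (by simp only; omega)
    simp only at h7 h8
    have hrs := hE.lt h7
    have n1 : ¬ (r < p ∧ p < s ∧ s < q) := fun h => hE.noncross h7 hpq h.1 h.2.1 h.2.2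
    have n2 : ¬ (p < r ∧ r < q ∧ q < s) := fun h => hE.noncross hpq h7 h.1 h.2.1 h.2.2
    obtain ⟨k, hk, h11, h12⟩ := hc.maximal r s h7 (by omega) (by omega) (by omega)
    have hkj : k ≠ j := by rintro rfl; exact h9 ⟨h11, h12⟩
    have h13 : k < j + 1 := (hc.lt_iff hE (by omega) (by omega)).1 (by omega)
    have h14 : j < k + 1 := (hc.lt_iff hE (by omega) (by omega)).1 (by omega)
    omega
  · by_contra hi'
    push Not at hi'
    have hc := hS.chain hpq h2
    have e0 := hc.first
    have eK := hc.last
    have o1 := hc.lt_of_lt hE (show 0 < i by omega) hi.le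
    have o2 := hc.lt_of_lt hE (show i + 1 < K p q by omega) le_rfl
    have o3 := hE.lt (hc.edge i hi)
    obtain ⟨r, s, ⟨h7, h8⟩, h9, h10⟩ := hcon.exists_exit hE
      (v := c p q i) (w := c p q (i + 1))
      ⟨hc.edge i hi, Or.inl ⟨h5, h6, by simp only; omega⟩⟩
      (f := (p, q)) ⟨hpq, Or.inl ⟨by simp only; omega, by simp only; omega, h3⟩⟩
      (by simp only; omega)
    simp only at h7 h8
    have hrs := hE.lt h7
    have n1 : ¬ (r < p ∧ p < s ∧ s < q) := fun h => hE.noncross h7 hpq h.1 h.2.1 h.2.2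
    have n2 : ¬ (p < r ∧ r < q ∧ q < s) := fun h => hE.noncross hpq h7 h.1 h.2.1 h.2.2
    obtain ⟨k, hk, h11, h12⟩ := hc.maximal r s h7 (by omega) (by omega) (by omega)
    have hki : k ≠ i := by rintro rfl; exact h9 ⟨h11, h12⟩
    have h13 : k < i + 1 := (hc.lt_iff hE (by omega) (by omega)).1 (by omega)
    have h14 : i < k + 1 := (hc.lt_iff hE (by omega) (by omega)).1 (by omega)
    omega

/-- Crossed edges with the same end of the chord below them are nested, and `left` and `right` make
consecutive ones, descending cell by cell, share an endpoint. The two nests are joined in the cell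
where the ends of the chord first fall below different edges; by `adj` these are adjacent. -/
lemma IsAccordionChord.crossesConnected (hS : IsCellSystem n E K c)
    (hacc : IsAccordionChord E K c a b) (hab : a < b) (hb : b < n) : CrossesConnected E a b := by
  have hE := hS.toIsLaminar
  set R : ℕ × ℕ → ℕ × ℕ → Prop := fun e f =>
    CrossesEdge E a b e ∧ CrossesEdge E a b f ∧ ShareEnd e f with hR
  have hsymm : ∀ e f, R e f → R f e := by
    rintro e f ⟨h1, h2, h3⟩
    refine ⟨h2, h1, ?_⟩
    unfold ShareEnd at h3 ⊢
    omega
  have hsymm' : ∀ {e f}, Relation.ReflTransGen R e f → Relation.ReflTransGen R f e := by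
    intro e f h
    induction h with
    | refl => exact Relation.ReflTransGen.refl
    | tail _ h ih => exact Relation.ReflTransGen.head (hsymm _ _ h) ih
  -- nested edges separating the same end
  have down1 : ∀ d p q r s, s - r ≤ d → E p q → E r s → p < a → a ≤ q → r ≤ p → q ≤ s → s < b →
      Relation.ReflTransGen R (r, s) (p, q) := by
    intro d
    induction d with
    | zero => intro p q r s hd _ hrs; have := hE.lt hrs; omega
    | succ d ih =>
      intro p q r s hd hpq hrs h1 h2 h3 h4 h5
      by_cases heq : p = r ∧ q = s
      · rw [heq.1, heq.2]
      have hlt := hE.lt hpq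
      have hrs2 : r + 2 ≤ s := by omega
      have hc := hS.chain hrs hrs2
      obtain ⟨i, hi, h6, h7⟩ := hc.maximal p q hpq h3 h4 heq
      have hch := hc.child_ne hE hi
      have hgl := hc.le_last hE (i := i + 1) hi
      have hend := hacc.right r s hrs hrs2 h5 i hi (by omega) (by omega)
      refine Relation.ReflTransGen.head (b := (c r s i, c r s (i + 1))) ⟨⟨hrs, Or.inl
        ⟨by simp only; omega, by simp only; omega, h5⟩⟩, ⟨hc.edge i hi, Or.inl
        ⟨by simp only; omega, by simp only; omega, by simp only; omega⟩⟩, ?_⟩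
        (ih p q _ _ (by omega) hpq (hc.edge i hi) h1 h2 h6 h7 (by omega))
      rcases hend with rfl | hend
      · exact Or.inl hc.first.symm
      · exact Or.inr (Or.inr (Or.inr (by simp only; rw [hend, hc.last])))
  have down2 : ∀ d p q r s, s - r ≤ d → E p q → E r s → p < b → b ≤ q → r ≤ p → q ≤ s → a ≤ r →
      Relation.ReflTransGen R (r, s) (p, q) := by
    intro d
    induction d with
    | zero => intro p q r s hd _ hrs; have := hE.lt hrs; omega
    | succ d ih =>
      intro p q r s hd hpq hrs h1 h2 h3 h4 h5
      by_cases heq : p = r ∧ q = s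
      · rw [heq.1, heq.2]
      have hlt := hE.lt hpq
      have hrs2 : r + 2 ≤ s := by omega
      have hc := hS.chain hrs hrs2
      obtain ⟨i, hi, h6, h7⟩ := hc.maximal p q hpq h3 h4 heq
      have hch := hc.child_ne hE hi
      have hgl := hc.ge_first hE hi.le
      have hend := hacc.left r s hrs hrs2 h5 i hi (by omega) (by omega)
      refine Relation.ReflTransGen.head (b := (c r s i, c r s (i + 1))) ⟨⟨hrs, Or.inr
        ⟨h5, by simp only; omega, by simp only; omega⟩⟩, ⟨hc.edge i hi, Or.inr
        ⟨by simp only; omega, by simp only; omega, by simp only; omega⟩⟩, ?_⟩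
        (ih p q _ _ (by omega) hpq (hc.edge i hi) h1 h2 h6 h7 (by omega))
      rcases hend with rfl | hend
      · exact Or.inl hc.first.symm
      · exact Or.inr (Or.inr (Or.inr (by simp only; rw [hend, hc.last])))
  have nested : ∀ {p q r s x}, E p q → E r s → p < x → x ≤ q → r < x → x ≤ s →
      (r ≤ p ∧ q ≤ s) ∨ (p ≤ r ∧ s ≤ q) := by
    intro p q r s x h1 h2 h3 h4 h5 h6
    have n1 : ¬ (r < p ∧ p < s ∧ s < q) := fun h => hE.noncross h2 h1 h.1 h.2.1 h.2.2
    have n2 : ¬ (p < r ∧ r < q ∧ q < s) := fun h => hE.noncross h1 h2 h.1 h.2.1 h.2.2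
    omega
  have same1 : ∀ p q r s, E p q → E r s → p < a → a ≤ q → q < b → r < a → a ≤ s → s < b →
      Relation.ReflTransGen R (p, q) (r, s) := by
    intro p q r s h1 h2 h3 h4 h5 h6 h7 h8
    rcases nested h1 h2 h3 h4 h6 h7 with h | h
    · exact hsymm' (down1 _ p q r s le_rfl h1 h2 h3 h4 h.1 h.2 h8)
    · exact down1 _ r s p q le_rfl h2 h1 h6 h7 h.1 h.2 h5
  have same2 : ∀ p q r s, E p q → E r s → p < b → b ≤ q → a ≤ p → r < b → b ≤ s → a ≤ r →
      Relation.ReflTransGen R (p, q) (r, s) := by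
    intro p q r s h1 h2 h3 h4 h5 h6 h7 h8
    rcases nested h1 h2 h3 h4 h6 h7 with h | h
    · exact hsymm' (down2 _ p q r s le_rfl h1 h2 h3 h4 h.1 h.2 h8)
    · exact down2 _ r s p q le_rfl h2 h1 h6 h7 h.1 h.2 h5
  -- two adjacent edges separating different ends
  have split : ∀ d p q, q - p ≤ d → E p q → p < a → b ≤ q →
      ∃ v w z, E v w ∧ E w z ∧ v < a ∧ a ≤ w ∧ w < b ∧ b ≤ z := by
    intro d
    induction d with
    | zero => intro p q hd hpq; have := hE.lt hpq; omega
    | succ d ih =>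
      intro p q hd hpq h1 h2
      have hc := hS.chain hpq (by omega)
      obtain ⟨i, hi, h3, h4⟩ := hc.exists_block h1 (by omega)
      obtain ⟨j, hj, h5, h6⟩ := hc.exists_block (a := b) (by omega) h2
      have hij := hacc.adj p q hpq (by omega) i j hi hj h3 h4 h5 h6
      have hij' : i < j + 1 := (hc.lt_iff hE (by omega) (by omega)).1 (by omega)
      rcases (show j = i ∨ j = i + 1 by omega) with rfl | rfl
      · have := hc.child_ne hE hi
        exact ih _ _ (by omega) (hc.edge j hj) h3 h6
      · exact ⟨_, _, _, hc.edge i hi, hc.edge (i + 1) hj, h3, h4, h5, h6⟩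
  have diff : ∀ p q r s, E p q → E r s → p < a → a ≤ q → q < b → r < b → b ≤ s → a ≤ r →
      Relation.ReflTransGen R (p, q) (r, s) := by
    intro p q r s h1 h2 h3 h4 h5 h6 h7 h8
    obtain ⟨v, w, z, k1, k2, k3, k4, k5, k6⟩ := split _ 0 (n - 1) le_rfl hE.root (by omega)
      (by omega)
    refine (same1 p q v w h1 k1 h3 h4 h5 k3 k4 k5).trans
      (Relation.ReflTransGen.head (b := (w, z)) ⟨⟨k1, Or.inl ⟨k3, k4, k5⟩⟩,
        ⟨k2, Or.inr ⟨k4, k5, k6⟩⟩, Or.inr (Or.inr (Or.inl rfl))⟩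
        (same2 w z r s k2 h2 k5 k6 k4 h6 h7 h8))
  rintro ⟨p, q⟩ ⟨r, s⟩ ⟨h1, h2⟩ ⟨h3, h4⟩
  refine Relation.ReflTransGen.mono (r := R) (fun e f h => h.2) _ _ ?_
  simp only at h1 h2 h3 h4
  rcases h2 with h2 | h2 <;> rcases h4 with h4 | h4
  · exact same1 p q r s h1 h3 h2.1 h2.2.1 h2.2.2 h4.1 h4.2.1 h4.2.2
  · exact diff p q r s h1 h3 h2.1 h2.2.1 h2.2.2 h4.2.1 h4.2.2 h4.1
  · exact hsymm' (diff r s p q h3 h1 h4.1 h4.2.1 h4.2.2 h2.2.1 h2.2.2 h2.1)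
  · exact same2 p q r s h1 h3 h2.2.1 h2.2.2 h2.1 h4.2.1 h4.2.2 h4.1

end Connectivity

/-! ### Families with prescribed coordinates -/

/-- A weighted non-crossing family of accordion chords. -/
structure IsAccordionFamily (n : ℕ) (E : ℕ → ℕ → Prop) (w : ℕ → ℕ → ℝ) : Prop
    extends IsFamily n w where
  accordion : ∀ a b, w a b ≠ 0 → CrossesConnected E a b

/-- The chord `(p, q)` is neither a side nor the root. -/
def IsInner (n : ℕ) (E : ℕ → ℕ → Prop) (p q : ℕ) : Prop :=
  E p q ∧ p + 2 ≤ q ∧ ¬ (p = 0 ∧ q = n - 1)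

/-- Every cell has an odd number of edges or an edge that is not inner. -/
def NoEvenCell (n : ℕ) (E : ℕ → ℕ → Prop) (K : ℕ → ℕ → ℕ) (c : ℕ → ℕ → ℕ → ℕ) : Prop :=
  ∀ p q, E p q → p + 2 ≤ q → Even (K p q) ∨ (p = 0 ∧ q = n - 1) ∨
    ∃ i < K p q, c p q (i + 1) = c p q i + 1

section Families

variable {n : ℕ} {E : ℕ → ℕ → Prop} {K : ℕ → ℕ → ℕ} {c : ℕ → ℕ → ℕ → ℕ}

lemma edgeCoord_zero : edgeCoord 0 0 0 = 0 := by simp [edgeCoord]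

lemma IsFamily.isHeight (hn : 3 ≤ n) {w : ℕ → ℕ → ℝ} (hw : IsFamily n w) :
    IsHeight n (height n w) :=
  ⟨height_zero, height_last (by omega), hw.intervalMin_eq_zero hn⟩

/-- The function equal to `x` on inner chords and to zero on the others. -/
noncomputable def innerPart (n : ℕ) (x : ℕ → ℕ → ℝ) (p q : ℕ) : ℝ :=
  if q = p + 1 ∨ (p = 0 ∧ q = n - 1) then 0 else x p q

lemma innerPart_of_isInner {x : ℕ → ℕ → ℝ} {p q : ℕ} (h : IsInner n E p q) :
    innerPart n x p q = x p q := by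
  obtain ⟨-, h1, h2⟩ := h
  rw [innerPart, if_neg]
  omega

/-- Extends prescribed coordinates by zero to sides and the root, so that every edge of every cell
has one. -/
lemma IsHeight.edgeCoord_eq (hn : 3 ≤ n) {h : ℕ → ℝ} (hh : IsHeight n h) {x : ℕ → ℕ → ℝ}
    (hE : IsLaminar n E)
    (hx : ∀ p q, IsInner n E p q → edgeCoord (h p) (h q) (overMin h p q) = x p q) {p q : ℕ}
    (hpq : E p q) : edgeCoord (h p) (h q) (overMin h p q) = innerPart n x p q := by
  have hlt := hE.lt hpq
  unfold innerPart
  split_ifs with h1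
  · by_cases h2 : q = p + 1
    · rw [overMin, if_pos h2, edgeCoord_max]
    · obtain ⟨rfl, rfl⟩ : p = 0 ∧ q = n - 1 := by tauto
      rw [hh.left, hh.right, overMin_of_le (by omega), zero_add,
        show n - 1 - 1 = n - 2 by omega, hh.inner, edgeCoord_zero]
  · exact hx p q ⟨hpq, by omega, by omega⟩

lemma NoEvenCell.hasUniqueCells (h : NoEvenCell n E K c) (x : ℕ → ℕ → ℝ) :
    HasUniqueCells E K c (innerPart n x) := by
  intro p q hpq h2
  rcases h p q hpq h2 with h3 | h3 | ⟨i, hi, h3⟩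
  · exact Or.inl h3
  · exact Or.inr (Or.inl (by rw [innerPart, if_pos (Or.inr h3)]))
  · exact Or.inr (Or.inr ⟨i, hi, by rw [innerPart, if_pos (Or.inl h3)]⟩)

/-- Both height functions solve the same reconstruction problem with value zero at the root, so they
coincide, and the weights are read off from the heights. -/
lemma IsAccordionFamily.unique (hn : 3 ≤ n) (hS : IsCellSystem n E K c)
    (hne : NoEvenCell n E K c) {w w' : ℕ → ℕ → ℝ} (hw : IsAccordionFamily n E w)
    (hw' : IsAccordionFamily n E w')
    (hx : ∀ p q, IsInner n E p q → coord n w p q = coord n w' p q) : w = w' := by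
  have hE := hS.toIsLaminar
  have sol : ∀ {v : ℕ → ℕ → ℝ}, IsAccordionFamily n E v →
      (∀ p q, IsInner n E p q → coord n v p q = coord n w p q) →
      (∀ p q, E p q → edgeCoord (height n v p) (height n v q) (overMin (height n v) p q) =
        innerPart n (coord n w) p q) ∧
      IsSolutionBelow E K c (innerPart n (coord n w)) 0 (n - 1) (height n v) := by
    intro v hv hvx
    have h1 : ∀ p q, E p q → edgeCoord (height n v p) (height n v q)
        (overMin (height n v) p q) = innerPart n (coord n w) p q := by
      intro p q hpq
      refine (hv.toIsFamily.isHeight hn).edgeCoord_eq hn hE (fun r s hrs => ?_) hpq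
      rw [← hvx r s hrs, hv.toIsFamily.coord_eq hrs.2.1 (hE.bound hrs.1), overMin_of_le hrs.2.1]
    exact ⟨h1, fun r s h2 _ _ _ => h1 r s h2, fun r s h2 _ _ h3 =>
      hv.toIsFamily.isGoodCell hS (fun a b hab => (hv.accordion a b hab).isAccordionChord hS)
        h2 h3⟩
  obtain ⟨h1, h2⟩ := sol hw fun _ _ _ => rfl
  obtain ⟨-, h3⟩ := sol hw' fun p q h => (hx p q h).symm
  have H := hw.toIsFamily.isHeight hn
  have H' := hw'.toIsFamily.isHeight hn
  have heq := IsSolutionBelow.unique hS (hne.hasUniqueCells (coord n w)) _ 0 (n - 1) le_rfl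
    hE.root h2 h3 (by rw [H.left, H'.left]) (by rw [H.right, H'.right]) (by
      rw [overMin_of_le (by omega), overMin_of_le (by omega), zero_add,
        show n - 1 - 1 = n - 2 by omega, H.inner, H'.inner]) (h1 _ _ hE.root)
  funext a b
  by_cases hab : a + 2 ≤ b ∧ b < n
  · rw [hw.toIsFamily.weight_eq hab.1 hab.2, hw'.toIsFamily.weight_eq hab.1 hab.2,
      heq a (by omega) (by omega), heq b (by omega) (by omega),
      intervalMin_congr (by omega) fun d h4 h5 => heq d (by omega) (by omega)]
  · have z : ∀ {v : ℕ → ℕ → ℝ}, IsAccordionFamily n E v → v a b = 0 := fun hv => by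
      by_contra h
      have := hv.supp a b h
      exact hab ⟨this.1, this.2.1⟩
    rw [z hw, z hw']

/-- Solutions of the cyclic systems of all cells. -/
structure IsCyclicSolution (E : ℕ → ℕ → Prop) (K : ℕ → ℕ → ℕ) (c : ℕ → ℕ → ℕ → ℕ)
    (x : ℕ → ℕ → ℝ) (p q : ℕ) (u : ℕ → ℝ) : Prop where
  step : ∀ i < K p q, u (i + 1) = max (max (x (c p q i) (c p q (i + 1))) 0 - u i) 0
  zero : u 0 = max (max (x p q) 0 - u (K p q)) 0

/-- The cyclic solutions `u` are an input and reappear in the conclusion, so that different choices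
can be compared in even cells. -/
lemma exists_heights (hn : 3 ≤ n) (hS : IsCellSystem n E K c) (x : ℕ → ℕ → ℝ)
    {u : ℕ → ℕ → ℕ → ℝ} (hu : ∀ p q, IsCyclicSolution E K c (innerPart n x) p q (u p q)) :
    ∃ h, IsHeight n h ∧ IsAccordionFamily n E (heightWeight n h) ∧
      (∀ p q, E p q → edgeCoord (h p) (h q) (overMin h p q) = innerPart n x p q) ∧
      ∀ p q, E p q → p + 2 ≤ q → ∃ t, IsCellSolution (K p q) (fun i => h (c p q i))
          (fun i => innerPart n x (c p q i) (c p q (i + 1)))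
          (fun i => overMin h (c p q i) (c p q (i + 1))) (overMin h p q) t (u p q) := by
  have hE := hS.toIsLaminar
  obtain ⟨h, h0, h1, hm, hsol, hcell⟩ := exists_solutionBelow hS (x := innerPart n x)
    (fun p => by rw [innerPart, if_pos (Or.inl rfl)]) (fun p q _ _ => (hu p q).step)
    (fun p q _ _ => (hu p q).zero) _ 0 (n - 1) le_rfl hE.root 0 0 0
    (by rw [edgeCoord_zero, innerPart, if_pos (Or.inr ⟨rfl, rfl⟩)])
  have hh : IsHeight n h := ⟨h0, h1, by
    rwa [overMin_of_le (by omega), zero_add, show n - 1 - 1 = n - 2 by omega] at hm⟩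
  have ble : ∀ {p q}, E p q → q ≤ n - 1 := fun hpq => by have := hE.bound hpq; omega
  refine ⟨h, hh, ⟨hh.isFamily, fun a b hab => ?_⟩, ?_, ?_⟩
  · obtain ⟨h2, h3, -⟩ := heightWeight_pos hab
    exact (isAccordionChord_of_isGoodCell hS (fun p q hpq h4 =>
      hsol.good p q hpq (Nat.zero_le _) (ble hpq) h4) hab).crossesConnected hS (by omega) h3
  · intro p q hpq
    by_cases h2 : p = 0 ∧ q = n - 1
    · rw [h2.1, h2.2, h0, h1, hm, edgeCoord_zero, innerPart, if_pos (Or.inr ⟨rfl, rfl⟩)]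
    · exact hsol.coord p q hpq (Nat.zero_le _) (ble hpq) h2
  · exact fun p q hpq h2 => hcell p q hpq (Nat.zero_le _) (ble hpq) h2

lemma IsHeight.coord_heightWeight {h : ℕ → ℝ} (hh : IsHeight n h) {p q : ℕ} (hpq : p + 2 ≤ q)
    (hq : q < n) : coord n (heightWeight n h) p q = edgeCoord (h p) (h q) (overMin h p q) := by
  rw [hh.isFamily.coord_eq hpq hq, hh.height_heightWeight hq, hh.height_heightWeight (by omega),
    overMin_of_le hpq, intervalMin_congr (by omega) fun d _ h2 =>
      hh.height_heightWeight (show d < n by omega)]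

/-- No parity condition is needed here: the cones cover the space for every dissection. -/
lemma exists_accordionFamily (hn : 3 ≤ n) (hS : IsCellSystem n E K c) (x : ℕ → ℕ → ℝ) :
    ∃ w, IsAccordionFamily n E w ∧ ∀ p q, IsInner n E p q → coord n w p q = x p q := by
  choose u hu hu0 using fun p q => exists_cyclic_solution (K p q)
    (fun i => max (innerPart n x (c p q i) (c p q (i + 1))) 0) (max (innerPart n x p q) 0)
  obtain ⟨h, hh, hf, hc, -⟩ := exists_heights hn hS x (u := u) fun p q => ⟨hu p q, hu0 p q⟩
  exact ⟨_, hf, fun p q hpq => by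
    rw [hh.coord_heightWeight hpq.2.1 (hS.bound hpq.1), hc p q hpq.1, innerPart_of_isInner hpq]⟩

/-! ### Even cells -/

/-- If the chords crossing both `(p, q)` and `(q, r)` account for the whole coordinate at either
one, then all chords cross both or none. -/
lemma IsFamily.chordCompat_eq {w : ℕ → ℕ → ℝ} (hw : IsFamily n w) {p q r : ℕ} (hpq : p + 2 ≤ q)
    (hqr : q + 2 ≤ r) (hr : r < n) (h1 : w p q = 0) (h2 : w q r = 0)
    (h3 : coord n w p q =
      ∑ a ∈ Finset.Ico (p + 1) q, ∑ b ∈ Finset.Ico (q + 1) (r - 1 + 1), w a b)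
    (h4 : coord n w q r =
      ∑ a ∈ Finset.Ico (p + 1) q, ∑ b ∈ Finset.Ico (q + 1) (r - 1 + 1), w a b)
    {a b : ℕ} (hab : w a b ≠ 0) : chordCompat p q a b = chordCompat q r a b := by
  have nn : ∀ I J : Finset ℕ, 0 ≤ ∑ a ∈ I, ∑ b ∈ J, w a b := fun I J =>
    Finset.sum_nonneg fun a _ => Finset.sum_nonneg fun b _ => hw.nonneg a b
  have zero : ∀ I J : Finset ℕ, ∑ a ∈ I, ∑ b ∈ J, w a b = 0 → ¬ (a ∈ I ∧ b ∈ J) := by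
    rintro I J h ⟨ha, hb⟩
    have h5 := (Finset.sum_eq_zero_iff_of_nonneg fun a _ => Finset.sum_nonneg fun b _ =>
      hw.nonneg a b).1 h a ha
    exact hab ((Finset.sum_eq_zero_iff_of_nonneg fun b _ => hw.nonneg a b).1 h5 b hb)
  rw [coord_eq_sums hpq (by omega), h1] at h3
  rw [coord_eq_sums hqr hr, h2,
    ← Finset.sum_Ico_consecutive _ (Nat.zero_le (p + 1)) (show p + 1 ≤ q by omega)] at h4
  have e : ∑ a ∈ Finset.Ico (p + 1) q, ∑ b ∈ Finset.Ico (q + 1) (n - 1 + 1), w a b =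
      ∑ a ∈ Finset.Ico (p + 1) q, ∑ b ∈ Finset.Ico (q + 1) (r - 1 + 1), w a b +
      ∑ a ∈ Finset.Ico (p + 1) q, ∑ b ∈ Finset.Ico (r - 1 + 1) (n - 1 + 1), w a b := by
    rw [← Finset.sum_add_distrib]
    exact Finset.sum_congr rfl fun a _ =>
      (Finset.sum_Ico_consecutive _ (by omega) (by omega)).symm
  -- Each coordinate is the corner sum plus nonnegative remainders, so by `h3` and `h4` the
  -- remainders vanish and no chord of the family lies in them.
  have a1 := nn (Finset.Ico 0 p) (Finset.Ico (p + 1) (q - 1 + 1))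
  have a2 := nn (Finset.Ico (p + 1) q) (Finset.Ico (r - 1 + 1) (n - 1 + 1))
  have a3 := nn (Finset.Ico 0 (p + 1)) (Finset.Ico (q + 1) (r - 1 + 1))
  have a4 := nn (Finset.Ico (q + 1) r) (Finset.Ico (r + 1) (n - 1 + 1))
  have z1 := zero _ _ (by linarith : ∑ a ∈ Finset.Ico 0 p,
    ∑ b ∈ Finset.Ico (p + 1) (q - 1 + 1), w a b = 0)
  have z2 := zero _ _ (by linarith : ∑ a ∈ Finset.Ico (p + 1) q,
    ∑ b ∈ Finset.Ico (r - 1 + 1) (n - 1 + 1), w a b = 0)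
  have z3 := zero _ _ (by linarith : ∑ a ∈ Finset.Ico 0 (p + 1),
    ∑ b ∈ Finset.Ico (q + 1) (r - 1 + 1), w a b = 0)
  have z4 := zero _ _ (by linarith : ∑ a ∈ Finset.Ico (q + 1) r,
    ∑ b ∈ Finset.Ico (r + 1) (n - 1 + 1), w a b = 0)
  have n1 : ¬ (a = p ∧ b = q) := by rintro ⟨rfl, rfl⟩; exact hab h1
  have n2 : ¬ (a = q ∧ b = r) := by rintro ⟨rfl, rfl⟩; exact hab h2
  have hs := hw.supp a b hab
  simp only [Finset.mem_Ico] at z1 z2 z3 z4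
  unfold chordCompat
  rw [if_neg n1, if_neg n2]
  refine if_congr ?_ rfl rfl
  omega

/-- An even cell with inner edges: for the vector `x` equal to one on its edges, each of the
corners `j = 1, 2` can be made to carry all the chords crossing the two edges at `j`. -/
lemma exists_family_even_cell (hn : 3 ≤ n) (hS : IsCellSystem n E K c) {p q : ℕ} (hpq : E p q)
    (h2 : p + 2 ≤ q) (hodd : ¬ Even (K p q)) {x : ℕ → ℕ → ℝ} (hx : innerPart n x p q = 1)
    (hxc : ∀ i < K p q, innerPart n x (c p q i) (c p q (i + 1)) = 1)
    (hin : ∀ i < K p q, c p q i + 2 ≤ c p q (i + 1)) {j : ℕ} (hj : j = 0 ∨ j = 1) :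
    ∃ w, IsAccordionFamily n E w ∧ (∀ p q, IsInner n E p q → coord n w p q = x p q) ∧
      ∀ a b, w a b ≠ 0 → chordCompat (c p q j) (c p q (j + 1)) a b =
        chordCompat (c p q (j + 1)) (c p q (j + 2)) a b := by
  classical
  have hE := hS.toIsLaminar
  have hc := hS.chain hpq h2
  have hK := hc.two_le
  have hK3 : 3 ≤ K p q := by
    by_contra h
    obtain h : K p q = 2 := by omega
    rw [h] at hodd
    exact hodd even_two
  choose u hu hu0 using fun p q => exists_cyclic_solution (K p q)
    (fun i => max (innerPart n x (c p q i) (c p q (i + 1))) 0) (max (innerPart n x p q) 0)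
  -- With all right-hand sides equal to one and an even number `K + 1` of steps, alternation solves
  -- the system; the phase gives one at vertex `j + 1` and zero at both neighbours.
  set v : ℕ → ℝ := fun i => if Even (i + j) then 0 else 1 with hv
  have hvsol : IsCyclicSolution E K c (innerPart n x) p q v := by
    constructor
    · intro i hi
      rw [hxc i hi]
      simp only [hv]
      simp only [show i + 1 + j = i + j + 1 by ring, Nat.even_add_one]
      by_cases h : Even (i + j) <;> simp [h]
    · rw [hx]
      simp only [hv]
      simp only [Nat.even_add, zero_add]
      by_cases h : Even j <;> simp [h, hodd]
  obtain ⟨h, hh, hf, hcd, hcs⟩ := exists_heights hn hS x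
    (u := fun r s => if r = p ∧ s = q then v else u r s) (by
      intro r s
      by_cases hrs : r = p ∧ s = q
      · simp only [hrs, and_self, if_true]
        exact hvsol
      · simp only [hrs, if_false]
        exact ⟨hu r s, hu0 r s⟩)
  refine ⟨_, hf, fun r s hrs => by
    rw [hh.coord_heightWeight hrs.2.1 (hE.bound hrs.1), hcd r s hrs.1, innerPart_of_isInner hrs],
    ?_⟩
  obtain ⟨t, ht⟩ := hcs p q hpq h2
  simp only [and_self, if_true] at ht
  set m := overMin h p q
  have hlast := ht.u_last
  have hzero := ht.u_zero
  have hvj : v j = 0 := by simp [hv]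
  have hvj1 : v (j + 1) = 1 := by
    simp only [hv]
    rw [if_neg]
    rw [show j + 1 + j = 2 * j + 1 by ring]
    simp
  have hvj2 : v (j + 2) = 0 := by
    simp only [hv]
    rw [if_pos]
    rw [show j + 2 + j = 2 * (j + 1) by ring]
    simp
  have mid1 := ht.u_mid (j + 1) (by omega) (by omega)
  rw [hvj1] at mid1
  -- Vertex `j + 1` is one above the common level while its neighbours are not above it. Coordinate
  -- one then forces the minima over both adjacent edges to be exactly that level, and the corner
  -- has weight one.
  have y1 : h (c p q (j + 1)) = m + |t| + 1 := by
    rcases max_choice (h (c p q (j + 1)) - m - |t|) 0 with h3 | h3 <;> rw [h3] at mid1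
    · linarith
    · norm_num at mid1
  have y0 : h (c p q j) ≤ m + |t| := by
    rcases hj with rfl | rfl
    · rw [hvj] at hzero
      have h3 := le_max_left (max (h (c p q 0) - m) 0 - t) 0
      have h4 := le_max_left (h (c p q 0) - m) 0
      have h5 := le_abs_self t
      linarith
    · have h3 := ht.u_mid 1 (by omega) (by omega)
      rw [hvj] at h3
      have h4 := le_max_left (h (c p q 1) - m - |t|) 0
      linarith
  have y2 : h (c p q (j + 2)) ≤ m + |t| := by
    rcases (show j + 2 < K p q ∨ j + 2 = K p q by omega) with h3 | h3
    · have h4 := ht.u_mid (j + 2) (by omega) h3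
      rw [hvj2] at h4
      have h5 := le_max_left (h (c p q (j + 2)) - m - |t|) 0
      linarith
    · rw [← h3, hvj2] at hlast
      have h4 := le_max_left (h (c p q (j + 2)) - m) 0
      have h5 := neg_abs_le t
      linarith
  have o1 := hin j (by omega)
  have o2 := hin (j + 1) (by omega)
  have hb := hE.bound (hc.edge (j + 1) (by omega))
  have e1 : edgeCoord (h (c p q j)) (h (c p q (j + 1)))
      (overMin h (c p q j) (c p q (j + 1))) = 1 := by
    rw [hcd _ _ (hc.edge j (by omega)), hxc j (by omega)]
  have e2 : edgeCoord (h (c p q (j + 1))) (h (c p q (j + 2)))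
      (overMin h (c p q (j + 1)) (c p q (j + 2))) = 1 := by
    rw [hcd _ _ (hc.edge (j + 1) (by omega)), hxc (j + 1) (by omega)]
  have m1 : overMin h (c p q j) (c p q (j + 1)) = m + |t| := by
    refine edgeCoord_inj (e1.trans ?_)
    rw [y1, edgeCoord, max_eq_right (by linarith : h (c p q j) - (m + |t|) ≤ 0),
      max_eq_left (by linarith : 0 ≤ m + |t| + 1 - (m + |t|)),
      max_eq_right (by linarith : h (c p q j) ≤ m + |t| + 1),
      max_eq_right (by linarith : m + |t| - (m + |t| + 1) ≤ 0)]
    ring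
  have m2 : overMin h (c p q (j + 1)) (c p q (j + 2)) = m + |t| := by
    refine edgeCoord_inj (e2.trans ?_)
    rw [y1, edgeCoord, max_eq_right (by linarith : h (c p q (j + 2)) - (m + |t|) ≤ 0),
      max_eq_left (by linarith : 0 ≤ m + |t| + 1 - (m + |t|)),
      max_eq_left (by linarith : h (c p q (j + 2)) ≤ m + |t| + 1),
      max_eq_right (by linarith : m + |t| - (m + |t| + 1) ≤ 0)]
    ring
  have w1 : heightWeight n h (c p q j) (c p q (j + 1)) = 0 := by
    by_contra h3
    have h4 := (heightWeight_pos h3).2.2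
    rw [← overMin_of_le o1, m1] at h4
    have := le_max_right (h (c p q j)) (h (c p q (j + 1)))
    linarith
  have w2 : heightWeight n h (c p q (j + 1)) (c p q (j + 2)) = 0 := by
    by_contra h3
    have h4 := (heightWeight_pos h3).2.2
    rw [← overMin_of_le o2, m2] at h4
    have := le_max_left (h (c p q (j + 1))) (h (c p q (j + 2)))
    linarith
  have hmin : ∀ r s, r + 2 ≤ s → s < n →
      intervalMin (height n (heightWeight n h)) (r + 1) (s - 1) = overMin h r s := by
    intro r s h3 h4
    rw [overMin_of_le h3, intervalMin_congr (by omega) fun d _ h2 =>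
      hh.height_heightWeight (show d < n by omega)]
  have hcorner := hf.toIsFamily.corner_sum o1 o2 hb (t := m + |t|)
    ((hmin _ _ o1 (by omega)).trans m1) ((hmin _ _ o2 hb).trans m2)
    (by rw [hh.height_heightWeight (by omega)]; linarith)
  rw [hh.height_heightWeight (by omega), y1] at hcorner
  intro a b hab
  refine hf.toIsFamily.chordCompat_eq o1 o2 hb w1 w2 ?_ ?_ hab
  · rw [hcorner, hh.coord_heightWeight o1 (by omega), e1]
    ring
  · rw [hcorner, hh.coord_heightWeight o2 hb, e2]
    ring

end Families

/-! ### Labels of the points -/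

section Labels

variable {n : ℕ}

lemma sbtw_iff_val {m : ℕ} [NeZero m] {a b c : ZMod m} : sbtw a b c ↔
    (a.val < b.val ∧ b.val < c.val) ∨ (b.val < c.val ∧ c.val < a.val) ∨
      (c.val < a.val ∧ a.val < b.val) := by
  cases m with
  | zero => exact absurd rfl (NeZero.ne 0)
  | succ m => exact Iff.rfl

/-- The hollow point `2 i + 1`. -/
def hollowPt (n i : ℕ) : ZMod (2 * n) := ((2 * i + 1 : ℕ) : ZMod (2 * n))

/-- The solid point `2 i`. -/
def solidPt (n i : ℕ) : ZMod (2 * n) := ((2 * i : ℕ) : ZMod (2 * n))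

lemma hollowPt_val {i : ℕ} (hi : i < n) : (hollowPt n i).val = 2 * i + 1 :=
  ZMod.val_natCast_of_lt (by omega)

lemma solidPt_val {i : ℕ} (hi : i < n) : (solidPt n i).val = 2 * i :=
  ZMod.val_natCast_of_lt (by omega)

lemma hollowPt_inj {i j : ℕ} (hi : i < n) (hj : j < n) (h : hollowPt n i = hollowPt n j) :
    i = j := by
  have := congrArg ZMod.val h
  rw [hollowPt_val hi, hollowPt_val hj] at this
  omega

lemma solidPt_inj {i j : ℕ} (hi : i < n) (hj : j < n) (h : solidPt n i = solidPt n j) :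
    i = j := by
  have := congrArg ZMod.val h
  rw [solidPt_val hi, solidPt_val hj] at this
  omega

lemma hollowPt_add_two (i : ℕ) : hollowPt n i + 2 = hollowPt n (i + 1) := by
  unfold hollowPt
  push_cast
  ring

lemma solidPt_add_two (i : ℕ) : solidPt n i + 2 = solidPt n (i + 1) := by
  unfold solidPt
  push_cast
  ring

lemma hollowPt_self : hollowPt n n = hollowPt n 0 := by
  unfold hollowPt
  rw [Nat.cast_add, ZMod.natCast_self]
  simp

lemma solidPt_self : solidPt n n = solidPt n 0 := by
  unfold solidPt
  rw [ZMod.natCast_self]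
  simp

lemma hollowPt_sub_one (i : ℕ) : hollowPt n i - 1 = solidPt n i := by
  unfold hollowPt solidPt
  push_cast
  ring

/-- The hollow diagonal joining the `p`-th and the `q`-th hollow point. -/
def hollowDiag (n p q : ℕ) : Diag n := s(hollowPt n p, hollowPt n q)

/-- The solid diagonal joining the `a`-th and the `b`-th solid point. -/
def solidDiag (n a b : ℕ) : Diag n := s(solidPt n a, solidPt n b)

lemma rotate_hollowDiag (p q : ℕ) : rotate (hollowDiag n p q) = solidDiag n p q := by
  simp [rotate, hollowDiag, solidDiag, hollowPt_sub_one]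

lemma hollowDiag_inj {p q r s : ℕ} (hpq : p < q) (hq : q < n) (hrs : r < s) (hs : s < n)
    (h : hollowDiag n p q = hollowDiag n r s) : p = r ∧ q = s := by
  rcases Sym2.eq_iff.1 h with ⟨h1, h2⟩ | ⟨h1, h2⟩
  · exact ⟨hollowPt_inj (by omega) (by omega) h1, hollowPt_inj hq hs h2⟩
  · have := hollowPt_inj (by omega) (by omega) h1
    have := hollowPt_inj (by omega) (by omega) h2
    omega

lemma solidDiag_inj {p q r s : ℕ} (hpq : p < q) (hq : q < n) (hrs : r < s) (hs : s < n)
    (h : solidDiag n p q = solidDiag n r s) : p = r ∧ q = s := by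
  rcases Sym2.eq_iff.1 h with ⟨h1, h2⟩ | ⟨h1, h2⟩
  · exact ⟨solidPt_inj (by omega) (by omega) h1, solidPt_inj hq hs h2⟩
  · have := solidPt_inj (by omega) (by omega) h1
    have := solidPt_inj (by omega) (by omega) h2
    omega

lemma isBoundary_hollowDiag {p q : ℕ} (hpq : p < q) (hq : q < n) :
    IsBoundary (hollowDiag n p q) ↔ q = p + 1 ∨ (p = 0 ∧ q = n - 1) := by
  constructor
  · rintro ⟨v, hv⟩
    rcases Sym2.eq_iff.1 hv with ⟨rfl, h⟩ | ⟨h, rfl⟩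
    · rw [hollowPt_add_two] at h
      exact Or.inl (hollowPt_inj hq (by omega) h)
    · rw [hollowPt_add_two] at h
      rcases (show q + 1 < n ∨ q + 1 = n by omega) with h1 | h1
      · have := hollowPt_inj (by omega) h1 h
        omega
      · rw [h1, hollowPt_self] at h
        have := hollowPt_inj (by omega) (by omega) h
        exact Or.inr (by omega)
  · rintro (rfl | ⟨rfl, rfl⟩)
    · exact ⟨hollowPt n p, by rw [hollowPt_add_two]; rfl⟩
    · refine ⟨hollowPt n (n - 1), ?_⟩
      rw [hollowPt_add_two, Nat.sub_add_cancel (by omega), hollowPt_self]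
      exact Sym2.eq_swap

lemma isBoundary_solidDiag {p q : ℕ} (hpq : p < q) (hq : q < n) :
    IsBoundary (solidDiag n p q) ↔ q = p + 1 ∨ (p = 0 ∧ q = n - 1) := by
  constructor
  · rintro ⟨v, hv⟩
    rcases Sym2.eq_iff.1 hv with ⟨rfl, h⟩ | ⟨h, rfl⟩
    · rw [solidPt_add_two] at h
      exact Or.inl (solidPt_inj hq (by omega) h)
    · rw [solidPt_add_two] at h
      rcases (show q + 1 < n ∨ q + 1 = n by omega) with h1 | h1
      · have := solidPt_inj (by omega) h1 h
        omega
      · rw [h1, solidPt_self] at h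
        have := solidPt_inj (by omega) (by omega) h
        exact Or.inr (by omega)
  · rintro (rfl | ⟨rfl, rfl⟩)
    · exact ⟨solidPt n p, by rw [solidPt_add_two]; rfl⟩
    · refine ⟨solidPt n (n - 1), ?_⟩
      rw [solidPt_add_two, Nat.sub_add_cancel (by omega), solidPt_self]
      exact Sym2.eq_swap

/-- The diagonals of `D` and the boundary edges, as pairs of indices. -/
def dissectionEdge (D : Finset (Diag n)) (p q : ℕ) : Prop :=
  p < q ∧ q < n ∧ hollowDiag n p q ∈ withBoundary D

variable {D : Finset (Diag n)}

lemma exists_mem_hollowDiag_iff {e f : ℕ × ℕ} (he : dissectionEdge D e.1 e.2)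
    (hf : dissectionEdge D f.1 f.2) :
    (∃ v, v ∈ hollowDiag n e.1 e.2 ∧ v ∈ hollowDiag n f.1 f.2) ↔ ShareEnd e f := by
  have he1 := he.1.trans he.2.1
  have hf1 := hf.1.trans hf.2.1
  constructor
  · rintro ⟨v, h1, h2⟩
    rcases Sym2.mem_iff.1 h1 with rfl | rfl <;> rcases Sym2.mem_iff.1 h2 with h3 | h3
    · exact Or.inl (hollowPt_inj he1 hf1 h3)
    · exact Or.inr (Or.inl (hollowPt_inj he1 hf.2.1 h3))
    · exact Or.inr (Or.inr (Or.inl (hollowPt_inj he.2.1 hf1 h3)))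
    · exact Or.inr (Or.inr (Or.inr (hollowPt_inj he.2.1 hf.2.1 h3)))
  · rintro (h | h | h | h)
    · exact ⟨_, Sym2.mem_mk_left _ _, h ▸ Sym2.mem_mk_left _ _⟩
    · exact ⟨_, Sym2.mem_mk_left _ _, h ▸ Sym2.mem_mk_right _ _⟩
    · exact ⟨_, Sym2.mem_mk_right _ _, h ▸ Sym2.mem_mk_left _ _⟩
    · exact ⟨_, Sym2.mem_mk_right _ _, h ▸ Sym2.mem_mk_right _ _⟩

variable [NeZero n]

lemma exists_hollowPt {v : ZMod (2 * n)} (hv : Odd v.val) : ∃ i < n, v = hollowPt n i := by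
  obtain ⟨i, hi⟩ := hv
  have h1 := ZMod.val_lt v
  refine ⟨i, by omega, ?_⟩
  rw [hollowPt, ← hi, ZMod.natCast_zmod_val]

lemma exists_solidPt {v : ZMod (2 * n)} (hv : Even v.val) : ∃ i < n, v = solidPt n i := by
  obtain ⟨i, hi⟩ := hv
  have h1 := ZMod.val_lt v
  refine ⟨i, by omega, ?_⟩
  rw [solidPt, show 2 * i = v.val by omega, ZMod.natCast_zmod_val]

lemma cross_iff_val {u v x y : ZMod (2 * n)} (huv : u.val < v.val) (hxy : x.val < y.val) :
    Cross s(u, v) s(x, y) ↔ (u.val < x.val ∧ x.val < v.val ∧ v.val < y.val) ∨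
      (x.val < u.val ∧ u.val < y.val ∧ y.val < v.val) := by
  constructor
  · rintro ⟨a, b, c, d, h1, h2, h3, h4⟩
    rw [sbtw_iff_val] at h3 h4
    rcases Sym2.eq_iff.1 h1 with ⟨rfl, rfl⟩ | ⟨rfl, rfl⟩ <;>
      rcases Sym2.eq_iff.1 h2 with ⟨rfl, rfl⟩ | ⟨rfl, rfl⟩ <;> omega
  · rintro (h | h)
    · refine ⟨u, v, x, y, rfl, rfl, ?_, ?_⟩ <;> rw [sbtw_iff_val] <;> omega
    · refine ⟨u, v, y, x, rfl, Sym2.eq_swap, ?_, ?_⟩ <;> rw [sbtw_iff_val] <;> omega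

/-- The inequalities are half-open because the solid point `2 a` precedes the hollow point `2 a + 1`
of the same index. -/
lemma cross_solid_hollow {a b p q : ℕ} (hab : a < b) (hb : b < n) (hpq : p < q) (hq : q < n) :
    Cross (solidDiag n a b) (hollowDiag n p q) ↔
      (p < a ∧ a ≤ q ∧ q < b) ∨ (a ≤ p ∧ p < b ∧ b ≤ q) := by
  have h1 := solidPt_val (show a < n by omega)
  have h2 := solidPt_val hb
  have h3 := hollowPt_val (show p < n by omega)
  have h4 := hollowPt_val hq
  rw [solidDiag, hollowDiag, cross_iff_val (by omega) (by omega), h1, h2, h3, h4]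
  omega

lemma cross_solid_solid {a b p q : ℕ} (hab : a < b) (hb : b < n) (hpq : p < q) (hq : q < n) :
    Cross (solidDiag n a b) (solidDiag n p q) ↔
      (a < p ∧ p < b ∧ b < q) ∨ (p < a ∧ a < q ∧ q < b) := by
  have h1 := solidPt_val (show a < n by omega)
  have h2 := solidPt_val hb
  have h3 := solidPt_val (show p < n by omega)
  have h4 := solidPt_val hq
  rw [solidDiag, solidDiag, cross_iff_val (by omega) (by omega), h1, h2, h3, h4]
  omega

lemma cross_hollow_hollow {a b p q : ℕ} (hab : a < b) (hb : b < n) (hpq : p < q) (hq : q < n) :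
    Cross (hollowDiag n a b) (hollowDiag n p q) ↔
      (a < p ∧ p < b ∧ b < q) ∨ (p < a ∧ a < q ∧ q < b) := by
  have h1 := hollowPt_val (show a < n by omega)
  have h2 := hollowPt_val hb
  have h3 := hollowPt_val (show p < n by omega)
  have h4 := hollowPt_val hq
  rw [hollowDiag, hollowDiag, cross_iff_val (by omega) (by omega), h1, h2, h3, h4]
  omega

lemma isHollow_iff {δ : Diag n} : IsHollow δ ↔ ∃ p q, p < q ∧ q < n ∧ δ = hollowDiag n p q := by
  constructor
  · rintro ⟨h1, h2⟩
    obtain ⟨⟨x, y⟩, rfl⟩ := Sym2.mk_surjective δ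
    obtain ⟨i, hi, rfl⟩ := exists_hollowPt (h2 x (Sym2.mem_mk_left x y))
    obtain ⟨j, hj, rfl⟩ := exists_hollowPt (h2 y (Sym2.mem_mk_right _ y))
    rcases lt_trichotomy i j with h | rfl | h
    · exact ⟨i, j, h, hj, rfl⟩
    · exact absurd rfl h1
    · exact ⟨j, i, h, hi, Sym2.eq_swap⟩
  · rintro ⟨p, q, hpq, hq, rfl⟩
    refine ⟨fun h => ?_, fun v hv => ?_⟩
    · have := hollowPt_inj (by omega) hq h
      omega
    · rcases Sym2.mem_iff.1 hv with rfl | rfl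
      · exact ⟨p, hollowPt_val (by omega)⟩
      · exact ⟨q, hollowPt_val hq⟩

lemma isSolid_iff {δ : Diag n} : IsSolid δ ↔ ∃ p q, p < q ∧ q < n ∧ δ = solidDiag n p q := by
  constructor
  · rintro ⟨h1, h2⟩
    obtain ⟨⟨x, y⟩, rfl⟩ := Sym2.mk_surjective δ
    obtain ⟨i, hi, rfl⟩ := exists_solidPt (h2 x (Sym2.mem_mk_left x y))
    obtain ⟨j, hj, rfl⟩ := exists_solidPt (h2 y (Sym2.mem_mk_right _ y))
    rcases lt_trichotomy i j with h | rfl | h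
    · exact ⟨i, j, h, hj, rfl⟩
    · exact absurd rfl h1
    · exact ⟨j, i, h, hi, Sym2.eq_swap⟩
  · rintro ⟨p, q, hpq, hq, rfl⟩
    refine ⟨fun h => ?_, fun v hv => ?_⟩
    · have := solidPt_inj (by omega) hq h
      omega
    · rcases Sym2.mem_iff.1 hv with rfl | rfl
      · exact ⟨p, by rw [solidPt_val (by omega)]; ring⟩
      · exact ⟨q, by rw [solidPt_val hq]; ring⟩

lemma compat_eq {p q a b : ℕ} (hpq : p < q) (hq : q < n) (hab : a < b) (hb : b < n) :
    compat (hollowDiag n p q) (solidDiag n a b) = chordCompat p q a b := by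
  unfold compat chordCompat
  rw [rotate_hollowDiag]
  have h1 : solidDiag n a b = solidDiag n p q ↔ a = p ∧ b = q :=
    ⟨solidDiag_inj hab hb hpq hq, by rintro ⟨rfl, rfl⟩; rfl⟩
  simp only [h1, cross_solid_solid hab hb hpq hq]

/-! ### The laminar family of a hollow dissection -/

lemma dissectionEdge_iff {p q : ℕ} :
    dissectionEdge D p q ↔ p < q ∧ q < n ∧
      (hollowDiag n p q ∈ D ∨ q = p + 1 ∨ (p = 0 ∧ q = n - 1)) := by
  unfold dissectionEdge
  refine and_congr_right fun h1 => and_congr_right fun h2 => ?_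
  change _ ∨ _ ∧ _ ↔ _
  rw [isBoundary_hollowDiag h1 h2, and_iff_right (isHollow_iff.2 ⟨p, q, h1, h2, rfl⟩)]

lemma isLaminar_dissectionEdge (hn : 3 ≤ n) (hD : IsHollowDissection D) :
    IsLaminar n (dissectionEdge D) where
  lt h := h.1
  bound h := h.2.1
  leaf p hp := (dissectionEdge_iff).2 ⟨by omega, hp, Or.inr (Or.inl rfl)⟩
  root := (dissectionEdge_iff).2 ⟨by omega, by omega, Or.inr (Or.inr ⟨rfl, rfl⟩)⟩
  noncross {p q r s} h1 h2 h3 h4 h5 := by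
    obtain ⟨a1, a2, a3⟩ := (dissectionEdge_iff).1 h1
    obtain ⟨b1, b2, b3⟩ := (dissectionEdge_iff).1 h2
    rcases a3 with a3 | a3
    · rcases b3 with b3 | b3
      · exact hD.2 _ a3 _ b3 ((cross_hollow_hollow a1 a2 b1 b2).2 (Or.inl ⟨h3, h4, h5⟩))
      · omega
    · omega

lemma isInner_dissectionEdge (hD : IsHollowDissection D) {p q : ℕ} :
    IsInner n (dissectionEdge D) p q ↔ p < q ∧ q < n ∧ hollowDiag n p q ∈ D := by
  constructor
  · rintro ⟨h1, h2, h3⟩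
    obtain ⟨a1, a2, a3⟩ := (dissectionEdge_iff).1 h1
    exact ⟨a1, a2, a3.resolve_right (by omega)⟩
  · rintro ⟨h1, h2, h3⟩
    have := (hD.1 _ h3).2
    rw [isBoundary_hollowDiag h1 h2] at this
    exact ⟨(dissectionEdge_iff).2 ⟨h1, h2, Or.inl h3⟩, by omega, by omega⟩

lemma exists_isInner (hD : IsHollowDissection D) {δ : Diag n} (hδ : δ ∈ D) :
    ∃ p q, IsInner n (dissectionEdge D) p q ∧ δ = hollowDiag n p q := by
  obtain ⟨p, q, h1, h2, rfl⟩ := isHollow_iff.1 (hD.1 δ hδ).1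
  exact ⟨p, q, (isInner_dissectionEdge hD).2 ⟨h1, h2, hδ⟩, rfl⟩

lemma exists_dissectionEdge (hD : IsHollowDissection D) {δ : Diag n} (hδ : δ ∈ withBoundary D) :
    ∃ e : ℕ × ℕ, dissectionEdge D e.1 e.2 ∧ δ = hollowDiag n e.1 e.2 := by
  have h : IsHollow δ := by
    rcases hδ with h | h
    · exact (hD.1 δ h).1
    · exact h.1
  obtain ⟨p, q, h1, h2, rfl⟩ := isHollow_iff.1 h
  exact ⟨(p, q), ⟨h1, h2, hδ⟩, rfl⟩

lemma crossesEdge_iff {a b : ℕ} (hab : a < b) (hb : b < n) {e : ℕ × ℕ} :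
    CrossesEdge (dissectionEdge D) a b e ↔ dissectionEdge D e.1 e.2 ∧
      Cross (solidDiag n a b) (hollowDiag n e.1 e.2) := by
  unfold CrossesEdge
  refine and_congr_right fun h => ?_
  rw [cross_solid_hollow hab hb h.1 h.2.1]

/-- Paths are transported along the bijection between crossed edges and their index pairs. -/
lemma isAccordionDiagonal_iff (hD : IsHollowDissection D) {a b : ℕ} (hab : a < b) (hb : b < n) :
    IsAccordionDiagonal D (solidDiag n a b) ↔ CrossesConnected (dissectionEdge D) a b := by
  unfold IsAccordionDiagonal
  rw [and_iff_right (isSolid_iff.2 ⟨a, b, hab, hb, rfl⟩)]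
  set S : Set (Diag n) := {ε | ε ∈ withBoundary D ∧ Cross (solidDiag n a b) ε} with hS
  have hmem : ∀ e : ℕ × ℕ, CrossesEdge (dissectionEdge D) a b e → hollowDiag n e.1 e.2 ∈ S :=
    fun e he => by
      rw [crossesEdge_iff hab hb] at he
      exact ⟨he.1.2.2, he.2⟩
  have hex : ∀ δ ∈ S, ∃ e : ℕ × ℕ, CrossesEdge (dissectionEdge D) a b e ∧
      δ = hollowDiag n e.1 e.2 := by
    rintro δ ⟨h1, h2⟩
    obtain ⟨e, he, rfl⟩ := exists_dissectionEdge hD h1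
    exact ⟨e, (crossesEdge_iff hab hb).2 ⟨he, h2⟩, rfl⟩
  have hinj : ∀ {e f : ℕ × ℕ}, CrossesEdge (dissectionEdge D) a b e →
      CrossesEdge (dissectionEdge D) a b f →
      hollowDiag n e.1 e.2 = hollowDiag n f.1 f.2 → e = f := fun he hf h =>
    Prod.ext_iff.2 (hollowDiag_inj he.1.1 he.1.2.1 hf.1.1 hf.1.2.1 h)
  constructor
  · intro H e f he hf
    have key : ∀ δ, Relation.ReflTransGen (fun α β => β ∈ S ∧ ∃ v, v ∈ α ∧ v ∈ β)
        (hollowDiag n e.1 e.2) δ → ∃ g, CrossesEdge (dissectionEdge D) a b g ∧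
          δ = hollowDiag n g.1 g.2 ∧ Relation.ReflTransGen
            (fun e f => CrossesEdge (dissectionEdge D) a b f ∧ ShareEnd e f) e g := by
      intro δ h
      induction h with
      | refl => exact ⟨e, he, rfl, Relation.ReflTransGen.refl⟩
      | tail _ h ih =>
        obtain ⟨g, hg, rfl, hr⟩ := ih
        obtain ⟨g', hg', rfl⟩ := hex _ h.1
        exact ⟨g', hg', rfl, hr.tail ⟨hg', (exists_mem_hollowDiag_iff hg.1 hg'.1).1 h.2⟩⟩
    obtain ⟨g, hg, h1, h2⟩ := key _ (H _ (hmem e he) _ (hmem f hf))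
    rwa [hinj hf hg h1]
  · intro H δ hδ ε hε
    obtain ⟨e, he, rfl⟩ := hex δ hδ
    obtain ⟨f, hf, rfl⟩ := hex ε hε
    have key : ∀ g, Relation.ReflTransGen
        (fun e f => CrossesEdge (dissectionEdge D) a b f ∧ ShareEnd e f) e g →
          CrossesEdge (dissectionEdge D) a b g ∧
          Relation.ReflTransGen (fun α β => β ∈ S ∧ ∃ v, v ∈ α ∧ v ∈ β)
            (hollowDiag n e.1 e.2) (hollowDiag n g.1 g.2) := by
      intro g h
      induction h with
      | refl => exact ⟨he, Relation.ReflTransGen.refl⟩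
      | tail _ h ih =>
        exact ⟨h.1, ih.2.tail ⟨hmem _ h.1, (exists_mem_hollowDiag_iff ih.1.1 h.1.1).2 h.2⟩⟩
    exact (key f (H e f he hf)).2

end Labels

/-! ### Fans from unique nonnegative representations -/

section Fans

variable {ι V : Type*} [Fintype ι] [AddCommGroup V] [Module ℝ V] {v : ι → V}

/-- `x` is the combination of the vectors `v` with nonnegative coefficients `Λ` supported
on `A`. -/
structure IsConicRep (v : ι → V) (A : Finset ι) (Λ : ι → ℝ) (x : V) : Prop where
  nonneg : ∀ i, 0 ≤ Λ i
  supp : ∀ i, i ∉ A → Λ i = 0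
  sum : ∑ i, Λ i • v i = x

lemma IsConicRep.add {A : Finset ι} {Λ Λ' : ι → ℝ} {x y : V} (h : IsConicRep v A Λ x)
    (h' : IsConicRep v A Λ' y) : IsConicRep v A (Λ + Λ') (x + y) where
  nonneg i := add_nonneg (h.nonneg i) (h'.nonneg i)
  supp i hi := by simp [h.supp i hi, h'.supp i hi]
  sum := by
    rw [← h.sum, ← h'.sum, ← Finset.sum_add_distrib]
    exact Finset.sum_congr rfl fun i _ => add_smul _ _ _

lemma IsConicRep.smul {A : Finset ι} {Λ : ι → ℝ} {x : V} (h : IsConicRep v A Λ x) {a : ℝ}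
    (ha : 0 ≤ a) : IsConicRep v A (a • Λ) (a • x) where
  nonneg i := mul_nonneg ha (h.nonneg i)
  supp i hi := by simp [h.supp i hi]
  sum := by
    rw [← h.sum, Finset.smul_sum]
    exact Finset.sum_congr rfl fun i _ => by rw [Pi.smul_apply, smul_assoc]

lemma isConicRep_single [DecidableEq ι] {A : Finset ι} {i : ι} (hi : i ∈ A) :
    IsConicRep v A (Pi.single i 1) (v i) where
  nonneg j := by
    by_cases h : j = i
    · subst h; simp
    · simp [h]
  supp j hj := Pi.single_eq_of_ne (by rintro rfl; exact hj hi) _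
  sum := by
    rw [Finset.sum_eq_single i (fun j _ hj => by simp [hj]) (by simp)]
    simp

lemma IsConicRep.mono {A B : Finset ι} {Λ : ι → ℝ} {x : V} (h : IsConicRep v A Λ x)
    (hAB : ∀ i, Λ i ≠ 0 → i ∈ B) : IsConicRep v B Λ x :=
  ⟨h.nonneg, fun i hi => by by_contra h0; exact hi (hAB i h0), h.sum⟩

lemma IsConicRep.mem_hull {A : Finset ι} {Λ : ι → ℝ} {x : V} (h : IsConicRep v A Λ x) :
    x ∈ PointedCone.hull ℝ (v '' (A : Set ι)) := by
  rw [← h.sum]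
  refine Submodule.sum_mem _ fun i _ => ?_
  by_cases hi : i ∈ A
  · exact Submodule.smul_mem _ (⟨Λ i, h.nonneg i⟩ : {c : ℝ // 0 ≤ c})
      (Submodule.subset_span ⟨i, hi, rfl⟩)
  · rw [h.supp i hi, zero_smul]
    exact Submodule.zero_mem _

lemma mem_hull_image_iff {A : Finset ι} {x : V} :
    x ∈ PointedCone.hull ℝ (v '' (A : Set ι)) ↔ ∃ Λ, IsConicRep v A Λ x := by
  classical
  refine ⟨fun hx => ?_, fun ⟨Λ, h⟩ => h.mem_hull⟩
  induction hx using Submodule.span_induction with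
  | mem x hx =>
    obtain ⟨i, hi, rfl⟩ := hx
    exact ⟨_, isConicRep_single hi⟩
  | zero => exact ⟨0, fun _ => le_rfl, fun _ _ => rfl, by simp⟩
  | add x y _ _ hx hy =>
    obtain ⟨Λ, h⟩ := hx
    obtain ⟨Λ', h'⟩ := hy
    exact ⟨_, h.add h'⟩
  | smul a x _ hx =>
    obtain ⟨Λ, h⟩ := hx
    exact ⟨_, h.smul a.2⟩

/-- Vectors in a face of a conic hull are combinations of generators in the face. -/
lemma IsConicRep.generator_mem {A : Finset ι} {Λ : ι → ℝ} {x : V} (h : IsConicRep v A Λ x)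
    {G : PointedCone ℝ V} (hG : G.IsFaceOf (PointedCone.hull ℝ (v '' (A : Set ι))))
    (hx : x ∈ G) {i : ι} (hi : Λ i ≠ 0) : v i ∈ G := by
  classical
  have hiA : i ∈ A := by by_contra h0; exact hi (h.supp i h0)
  have hrest : ∑ j ∈ Finset.univ.erase i, Λ j • v j ∈
      PointedCone.hull ℝ (v '' (A : Set ι)) := by
    refine Submodule.sum_mem _ fun j _ => ?_
    by_cases hj : j ∈ A
    · exact Submodule.smul_mem _ (⟨Λ j, h.nonneg j⟩ : {c : ℝ // 0 ≤ c})
        (Submodule.subset_span ⟨j, hj, rfl⟩)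
    · rw [h.supp j hj, zero_smul]
      exact Submodule.zero_mem _
  refine hG.mem_of_smul_add_mem (a := Λ i) (Submodule.subset_span ⟨i, hiA, rfl⟩) hrest
    (lt_of_le_of_ne (h.nonneg i) hi.symm) ?_
  have hsum := Finset.add_sum_erase Finset.univ (fun j => Λ j • v j) (Finset.mem_univ i)
  rw [h.sum] at hsum
  rwa [hsum]

/-- The cones spanned by the faces of a simplicial complex form a complete simplicial fan when
every vector has a unique nonnegative representation supported on a face. -/
theorem isCompleteSimplicialFan_of_unique {Δ : Set (Finset ι)}
    (hΔ : ∀ A ∈ Δ, ∀ B ⊆ A, B ∈ Δ) (hex : ∀ x, ∃ A ∈ Δ, ∃ Λ, IsConicRep v A Λ x)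
    (huniq : ∀ A ∈ Δ, ∀ B ∈ Δ, ∀ Λ Λ' x, IsConicRep v A Λ x → IsConicRep v B Λ' x → Λ = Λ') :
    IsCompleteSimplicialFan {K | ∃ A, A ∈ Δ ∧ K = PointedCone.hull ℝ (v '' (A : Set ι))} ∧
      ∀ A ∈ Δ, ∀ B ∈ Δ, PointedCone.hull ℝ (v '' (A : Set ι)) ≤
        PointedCone.hull ℝ (v '' (B : Set ι)) ↔ A ⊆ B := by
  classical
  have inter : ∀ A ∈ Δ, ∀ B ∈ Δ, (PointedCone.hull ℝ (v '' (A : Set ι)) ⊓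
      PointedCone.hull ℝ (v '' (B : Set ι))).IsFaceOf (PointedCone.hull ℝ (v '' (A : Set ι))) := by
    intro A hA B hB
    refine ⟨inf_le_left, fun {x y a} hx hy ha hxy => ⟨hx, ?_⟩⟩
    obtain ⟨Λ, h⟩ := mem_hull_image_iff.1 hx
    obtain ⟨Λ', h'⟩ := mem_hull_image_iff.1 hy
    obtain ⟨M, hM⟩ := mem_hull_image_iff.1 hxy.2
    -- The representations of `a • x + y` from `A` and from `B` agree. Coefficients are nonnegative,
    -- so nothing cancels and those of `x` are already supported on `B`.
    have heq := huniq A hA B hB _ _ _ ((h.smul ha.le).add h') hM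
    refine (h.mono (B := B) fun i hi => ?_).mem_hull
    by_contra hiB
    have h1 := congrFun heq i
    rw [hM.supp i hiB] at h1
    have h2 : 0 < a * Λ i := mul_pos ha (lt_of_le_of_ne (h.nonneg i) hi.symm)
    have h3 := h'.nonneg i
    simp only [Pi.add_apply, Pi.smul_apply, smul_eq_mul] at h1
    linarith
  refine ⟨⟨?_, ?_, ?_, ?_, ?_⟩, ?_⟩
  · refine ((Set.toFinite Δ).image fun A : Finset ι =>
      PointedCone.hull ℝ (v '' (A : Set ι))).subset ?_
    rintro K ⟨A, hA, rfl⟩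
    exact ⟨A, hA, rfl⟩
  · rintro K ⟨A, hA, rfl⟩
    refine PointedCone.IsSimplicial.hull (A.finite_toSet.image v) (LinearIndepOn.id_image ?_)
    rw [linearIndepOn_finset_iff]
    intro f hf i hi
    -- Moving the negative coefficients of a linear relation to the other side gives two conic
    -- representations of one vector, which must coincide.
    have rep : ∀ g : ι → ℝ, IsConicRep v A (fun i => if i ∈ A then max (g i) 0 else 0)
        (∑ i ∈ A, max (g i) 0 • v i) := by
      intro g
      refine ⟨fun i => ?_, fun i hi => if_neg hi, ?_⟩
      · split_ifs
        · exact le_max_right _ _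
        · exact le_rfl
      · simp only [ite_smul, zero_smul, Finset.sum_ite_mem, Finset.univ_inter]
    have hsum : ∑ i ∈ A, max (f i) 0 • v i = ∑ i ∈ A, max (-f i) 0 • v i := by
      rw [← sub_eq_zero, ← Finset.sum_sub_distrib, ← hf]
      refine Finset.sum_congr rfl fun j _ => ?_
      rw [← sub_smul]
      congr 1
      rcases le_total (f j) 0 with h | h
      · rw [max_eq_right h, max_eq_left (by linarith)]; ring
      · rw [max_eq_left h, max_eq_right (by linarith)]; ring
    have h1 := congrFun (huniq A hA A hA _ _ _ (rep f) (hsum ▸ rep fun i => -f i)) i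
    simp only [if_pos hi] at h1
    rcases le_total (f i) 0 with h | h
    · rw [max_eq_right h, max_eq_left (by linarith)] at h1; linarith
    · rw [max_eq_left h, max_eq_right (by linarith)] at h1; linarith
  · rintro K ⟨A, hA, rfl⟩ G hG
    -- A face is spanned by the generators that it contains.
    refine ⟨A.filter fun i => v i ∈ G, hΔ A hA _ (Finset.filter_subset _ _), le_antisymm ?_ ?_⟩
    · intro x hx
      obtain ⟨Λ, h⟩ := mem_hull_image_iff.1 (hG.le hx)
      refine (h.mono fun i hi => Finset.mem_filter.2 ⟨?_, h.generator_mem hG hx hi⟩).mem_hull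
      by_contra h0
      exact hi (h.supp i h0)
    · refine Submodule.span_le.2 ?_
      rintro _ ⟨i, hi, rfl⟩
      exact (Finset.mem_filter.1 hi).2
  · rintro K ⟨A, hA, rfl⟩ L ⟨B, hB, rfl⟩
    exact ⟨inter A hA B hB, by rw [inf_comm]; exact inter B hB A hA⟩
  · intro x
    obtain ⟨A, hA, Λ, h⟩ := hex x
    exact ⟨_, ⟨A, hA, rfl⟩, h.mem_hull⟩
  · intro A hA B hB
    refine ⟨fun h i hi => ?_, fun h => Submodule.span_mono (Set.image_mono h)⟩
    obtain ⟨M, hM⟩ := mem_hull_image_iff.1 (h (isConicRep_single (v := v) hi).mem_hull)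
    have h1 := congrFun (huniq A hA B hB _ _ _ (isConicRep_single hi) hM) i
    by_contra h0
    rw [hM.supp i h0] at h1
    simp at h1

end Fans

/-! ### Weighted accordion dissections -/

section WeightedDissections

variable {n : ℕ} {D : Finset (Diag n)}

/-- The weights of the chords for a weighted set of solid diagonals. -/
noncomputable def chordWeight (Λ : Diag n → ℝ) (a b : ℕ) : ℝ :=
  if a < b ∧ b < n then Λ (solidDiag n a b) else 0

/-- The pairs of indices of solid diagonals. -/
def chordPairs (n : ℕ) : Finset (ℕ × ℕ) :=
  (Finset.range n ×ˢ Finset.range n).filter fun e => e.1 < e.2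

lemma mem_chordPairs {e : ℕ × ℕ} : e ∈ chordPairs n ↔ e.1 < e.2 ∧ e.2 < n := by
  simp only [chordPairs, Finset.mem_filter, Finset.mem_product, Finset.mem_range]
  omega

lemma IsAccordionDissection.subset {A B : Finset (Diag n)} (hA : IsAccordionDissection D A)
    (hBA : B ⊆ A) : IsAccordionDissection D B :=
  ⟨fun δ hδ => hA.1 δ (hBA hδ), fun δ hδ ε hε => hA.2 δ (hBA hδ) ε (hBA hε)⟩

lemma IsAccordionDissection.isSolid_of_ne_zero {A : Finset (Diag n)}
    (hA : IsAccordionDissection D A) {Λ : Diag n → ℝ} (hsupp : ∀ ε, ε ∉ A → Λ ε = 0)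
    {ε : Diag n} (hε : Λ ε ≠ 0) : IsSolid ε :=
  (hA.1 ε (by by_contra h; exact hε (hsupp ε h))).1.1

variable [NeZero n]

lemma isAccordionFamily_chordWeight (hD : IsHollowDissection D) {A : Finset (Diag n)}
    (hA : IsAccordionDissection D A) {Λ : Diag n → ℝ} (h0 : ∀ ε, 0 ≤ Λ ε)
    (hsupp : ∀ ε, ε ∉ A → Λ ε = 0) :
    IsAccordionFamily n (dissectionEdge D) (chordWeight Λ) := by
  have key : ∀ a b, chordWeight Λ a b ≠ 0 → a < b ∧ b < n ∧ solidDiag n a b ∈ A := by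
    intro a b hab
    unfold chordWeight at hab
    split_ifs at hab with h
    · exact ⟨h.1, h.2, by by_contra h1; exact hab (hsupp _ h1)⟩
    · exact absurd rfl hab
  refine ⟨⟨fun a b => ?_, fun a b hab => ?_, fun a b c d hab hcd h1 h2 h3 => ?_⟩,
    fun a b hab => ?_⟩
  · unfold chordWeight
    split_ifs
    · exact h0 _
    · exact le_rfl
  · obtain ⟨h1, h2, h3⟩ := key a b hab
    have := (hA.1 _ h3).2
    rw [isBoundary_solidDiag h1 h2] at this
    omega
  · obtain ⟨a1, a2, a3⟩ := key a b hab
    obtain ⟨b1, b2, b3⟩ := key c d hcd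
    exact hA.2 _ a3 _ b3 ((cross_solid_solid a1 a2 b1 b2).2 (Or.inl ⟨h1, h2, h3⟩))
  · obtain ⟨a1, a2, a3⟩ := key a b hab
    exact (isAccordionDiagonal_iff hD a1 a2).1 (hA.1 _ a3).1

lemma sum_dVector_apply {Λ : Diag n → ℝ} (hsolid : ∀ ε, Λ ε ≠ 0 → IsSolid ε) {p q : ℕ}
    (hpq : p < q) (hq : q < n) (hδ : hollowDiag n p q ∈ D) :
    (∑ ε, Λ ε • dVector D ε) ⟨hollowDiag n p q, hδ⟩ = coord n (chordWeight Λ) p q := by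
  classical
  rw [Finset.sum_apply]
  simp only [Pi.smul_apply, smul_eq_mul, dVector]
  have e1 : ∑ ε, Λ ε * compat (hollowDiag n p q) ε =
      ∑ ε ∈ (chordPairs n).image (fun e => solidDiag n e.1 e.2),
        Λ ε * compat (hollowDiag n p q) ε := by
    refine (Finset.sum_subset (Finset.subset_univ _) fun ε _ hε => ?_).symm
    by_cases h : Λ ε = 0
    · rw [h, zero_mul]
    · obtain ⟨a, b, hab, hb, rfl⟩ := isSolid_iff.1 (hsolid ε h)
      exact absurd (Finset.mem_image.2 ⟨(a, b), mem_chordPairs.2 ⟨hab, hb⟩, rfl⟩) hε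
  rw [e1, Finset.sum_image, chordPairs, Finset.sum_filter, Finset.sum_product]
  · unfold coord
    refine Finset.sum_congr rfl fun a _ => Finset.sum_congr rfl fun b hb => ?_
    rw [Finset.mem_range] at hb
    unfold chordWeight
    by_cases h : a < b
    · rw [if_pos h, if_pos ⟨h, hb⟩, compat_eq hpq hq h hb]
    · rw [if_neg h, if_neg (fun h' => h h'.1), zero_mul]
  · intro e he f hf h
    rw [Finset.mem_coe, mem_chordPairs] at he hf
    exact Prod.ext_iff.2 (solidDiag_inj he.1 he.2 hf.1 hf.2 h)

lemma chordWeight_injective {Λ Λ' : Diag n → ℝ} (h : ∀ ε, Λ ε ≠ 0 → IsSolid ε)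
    (h' : ∀ ε, Λ' ε ≠ 0 → IsSolid ε) (heq : chordWeight Λ = chordWeight Λ') : Λ = Λ' := by
  funext ε
  by_cases hε : IsSolid ε
  · obtain ⟨a, b, hab, hb, rfl⟩ := isSolid_iff.1 hε
    have := congrFun (congrFun heq a) b
    simpa only [chordWeight, if_pos (And.intro hab hb)] using this
  · rw [not_imp_comm.1 (h ε) hε, not_imp_comm.1 (h' ε) hε]

/-- Every weighted family of accordion chords comes from a weighted accordion dissection. -/
lemma IsAccordionFamily.exists_dissection (hD : IsHollowDissection D) {w : ℕ → ℕ → ℝ}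
    (hw : IsAccordionFamily n (dissectionEdge D) w) :
    ∃ (A : Finset (Diag n)) (Λ : Diag n → ℝ), IsAccordionDissection D A ∧ (∀ ε, 0 ≤ Λ ε) ∧
      (∀ ε, ε ∉ A → Λ ε = 0) ∧ chordWeight Λ = w := by
  classical
  set S := chordPairs n with hS
  set Λ : Diag n → ℝ := fun ε => ∑ e ∈ S, if solidDiag n e.1 e.2 = ε then w e.1 e.2 else 0
    with hΛ
  set A : Finset (Diag n) := (S.filter fun e => w e.1 e.2 ≠ 0).image fun e =>
    solidDiag n e.1 e.2 with hA
  have hmem : ∀ ε ∈ A, ∃ a b, a < b ∧ b < n ∧ w a b ≠ 0 ∧ ε = solidDiag n a b := by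
    intro ε hε
    obtain ⟨e, he, rfl⟩ := Finset.mem_image.1 hε
    obtain ⟨h1, h2⟩ := Finset.mem_filter.1 he
    rw [hS, mem_chordPairs] at h1
    exact ⟨_, _, h1.1, h1.2, h2, rfl⟩
  refine ⟨A, Λ, ⟨fun ε hε => ?_, fun ε hε ε' hε' => ?_⟩, fun ε => ?_, fun ε hε => ?_, ?_⟩
  · obtain ⟨a, b, hab, hb, hne, rfl⟩ := hmem ε hε
    rw [isAccordionDiagonal_iff hD hab hb, isBoundary_solidDiag hab hb]
    have := hw.supp a b hne
    exact ⟨hw.accordion a b hne, by omega⟩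
  · obtain ⟨a, b, hab, hb, hne, rfl⟩ := hmem ε hε
    obtain ⟨c, d, hcd, hd, hne', rfl⟩ := hmem ε' hε'
    rw [cross_solid_solid hab hb hcd hd]
    rintro (h | h)
    · exact hw.noncross a b c d hne hne' h.1 h.2.1 h.2.2
    · exact hw.noncross c d a b hne' hne h.1 h.2.1 h.2.2
  · refine Finset.sum_nonneg fun e _ => ?_
    split_ifs
    · exact hw.nonneg _ _
    · exact le_rfl
  · refine Finset.sum_eq_zero fun e he => ?_
    split_ifs with h
    · by_contra h0
      exact hε (Finset.mem_image.2 ⟨e, Finset.mem_filter.2 ⟨he, h0⟩, h⟩)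
    · rfl
  · funext a b
    unfold chordWeight
    split_ifs with h
    · rw [hΛ]
      simp only
      rw [Finset.sum_eq_single (a, b)]
      · simp
      · intro e he hne
        rw [hS, mem_chordPairs] at he
        refine if_neg fun h1 => hne ?_
        exact Prod.ext_iff.2 (solidDiag_inj he.1 he.2 h.1 h.2 h1)
      · intro h1
        exact absurd (mem_chordPairs.2 h) h1
    · by_contra h0
      have := hw.supp a b (Ne.symm h0)
      exact h ⟨by omega, this.2.1⟩

/-- The weighted families with coordinates `y` represent the vector `y`. -/
lemma IsAccordionFamily.exists_conicRep (hD : IsHollowDissection D) {w : ℕ → ℕ → ℝ}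
    (hw : IsAccordionFamily n (dissectionEdge D) w) {y : D → ℝ}
    (hy : ∀ p q (h : hollowDiag n p q ∈ D), p < q → q < n →
      coord n w p q = y ⟨hollowDiag n p q, h⟩) :
    ∃ A Λ, IsAccordionDissection D A ∧ IsConicRep (dVector D) A Λ y ∧ chordWeight Λ = w := by
  obtain ⟨A, Λ, hA, h0, hs, rfl⟩ := hw.exists_dissection hD
  refine ⟨A, Λ, hA, ⟨h0, hs, ?_⟩, rfl⟩
  funext δ
  obtain ⟨δ, hδ⟩ := δ
  obtain ⟨p, q, h1, h2, rfl⟩ := isHollow_iff.1 (hD.1 δ hδ).1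
  rw [sum_dVector_apply (fun ε => hA.isSolid_of_ne_zero hs) h1 h2 hδ, hy p q hδ h1 h2]

end WeightedDissections

/-! ### Even interior cells -/

section EvenCells

variable {n : ℕ} {D : Finset (Diag n)}

/-- The vertices `c 0, …, c K` of a polygon, as hollow points. -/
def polygon (n K : ℕ) (c : ℕ → ℕ) : Finset (ZMod (2 * n)) :=
  (Finset.range (K + 1)).image fun i => hollowPt n (c i)

lemma mem_polygon {K : ℕ} {c : ℕ → ℕ} {v : ZMod (2 * n)} :
    v ∈ polygon n K c ↔ ∃ i ≤ K, v = hollowPt n (c i) := by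
  simp only [polygon, Finset.mem_image, Finset.mem_range]
  constructor
  · rintro ⟨i, hi, rfl⟩; exact ⟨i, by omega, rfl⟩
  · rintro ⟨i, hi, rfl⟩; exact ⟨i, by omega, rfl⟩

lemma card_polygon {K : ℕ} {c : ℕ → ℕ} (hc : StrictMonoOn c (Set.Iic K)) (hn : c K < n) :
    (polygon n K c).card = K + 1 := by
  rw [polygon, Finset.card_image_of_injOn, Finset.card_range]
  intro i hi j hj h
  simp only [Finset.coe_range, Set.mem_Iio] at hi hj
  have hb : ∀ i ≤ K, c i < n := fun i hi =>
    lt_of_le_of_lt (hc.monotoneOn hi (Set.mem_Iic.2 le_rfl) hi) hn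
  exact hc.injOn (Set.mem_Iic.2 (by omega)) (Set.mem_Iic.2 (by omega))
    (hollowPt_inj (hb i (by omega)) (hb j (by omega)) h)

lemma mem_sides_polygon [NeZero n] {K : ℕ} {c : ℕ → ℕ} (hc : StrictMonoOn c (Set.Iic K))
    (hn : c K < n) (hK : 1 ≤ K) {δ : Diag n} : δ ∈ sides (polygon n K c) ↔
      (∃ i < K, δ = hollowDiag n (c i) (c (i + 1))) ∨ δ = hollowDiag n (c 0) (c K) := by
  have hle : ∀ {i j}, i ≤ j → j ≤ K → c i ≤ c j := fun {i j} hij hj =>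
    hc.monotoneOn (Set.mem_Iic.2 (hij.trans hj)) (Set.mem_Iic.2 hj) hij
  have hlt : ∀ {i j}, i < j → j ≤ K → c i < c j := fun {i j} hij hj =>
    hc (Set.mem_Iic.2 (hij.le.trans hj)) (Set.mem_Iic.2 hj) hij
  have hval : ∀ i ≤ K, (hollowPt n (c i)).val = 2 * c i + 1 := fun i hi =>
    hollowPt_val ((hle hi le_rfl).trans_lt hn)
  constructor
  · rintro ⟨v, hv, w, hw, hvw, hbt, rfl⟩
    obtain ⟨i, hi, rfl⟩ := mem_polygon.1 hv
    obtain ⟨j, hj, rfl⟩ := mem_polygon.1 hw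
    have hij : i ≠ j := by rintro rfl; exact hvw rfl
    rcases hi.lt_or_eq with hi' | rfl
    · left
      refine ⟨i, hi', ?_⟩
      -- Tested against the next vertex: unless `j = i + 1`, it would lie strictly between the two
      -- ends.
      have h1 := hbt _ (mem_polygon.2 ⟨i + 1, hi', rfl⟩)
      rw [sbtw_iff_val, hval i hi, hval j hj, hval (i + 1) hi'] at h1
      have h2 := hlt (Nat.lt_succ_self i) hi'
      rw [Nat.succ_eq_add_one] at h2
      rcases lt_trichotomy j (i + 1) with h3 | rfl | h3
      · have := hlt (show j < i by omega) hi
        omega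
      · rfl
      · have := hlt h3 hj
        omega
    · right
      have h1 := hbt _ (mem_polygon.2 ⟨0, Nat.zero_le _, rfl⟩)
      rw [sbtw_iff_val, hval i hi, hval j hj, hval 0 (Nat.zero_le _)] at h1
      rcases Nat.eq_zero_or_pos j with rfl | h3
      · exact Sym2.eq_swap
      · have := hlt h3 hj
        have := hlt (show j < i by omega) le_rfl
        omega
  · rintro (⟨i, hi, rfl⟩ | rfl)
    · refine ⟨_, mem_polygon.2 ⟨i, hi.le, rfl⟩, _, mem_polygon.2 ⟨i + 1, hi, rfl⟩, ?_, ?_, rfl⟩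
      · intro h
        have := congrArg ZMod.val h
        rw [hval i hi.le, hval (i + 1) hi] at this
        have := hlt (Nat.lt_succ_self i) hi
        rw [Nat.succ_eq_add_one] at this
        omega
      · intro u hu
        obtain ⟨k, hk, rfl⟩ := mem_polygon.1 hu
        rw [sbtw_iff_val, hval i hi.le, hval (i + 1) hi, hval k hk]
        rcases (show k ≤ i ∨ i + 1 ≤ k by omega) with h | h
        · have h1 := hle h hi.le
          have h2 := hlt (Nat.lt_succ_self i) hi
          rw [Nat.succ_eq_add_one] at h2
          omega
        · have h1 := hle h hk
          have h2 := hlt (Nat.lt_succ_self i) hi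
          rw [Nat.succ_eq_add_one] at h2
          omega
    · refine ⟨_, mem_polygon.2 ⟨K, le_rfl, rfl⟩, _, mem_polygon.2 ⟨0, Nat.zero_le _, rfl⟩, ?_, ?_,
        Sym2.eq_swap⟩
      · intro h
        have := congrArg ZMod.val h
        rw [hval K le_rfl, hval 0 (Nat.zero_le _)] at this
        have := hlt (show 0 < K from hK) le_rfl
        omega
      · intro u hu
        obtain ⟨k, hk, rfl⟩ := mem_polygon.1 hu
        rw [sbtw_iff_val, hval K le_rfl, hval 0 (Nat.zero_le _), hval k hk]
        have h1 := hle hk le_rfl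
        have h2 := hle (Nat.zero_le k) hk
        omega

lemma IsCellChain.strictMonoOn {E : ℕ → ℕ → Prop} (hE : IsLaminar n E) {p q K : ℕ} {c : ℕ → ℕ}
    (hc : IsCellChain E p q K c) : StrictMonoOn c (Set.Iic K) :=
  fun _ _ _ hj hij => hc.lt_of_lt hE hij hj

variable [NeZero n]

/-- A cell failing all three alternatives has `K + 1` edges, an even number, all inner; maximality
of the chain says that no diagonal of `D` subdivides it. -/
lemma noEvenCell_of_not_hasEvenInteriorCell (hn : 3 ≤ n) (hD : IsHollowDissection D)
    {K : ℕ → ℕ → ℕ} {c : ℕ → ℕ → ℕ → ℕ} (hS : IsCellSystem n (dissectionEdge D) K c)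
    (h : ¬ HasEvenInteriorCell D) : NoEvenCell n (dissectionEdge D) K c := by
  have hE := hS.toIsLaminar
  intro p q hpq h2
  by_contra hcon
  push Not at hcon
  obtain ⟨h3, h4, h5⟩ := hcon
  have hc := hS.chain hpq h2
  have hK := hc.two_le
  have hmono := hc.strictMonoOn hE
  have hq : c p q (K p q) < n := by rw [hc.last]; exact hE.bound hpq
  have hb : ∀ i ≤ K p q, c p q i < n := fun i hi =>
    lt_of_le_of_lt (hc.le_of_le hE hi le_rfl) hq
  have hinner : ∀ δ ∈ sides (polygon n (K p q) (c p q)), δ ∈ D := by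
    intro δ hδ
    rcases (mem_sides_polygon hmono hq (by omega)).1 hδ with ⟨i, hi, rfl⟩ | rfl
    · have h6 := hE.lt (hc.edge i hi)
      have h7 := hc.child_ne hE hi
      have h8 := h5 i hi
      have h9 := hb (i + 1) hi
      have h10 := hE.bound hpq
      exact ((isInner_dissectionEdge hD).1 ⟨hc.edge i hi, by omega, by omega⟩).2.2
    · rw [hc.first, hc.last]
      exact ((isInner_dissectionEdge hD).1 ⟨hpq, h2, fun h => h4 h.1 h.2⟩).2.2
  refine h ⟨polygon n (K p q) (c p q), ⟨?_, ?_, ?_, ?_⟩, ?_, hinner⟩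
  · rw [card_polygon hmono hq]
    omega
  · intro v hv
    obtain ⟨i, hi, rfl⟩ := mem_polygon.1 hv
    exact ⟨_, hollowPt_val (hb i hi)⟩
  · exact fun δ hδ => Or.inl (hinner δ hδ)
  · intro δ hδ hvert
    obtain ⟨r, s, hrs, rfl⟩ := exists_isInner hD hδ
    have hr := hE.lt hrs.1
    have hs := hE.bound hrs.1
    obtain ⟨i, hi, h6⟩ := mem_polygon.1 (hvert _ (Sym2.mem_mk_left _ _))
    obtain ⟨j, hj, h7⟩ := mem_polygon.1 (hvert _ (Sym2.mem_mk_right _ _))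
    obtain rfl := hollowPt_inj (by omega) (hb i hi) h6
    obtain rfl := hollowPt_inj hs (hb j hj) h7
    rw [mem_sides_polygon hmono hq (by omega)]
    by_cases h8 : c p q i = p ∧ c p q j = q
    · right
      rw [hc.first, hc.last, h8.1, h8.2]
    · left
      obtain ⟨k, hk, h9, h10⟩ := hc.maximal _ _ hrs.1 (hc.ge_first hE hi) (hc.le_last hE hj) h8
      rw [hc.le_iff hE hk.le hi] at h9
      rw [hc.le_iff hE hj hk] at h10
      rw [hc.lt_iff hE hi hj] at hr
      obtain ⟨rfl, rfl⟩ : i = k ∧ j = k + 1 := by omega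
      exact ⟨i, hk, rfl⟩
  · rw [card_polygon hmono hq, Nat.even_add_one]
    exact h3

lemma exists_polygon {C : Finset (ZMod (2 * n))} (hC : ∀ v ∈ C, Odd v.val) (hne : 0 < C.card) :
    ∃ K c, C = polygon n K c ∧ StrictMonoOn c (Set.Iic K) ∧ c K < n := by
  classical
  set V : Finset ℕ := (Finset.range n).filter fun i => hollowPt n i ∈ C with hV
  have hCV : C = V.image (hollowPt n) := by
    ext v
    constructor
    · intro hv
      obtain ⟨i, hi, rfl⟩ := exists_hollowPt (hC v hv)
      exact Finset.mem_image.2 ⟨i, Finset.mem_filter.2 ⟨Finset.mem_range.2 hi, hv⟩, rfl⟩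
    · intro hv
      obtain ⟨i, hi, rfl⟩ := Finset.mem_image.1 hv
      exact (Finset.mem_filter.1 hi).2
  have hVpos : 0 < V.card := by
    rw [Finset.card_pos]
    by_contra h
    rw [Finset.not_nonempty_iff_eq_empty] at h
    rw [hCV, h] at hne
    simp at hne
  obtain ⟨K, hK⟩ : ∃ K, V.card = K + 1 := ⟨V.card - 1, by omega⟩
  set f := V.orderEmbOfFin hK
  -- Indices beyond `K` wrap around; only those up to `K` are used.
  set c : ℕ → ℕ := fun i => f (Fin.ofNat (K + 1) i) with hc
  have hval : ∀ i ≤ K, (Fin.ofNat (K + 1) i).val = i := fun i hi => by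
    simp [Fin.ofNat, Nat.mod_eq_of_lt (Nat.lt_succ_of_le hi)]
  have hmem : ∀ i, c i ∈ V := fun i => Finset.orderEmbOfFin_mem _ _ _
  refine ⟨K, c, ?_, ?_, ?_⟩
  · rw [hCV]
    ext v
    rw [mem_polygon, Finset.mem_image]
    constructor
    · rintro ⟨i, hi, rfl⟩
      have : i ∈ Set.range f := by rw [Finset.range_orderEmbOfFin]; exact hi
      obtain ⟨k, rfl⟩ := this
      refine ⟨k, by omega, ?_⟩
      simp only [hc]
      congr 2
      exact Fin.ext (hval k (by omega)).symm
    · rintro ⟨i, _, rfl⟩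
      exact ⟨c i, hmem i, rfl⟩
  · intro i hi j hj hij
    refine f.strictMono (Fin.lt_def.2 ?_)
    rw [hval i hi, hval j hj]
    exact hij
  · exact Finset.mem_range.1 (Finset.mem_filter.1 (hmem K)).1

/-- An even interior cell gives a cell of the laminar family with inner edges. -/
lemma HasEvenInteriorCell.exists_chain (hn : 3 ≤ n) (hD : IsHollowDissection D)
    (h : HasEvenInteriorCell D) : ∃ p q K c, IsCellChain (dissectionEdge D) p q K c ∧
      ¬ Even K ∧ IsInner n (dissectionEdge D) p q ∧
        ∀ i < K, IsInner n (dissectionEdge D) (c i) (c (i + 1)) := by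
  have hE := isLaminar_dissectionEdge hn hD
  obtain ⟨C, ⟨h3, hodd, hsub, hdiv⟩, heven, hin⟩ := h
  obtain ⟨K, c, rfl, hmono, hcK⟩ := exists_polygon hodd (by omega)
  rw [card_polygon hmono hcK] at h3 heven
  have hK : 2 ≤ K := by omega
  have hle : ∀ {i j}, i ≤ j → j ≤ K → c i ≤ c j := fun {i j} hij hj =>
    hmono.monotoneOn (Set.mem_Iic.2 (hij.trans hj)) (Set.mem_Iic.2 hj) hij
  have hlt : ∀ {i j}, i < j → j ≤ K → c i < c j := fun {i j} hij hj =>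
    hmono (Set.mem_Iic.2 (hij.le.trans hj)) (Set.mem_Iic.2 hj) hij
  have hinner : ∀ i < K, IsInner n (dissectionEdge D) (c i) (c (i + 1)) := fun i hi =>
    (isInner_dissectionEdge hD).2 ⟨hlt (Nat.lt_succ_self i) hi, (hle hi le_rfl).trans_lt hcK,
      hin _ ((mem_sides_polygon hmono hcK (by omega)).2 (Or.inl ⟨i, hi, rfl⟩))⟩
  have hroot : IsInner n (dissectionEdge D) (c 0) (c K) :=
    (isInner_dissectionEdge hD).2 ⟨hlt (by omega) le_rfl, hcK,
      hin _ ((mem_sides_polygon hmono hcK (by omega)).2 (Or.inr rfl))⟩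
  refine ⟨c 0, c K, K, c, ⟨hK, rfl, rfl, fun i hi => (hinner i hi).1, ?_⟩,
    by rwa [Nat.even_add_one] at heven, hroot, hinner⟩
  intro r s hrs h4 h5 h6
  have hlt' := hE.lt hrs
  have block : ∀ x, c 0 ≤ x → x < c K → ∃ i < K, c i ≤ x ∧ x < c (i + 1) := by
    intro x hx0 hxK
    have : ∀ j ≤ K, x < c j → ∃ i < j, c i ≤ x ∧ x < c (i + 1) := by
      intro j
      induction j with
      | zero => intro _ h; omega
      | succ j ih =>
        intro hj h
        rcases lt_or_ge x (c j) with h3 | h3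
        · obtain ⟨i, hi, h⟩ := ih (by omega) h3
          exact ⟨i, by omega, h⟩
        · exact ⟨j, by omega, h3, h⟩
    exact this K le_rfl hxK
  obtain ⟨i, hi, h7, h8⟩ := block r h4 (by omega)
  refine ⟨i, hi, h7, ?_⟩
  by_contra h9
  rcases h7.lt_or_eq with h7 | rfl
  · exact hE.noncross (hinner i hi).1 hrs h7 h8 (by omega)
  -- the right end of the chord is a vertex
  obtain ⟨j, hj, rfl⟩ : ∃ j ≤ K, s = c j := by
    rcases h5.lt_or_eq with h5 | rfl
    · obtain ⟨j, hj, h10, h11⟩ := block s (by omega) h5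
      rcases h10.lt_or_eq with h10 | rfl
      · refine absurd (hE.noncross hrs (hinner j hj).1 ?_ h10 h11) id
        have : i + 1 ≤ j := by
          by_contra h12
          have := hle (show j + 1 ≤ i + 1 by omega) hi
          omega
        exact hlt this hj.le
      · exact ⟨j, hj.le, rfl⟩
    · exact ⟨K, le_rfl, rfl⟩
  have hij : i + 1 < j := by
    by_contra h10
    exact h9 (hle (by omega) hi)
  have hgap := hlt (Nat.lt_succ_self i) hi
  have hgap' := hlt hij hj
  rw [Nat.succ_eq_add_one] at hgap
  have hK0 : ¬ (i = 0 ∧ j = K) := by rintro ⟨rfl, rfl⟩; exact h6 ⟨rfl, rfl⟩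
  have hDrs : hollowDiag n (c i) (c j) ∈ D := by
    refine ((isInner_dissectionEdge hD).1 ⟨hrs, by omega, ?_⟩).2.2
    rintro ⟨h10, h11⟩
    refine hK0 ⟨?_, ?_⟩
    · by_contra h12
      have := hlt (Nat.pos_of_ne_zero h12) hi.le
      omega
    · by_contra h12
      have := hlt (show j < K by omega) le_rfl
      omega
  -- A diagonal of `D` joining two vertices of the cell must be a side, but `c i` and `c j` are
  -- neither consecutive nor the two extreme vertices.
  have hside := hdiv _ hDrs (by
    intro v hv
    rcases Sym2.mem_iff.1 hv with rfl | rfl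
    · exact mem_polygon.2 ⟨i, hi.le, rfl⟩
    · exact mem_polygon.2 ⟨j, hj, rfl⟩)
  have hbj := (hle hj le_rfl).trans_lt hcK
  rcases (mem_sides_polygon hmono hcK (by omega)).1 hside with ⟨k, hk, h10⟩ | h10
  · obtain ⟨h11, h12⟩ := hollowDiag_inj hlt' hbj (hlt (Nat.lt_succ_self k) hk)
      ((hle hk le_rfl).trans_lt hcK) h10
    have h13 := hmono.injOn (Set.mem_Iic.2 hi.le) (Set.mem_Iic.2 hk.le) h11
    have h14 := hmono.injOn (Set.mem_Iic.2 hj) (Set.mem_Iic.2 hk) h12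
    omega
  · obtain ⟨h11, h12⟩ := hollowDiag_inj hlt' hbj (hlt (by omega) le_rfl) hcK h10
    exact hK0 ⟨hmono.injOn (Set.mem_Iic.2 hi.le) (Set.mem_Iic.2 (Nat.zero_le _)) h11,
      hmono.injOn (Set.mem_Iic.2 hj) (Set.mem_Iic.2 le_rfl) h12⟩

end EvenCells

/-! ### The two directions -/

section Fan

variable {n : ℕ} {D : Finset (Diag n)}

/-- A positive coordinate comes from a chord of positive weight. -/
lemma exists_chordCompat_eq_one {w : ℕ → ℕ → ℝ} (hw : ∀ a b, 0 ≤ w a b) {p q : ℕ}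
    (h : 0 < coord n w p q) : ∃ a b, w a b ≠ 0 ∧ chordCompat p q a b = 1 := by
  by_contra! hcon
  refine h.not_ge (Finset.sum_nonpos fun a _ => Finset.sum_nonpos fun b _ => ?_)
  by_cases h0 : w a b = 0
  · rw [h0, zero_mul]
  · refine mul_nonpos_of_nonneg_of_nonpos (hw a b) ?_
    have := hcon a b h0
    unfold chordCompat at this ⊢
    split_ifs at this ⊢ <;> simp_all

/-- If the generators of a cone have equal coordinates at two places, so have all its vectors. -/
lemma apply_eq_of_mem_dCone {A : Finset (Diag n)} {δ δ' : D}
    (h : ∀ ε ∈ A, dVector D ε δ = dVector D ε δ') {y : D → ℝ} (hy : y ∈ dCone D A) :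
    y δ = y δ' := by
  induction hy using Submodule.span_induction with
  | mem x hx =>
    obtain ⟨ε, hε, rfl⟩ := hx
    exact h ε hε
  | zero => rfl
  | add x y _ _ hx hy => rw [Pi.add_apply, Pi.add_apply, hx, hy]
  | smul a x _ hx => exact congrArg (fun t => (a : ℝ) * t) hx

/-- An even interior cell yields two cones that do not meet along a face. -/
lemma not_isCompleteSimplicialFan_dVectorFan (hn : 3 ≤ n) (hD : IsHollowDissection D)
    (h : HasEvenInteriorCell D) : ¬ IsCompleteSimplicialFan (dVectorFan D) := by
  classical
  have : NeZero n := ⟨by omega⟩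
  intro hF
  have hE := isLaminar_dissectionEdge hn hD
  obtain ⟨p, q, K₀, c₀, hch, hodd, hroot, hinner⟩ := h.exists_chain hn hD
  obtain ⟨K, c, hS, rfl, rfl⟩ := hE.exists_cellSystem_extending hch
  have hK : 3 ≤ K p q := by
    have h2 := hch.two_le
    by_contra h3
    exact hodd ⟨1, by omega⟩
  have hfam : ∀ j, j = 0 ∨ j = 1 → ∃ A Λ, IsAccordionDissection D A ∧
      IsConicRep (dVector D) A Λ (fun _ => 1) ∧ (∀ ε ∈ A, Λ ε ≠ 0) ∧
      ∀ a b, chordWeight Λ a b ≠ 0 → chordCompat (c p q j) (c p q (j + 1)) a b =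
        chordCompat (c p q (j + 1)) (c p q (j + 2)) a b := by
    intro j hj
    obtain ⟨w, hw, hwx, hwc⟩ := exists_family_even_cell hn hS hroot.1 hroot.2.1 hodd
      (x := fun _ _ => 1) (innerPart_of_isInner hroot)
      (fun i hi => innerPart_of_isInner (hinner i hi)) (fun i hi => (hinner i hi).2.1) hj
    obtain ⟨A, Λ, hA, hΛ, rfl⟩ := hw.exists_conicRep hD (y := fun _ => 1) fun r s hδ hrs hs =>
      hwx r s ((isInner_dissectionEdge hD).2 ⟨hrs, hs, hδ⟩)
    -- Restricting to the support makes the equality of compatibility degrees valid for every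
    -- generator of the cone.
    refine ⟨A.filter fun ε => Λ ε ≠ 0, Λ, hA.subset (Finset.filter_subset _ _),
      hΛ.mono fun ε hε => Finset.mem_filter.2 ⟨?_, hε⟩, fun ε hε => (Finset.mem_filter.1 hε).2,
      hwc⟩
    by_contra h0
    exact hε (hΛ.supp ε h0)
  obtain ⟨A, Λ, hA, hΛ, hΛ0, hcA⟩ := hfam 0 (Or.inl rfl)
  obtain ⟨B, M, hB, hM, -, hcB⟩ := hfam 1 (Or.inr rfl)
  have hfamB := isAccordionFamily_chordWeight hD hB hM.nonneg hM.supp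
  obtain ⟨a1, a2, a3⟩ := (isInner_dissectionEdge hD).1 (hinner 0 (by omega))
  obtain ⟨b1, b2, b3⟩ := (isInner_dissectionEdge hD).1 (hinner 1 (by omega))
  have h23 := hE.lt (hinner 2 (by omega)).1
  have hcoord : coord n (chordWeight M) (c p q 1) (c p q (1 + 1)) = 1 := by
    rw [← sum_dVector_apply (fun ε => hB.isSolid_of_ne_zero hM.supp) b1 b2 b3, hM.sum]
  obtain ⟨a, b, hab, hab1⟩ := exists_chordCompat_eq_one hfamB.nonneg (hcoord ▸ one_pos)
  have hsupp := hfamB.supp a b hab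
  have hlt : a < b ∧ b < n := ⟨by omega, hsupp.2.1⟩
  have hMab : M (solidDiag n a b) ≠ 0 := by
    rwa [chordWeight, if_pos hlt] at hab
  -- The intersection contains the all-ones vector. As a face of the cone of `B`, it contains every
  -- generator with nonzero coefficient in a representation of that vector.
  have hmem : dVector D (solidDiag n a b) ∈ dCone D B ⊓ dCone D A :=
    hM.generator_mem (hF.inter_face _ ⟨B, hB, rfl⟩ _ ⟨A, hA, rfl⟩).1
      ⟨hM.mem_hull, hΛ.mem_hull⟩ hMab
  have heq := apply_eq_of_mem_dCone (δ := ⟨_, a3⟩) (δ' := ⟨_, b3⟩) (fun ε hε => by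
    obtain ⟨r, s, hrs, hs, rfl⟩ := isSolid_iff.1 (hA.1 ε hε).1.1
    have h0 := hΛ0 _ hε
    have := hcA r s (by rwa [chordWeight, if_pos ⟨hrs, hs⟩])
    simpa only [dVector, compat_eq a1 a2 hrs hs, compat_eq b1 b2 hrs hs] using this) hmem.2
  simp only [dVector, compat_eq a1 a2 hlt.1 hlt.2, compat_eq b1 b2 hlt.1 hlt.2] at heq
  have h12 := hcB a b hab
  rw [hab1] at heq h12
  -- The chord has degree one at three consecutive edges, hence an end strictly inside each of three
  -- disjoint intervals.
  simp only [Nat.reduceAdd, chordCompat] at a1 b1 h23 heq hab1 h12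
  split_ifs at heq hab1 h12 <;> first | omega | linarith

/-- Without even interior cells every vector is a unique nonnegative combination of
compatibility vectors of an accordion dissection. -/
lemma isCompleteSimplicialFan_dVectorFan (hn : 3 ≤ n) (hD : IsHollowDissection D)
    (h : ¬ HasEvenInteriorCell D) : IsCompleteSimplicialFan (dVectorFan D) ∧
      ∀ A, IsAccordionDissection D A → ∀ B, IsAccordionDissection D B →
        (dCone D A ≤ dCone D B ↔ A ⊆ B) := by
  classical
  have : NeZero n := ⟨by omega⟩
  obtain ⟨K, c, hS⟩ := (isLaminar_dissectionEdge hn hD).exists_cellSystem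
  have hne := noEvenCell_of_not_hasEvenInteriorCell hn hD hS h
  refine isCompleteSimplicialFan_of_unique (v := dVector D)
    (Δ := {A | IsAccordionDissection D A}) (fun A hA B hBA => hA.subset hBA) (fun y => ?_)
    fun A hA B hB Λ Λ' y hΛ hΛ' => ?_
  -- The value zero off `D` is irrelevant, as only coordinates at inner chords are prescribed.
  · obtain ⟨w, hw, hwx⟩ := exists_accordionFamily hn hS fun p q =>
      if hpq : hollowDiag n p q ∈ D then y ⟨_, hpq⟩ else 0
    obtain ⟨A, Λ, hA, hΛ, -⟩ := hw.exists_conicRep hD (y := y) fun p q hδ hpq hq => by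
      rw [hwx p q ((isInner_dissectionEdge hD).2 ⟨hpq, hq, hδ⟩), dif_pos hδ]
    exact ⟨A, hA, Λ, hΛ⟩
  · have hs := fun ε => hA.isSolid_of_ne_zero hΛ.supp (ε := ε)
    have hs' := fun ε => hB.isSolid_of_ne_zero hΛ'.supp (ε := ε)
    refine chordWeight_injective hs hs' (IsAccordionFamily.unique hn hS hne
      (isAccordionFamily_chordWeight hD hA hΛ.nonneg hΛ.supp)
      (isAccordionFamily_chordWeight hD hB hΛ'.nonneg hΛ'.supp) fun p q hpq => ?_)
    obtain ⟨h1, h2, h3⟩ := (isInner_dissectionEdge hD).1 hpq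
    rw [← sum_dVector_apply hs h1 h2 h3, ← sum_dVector_apply hs' h1 h2 h3, hΛ.sum, hΛ'.sum]

end Fan

end Accordion

theorem mainTheorem3 (n : ℕ) (hn : 3 ≤ n) (D : Finset (Accordion.Diag n))
    (hD : Accordion.IsHollowDissection D) :
    (Accordion.IsCompleteSimplicialFan (Accordion.dVectorFan D) ↔
        ¬ Accordion.HasEvenInteriorCell D) ∧
      (¬ Accordion.HasEvenInteriorCell D →
        ∀ A B : Finset (Accordion.Diag n),
          Accordion.IsAccordionDissection D A → Accordion.IsAccordionDissection D B →
            (Accordion.dCone D A ≤ Accordion.dCone D B ↔ A ⊆ B)) :=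
  ⟨⟨fun hF h => Accordion.not_isCompleteSimplicialFan_dVectorFan hn hD h hF,
    fun h => (Accordion.isCompleteSimplicialFan_dVectorFan hn hD h).1⟩,
    fun h A B hA hB => (Accordion.isCompleteSimplicialFan_dVectorFan hn hD h).2 A hA B hB⟩
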